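/- Let $(M,g)$ be a smooth Riemannian manifold (Hausdorff, without boundary) of dimension $n$, $\nabla^L$ its Levi-Civita connection, also on the bundle $\wedge^*T^*M$ of real differential forms, and let $v$ be a smooth vector field on $M$ with dual one-form $v^*=g(v,\cdot)$. Let $d$ be the de Rham derivative, $\delta=d^*$ its formal $L^2$-adjoint, $\varepsilon$ and $l$ exterior and interior multiplication, $c(w)=\varepsilon(w^*)-l(w)$ and $\bar c(w)=\varepsilon(w^*)+l(w)$, and set, on smooth forms, $$D_v=d+\delta+l(v),\qquad D_v^*=d+\delta+\varepsilon(v^*).$$ Let $R_{ijkl}=g(R(e_i,e_j)e_k,e_l)$ with $R(X,Y)=\nabla^L_X\nabla^L_Y-\nabla^L_Y\nabla^L_X-\nabla^L_{[X,Y]}$, let $s=\sum_{i,j}g(R(e_i,e_j)e_j,e_i)$ be the scalar curvature, and for a field $A$ of endomorphisms of $\wedge^*T^*M$ let $\nabla^{TM}_u(A)=[\nabla^L_u,A]$. For each operator $P\in\{D_v^2,\ (D_v^*)^2,\ D_v^*D_v\}$ there is a unique connection $\nabla=\nabla^P$ on $\wedge^*T^*M$ such that, in all coordinates, $P=-\big[\sum_{i,j}g^{ij}(\nabla_{\partial_i}\nabla_{\partial_j}-\nabla_{\nabla^L_{\partial_i}\partial_j})+E'\big]$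 for some field $E'$ of endomorphisms, namely $$\nabla_u=\nabla^L_u-\tfrac12\big[c(u)l(v)+l(v)c(u)\big],\quad \nabla_u=\nabla^L_u-\tfrac12\big[c(u)\varepsilon(v^*)+\varepsilon(v^*)c(u)\big],\quad \nabla_u=\nabla^L_u-\tfrac12\big[c(u)l(v)+\varepsilon(v^*)c(u)\big]$$ respectively. With this $\nabla$ (depending on the operator), for every coordinate system and every smooth local orthonormal frame $e_1,\dots,e_n$, on the common domain of the two, $$\begin{aligned} D_v^2={}&-\sum_{i,j}g^{ij}(\nabla_{\partial_i}\nabla_{\partial_j}-\nabla_{\nabla^L_{\partial_i}\partial_j})-\tfrac18\sum_{i,j,k,l}R_{ijkl}\bar c(e_i)\bar c(e_j)c(e_k)c(e_l)+\tfrac14 s\\ &+\tfrac14\sum_i[c(e_i)l(v)+l(v)c(e_i)]^2-\tfrac12\sum_j\big[\nabla^{TM}_{e_j}(l(v))c(e_j)-c(e_j)\nabla^{TM}_{e_j}(l(v))\big],\\ (D_v^*)^2={}&-\sum_{i,j}g^{ij}(\nabla_{\partial_i}\nabla_{\partial_j}-\nabla_{\nabla^L_{\partial_i}\partial_j})-\tfrac18\sum_{i,j,k,l}R_{ijkl}\bar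 c(e_i)\bar c(e_j)c(e_k)c(e_l)+\tfrac14 s\\ &+\tfrac14\sum_i[c(e_i)\varepsilon(v^*)+\varepsilon(v^*)c(e_i)]^2-\tfrac12\sum_j\big[\nabla^{TM}_{e_j}(\varepsilon(v^*))c(e_j)-c(e_j)\nabla^{TM}_{e_j}(\varepsilon(v^*))\big],\\ D_v^*D_v={}&-\sum_{i,j}g^{ij}(\nabla_{\partial_i}\nabla_{\partial_j}-\nabla_{\nabla^L_{\partial_i}\partial_j})-\tfrac18\sum_{i,j,k,l}R_{ijkl}\bar c(e_i)\bar c(e_j)c(e_k)c(e_l)+\tfrac14 s+\varepsilon(v^*)l(v)\\ &+\tfrac14\sum_i[c(e_i)l(v)+\varepsilon(v^*)c(e_i)]^2-\tfrac12\sum_j\big[\nabla^{TM}_{e_j}(\varepsilon(v^*))c(e_j)-c(e_j)\nabla^{TM}_{e_j}(l(v))\big]. \end{aligned}$$ -/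

import Mathlib

open Bundle Manifold Set
open scoped ContDiff Topology

noncomputable section

namespace StatHodge

/-! ### Linear algebra of the exterior algebra of the dual of a finite-dimensional space -/

section LinearAlgebra

variable {V : Type*} [NormedAddCommGroup V] [NormedSpace ℝ V]

/-- The exterior algebra `∧* V*` as the family of the spaces of alternating `k`-linear forms on `V`.
When `V` has dimension `n`, the components of degree `k > n` are zero. -/
abbrev Ext (V : Type*) [NormedAddCommGroup V] [NormedSpace ℝ V] : Type _ :=
  (k : ℕ) → V [⋀^Fin k]→L[ℝ] ℝ

/-- Exterior multiplication `ε(α) η = α ∧ η` by a covector `α`, that is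
`(α ∧ η)(w₀, …, w_k) = ∑ᵢ (-1)ⁱ α(wᵢ) η(w₀, …, ŵᵢ, …, w_k)`. -/
def wedge (α : V →L[ℝ] ℝ) : Module.End ℝ (Ext V) where
  toFun η := fun k ↦ match k with
    | 0 => 0
    | k + 1 => ContinuousAlternatingMap.alternatizeUncurryFin (α.smulRight (η k))
  map_add' η ζ := by
    funext k
    cases k with
    | zero => simp
    | succ k =>
      ext w
      simp [ContinuousAlternatingMap.alternatizeUncurryFin_apply, Finset.sum_add_distrib]
  map_smul' c η := by
    funext k
    cases k with
    | zero => simp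
    | succ k =>
      ext w
      simp only [ContinuousAlternatingMap.alternatizeUncurryFin_apply, Pi.smul_apply,
        ContinuousAlternatingMap.smul_apply, ContinuousLinearMap.smulRight_apply, RingHom.id_apply,
        Finset.smul_sum]
      refine Finset.sum_congr rfl fun i _ ↦ ?_
      simp only [smul_eq_mul, zsmul_eq_mul]
      ring

/-- Interior multiplication (contraction) `(l(v) η)(w₁, …, w_k) = η(v, w₁, …, w_k)`. -/
def contract (v : V) : Module.End ℝ (Ext V) where
  toFun η := fun k ↦ (η (k + 1)).curryLeft v
  map_add' η ζ := by funext k; ext w; simp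
  map_smul' c η := by funext k; ext w; simp

/-- The derivation action of an endomorphism `A` of `V` on forms,
`(A · η)(w₁, …, w_k) = ∑ᵢ η(w₁, …, A wᵢ, …, w_k)`; see `derivAction_apply`. -/
def derivAction (A : V →L[ℝ] V) (η : Ext V) : Ext V := fun k ↦ match k with
  | 0 => 0
  | k + 1 => ContinuousAlternatingMap.alternatizeUncurryFin ((η (k + 1)).curryLeft ∘L A)

theorem derivAction_apply (A : V →L[ℝ] V) (η : Ext V) (k : ℕ) (w : Fin k → V) :
    derivAction A η k w = ∑ i, η k (Function.update w i (A (w i))) := by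
  cases k with
  | zero => simp [derivAction]
  | succ k =>
    simp only [derivAction, ContinuousAlternatingMap.alternatizeUncurryFin_apply]
    refine Finset.sum_congr rfl fun i _ ↦ ?_
    have h := (η (k + 1)).toAlternatingMap.map_insertNth i (A (w i)) (i.removeNth w)
    have h2 : i.insertNth (A (w i)) (i.removeNth w) = Function.update w i (A (w i)) := by
      simp
    rw [h2] at h
    simpa [Matrix.vecCons] using h.symm

end LinearAlgebra

section Clifford

variable {V : Type*} [NormedAddCommGroup V] [InnerProductSpace ℝ V]

/-- `ε(v*)`, where `v* = ⟨v, ·⟩` is the covector dual to `v`. -/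
def wedgeDual (v : V) : Module.End ℝ (Ext V) := wedge (innerSL ℝ v)

/-- The Clifford action `c(v) = ε(v*) - l(v)`. -/
def cliff (v : V) : Module.End ℝ (Ext V) := wedgeDual v - contract v

/-- The Clifford action `c̄(v) = ε(v*) + l(v)`. -/
def cliffBar (v : V) : Module.End ℝ (Ext V) := wedgeDual v + contract v

/-- The inner product on `∧* V*` induced by the one on `V`: for an orthonormal basis `b`,
`⟨η, ζ⟩ = ∑ₖ ∑_{i₁ < … < i_k} η(b_{i₁}, …, b_{i_k}) ζ(b_{i₁}, …, b_{i_k})`, written as `1 / k!`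
times the sum over all multi-indices. -/
def extInner [FiniteDimensional ℝ V] (η ζ : Ext V) : ℝ :=
  ∑ k ∈ Finset.range (Module.finrank ℝ V + 1), ((k.factorial : ℝ))⁻¹ *
    ∑ f : Fin k → Fin (Module.finrank ℝ V),
      η k (fun i ↦ stdOrthonormalBasis ℝ V (f i)) * ζ k (fun i ↦ stdOrthonormalBasis ℝ V (f i))

end Clifford

/-! ### Riemannian manifolds: vector fields, forms, Levi-Civita connection -/

/-- The model space `ℝⁿ`. -/
abbrev Model (n : ℕ) : Type := EuclideanSpace ℝ (Fin n)

variable {n : ℕ} {M : Type*} [TopologicalSpace M] [ChartedSpace (Model n) M]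

/-- The tangent space of the `n`-manifold `M` at `x`. -/
abbrev TSp (n : ℕ) {M : Type*} [TopologicalSpace M] [ChartedSpace (Model n) M] (x : M) : Type :=
  TangentSpace 𝓘(ℝ, Model n) x

/-- A (not necessarily smooth) vector field. -/
abbrev VField (n : ℕ) (M : Type*) [TopologicalSpace M] [ChartedSpace (Model n) M] : Type _ :=
  (x : M) → TSp n x

/-- Smoothness of a vector field on a set. -/
def VField.SmoothOn [IsManifold 𝓘(ℝ, Model n) ∞ M] (X : VField n M) (U : Set M) : Prop :=
  ContMDiffOn 𝓘(ℝ, Model n) 𝓘(ℝ, Model n).tangent ∞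
    (fun x ↦ (⟨x, X x⟩ : TangentBundle 𝓘(ℝ, Model n) M)) U

/-- The charts of the smooth structure of `M` (its maximal atlas). -/
def Charts (n : ℕ) (M : Type*) [TopologicalSpace M] [ChartedSpace (Model n) M] :
    Set (OpenPartialHomeomorph M (Model n)) :=
  IsManifold.maximalAtlas 𝓘(ℝ, Model n) ∞ M

/-- The differential at `x` of a chart `φ`. -/
def chartD (φ : OpenPartialHomeomorph M (Model n)) (x : M) : TSp n x →L[ℝ] Model n :=
  mfderiv 𝓘(ℝ, Model n) 𝓘(ℝ, Model n) φ x

/-- The coordinate vector field `∂ᵢ` of a chart `φ`. -/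
def coordField (φ : OpenPartialHomeomorph M (Model n)) (i : Fin n) : VField n M :=
  fun x ↦ (chartD φ x).inverse (EuclideanSpace.single i 1)

variable [RiemannianBundle (fun x : M ↦ TangentSpace 𝓘(ℝ, Model n) x)]

/-- A (not necessarily smooth) differential form of mixed degree on `M`. -/
abbrev DForm (n : ℕ) (M : Type*) [TopologicalSpace M] [ChartedSpace (Model n) M]
    [RiemannianBundle (fun x : M ↦ TangentSpace 𝓘(ℝ, Model n) x)] : Type _ :=
  (x : M) → Ext (TSp n x)

/-- The degree `k` part of the form `θ` in the chart `φ`: the pullback of `θ` by `φ⁻¹`. -/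
def coordForm (φ : OpenPartialHomeomorph M (Model n)) (θ : DForm n M) (k : ℕ) :
    Model n → (Model n) [⋀^Fin k]→L[ℝ] ℝ :=
  fun y ↦ (θ (φ.symm y) k).compContinuousLinearMap
    (mfderiv 𝓘(ℝ, Model n) 𝓘(ℝ, Model n) φ.symm y : Model n →L[ℝ] TSp n (φ.symm y))

/-- Smoothness of a form on a set `U` (which is open whenever this is used): in every chart,
all components are smooth. -/
def DForm.SmoothOn (θ : DForm n M) (U : Set M) : Prop :=
  ∀ φ ∈ Charts n M, ∀ k : ℕ,
    ContDiffOn ℝ ∞ (coordForm φ θ k) (φ.target ∩ φ.symm ⁻¹' U)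

/-- The de Rham derivative `d`, computed at `x` in the preferred chart at `x`. -/
def extD (θ : DForm n M) : DForm n M := fun x k ↦ match k with
  | 0 => 0
  | k + 1 => (extDeriv (coordForm (chartAt (Model n) x) θ k)
      (chartAt (Model n) x x)).compContinuousLinearMap (chartD (chartAt (Model n) x) x)

/-- The matrix `(g_{ij})` of the metric at `x` in the chart `φ`. -/
def metricMatrix (φ : OpenPartialHomeomorph M (Model n)) (x : M) : Matrix (Fin n) (Fin n) ℝ :=
  Matrix.of fun i j ↦ inner ℝ (coordField φ i x) (coordField φ j x)

/-- The integral over the domain of the chart `φ` of a function `f` with respect to the Riemannian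
volume `√det(g_{ij}) dx₁ ⋯ dxₙ`. -/
def chartIntegral (φ : OpenPartialHomeomorph M (Model n)) (f : M → ℝ) : ℝ :=
  ∫ y in φ.target, f (φ.symm y) * Real.sqrt (metricMatrix φ (φ.symm y)).det

instance tangentFiniteDimensional (x : M) : FiniteDimensional ℝ (TSp n x) :=
  inferInstanceAs (FiniteDimensional ℝ (Model n))

/-- `η = δ θ` for the formal adjoint `δ = d*` of the de Rham derivative: `η` is smooth and the
`L²` inner products satisfy `(d α, θ) = (α, η)` for all smooth test forms `α` that are supported in
a compact subset of a coordinate domain. -/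
def IsCodiff (θ η : DForm n M) : Prop :=
  η.SmoothOn univ ∧
  ∀ φ ∈ Charts n M, ∀ α : DForm n M, α.SmoothOn univ →
    (∃ K : Set M, IsCompact K ∧ K ⊆ φ.source ∧ ∀ x ∉ K, α x = 0) →
    chartIntegral φ (fun x ↦ extInner (extD α x) (θ x)) =
      chartIntegral φ (fun x ↦ extInner (α x) (η x))

open Classical in
/-- The de Rham coderivative `δ = d*` on smooth forms: `δ θ` is the form `η` with
`(d α, θ) = (α, η)` for all test forms `α`. -/
def codiff (θ : DForm n M) : DForm n M :=
  if h : ∃ η : DForm n M, IsCodiff θ η then h.choose else 0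

/-- `D_v = d + δ + l(v)`. -/
def opD (v : VField n M) (θ : DForm n M) : DForm n M :=
  fun x ↦ extD θ x + codiff θ x + contract (v x) (θ x)

/-- `D_v^* = d + δ + ε(v*)`. -/
def opDStar (v : VField n M) (θ : DForm n M) : DForm n M :=
  fun x ↦ extD θ x + codiff θ x + wedgeDual (v x) (θ x)

section Connection

variable [IsManifold 𝓘(ℝ, Model n) ∞ M]
  [IsContMDiffRiemannianBundle 𝓘(ℝ, Model n) ∞ (Model n)
    (fun x : M ↦ TangentSpace 𝓘(ℝ, Model n) x)]

/-- A connection on the tangent bundle `TM`; `cov Y x u` is `∇_u Y` at `x`. -/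
abbrev TConn (n : ℕ) (M : Type*) [TopologicalSpace M] [ChartedSpace (Model n) M]
    [IsManifold 𝓘(ℝ, Model n) ∞ M] : Type _ :=
  CovariantDerivative 𝓘(ℝ, Model n) (Model n) (fun x : M ↦ TangentSpace 𝓘(ℝ, Model n) x)

set_option synthInstance.maxHeartbeats 400000 in
/-- The Levi-Civita connection: the torsion-free metric connection. -/
structure IsLeviCivita (cov : TConn n M) : Prop where
  torsion_eq_zero : cov.torsion = 0
  metric : cov.IsMetricCompatible

/-- The connection on `∧* T*M` induced by `cov`: with `w ↦ ∑ⱼ dxⱼ(w) ∇_u ∂ⱼ` the connection form in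
the preferred chart at `x`,
`(∇_u θ)(w₁, …, w_k) = (u θ)(w₁, …, w_k) - ∑ᵢ θ(w₁, …, ∑ⱼ dxⱼ(wᵢ) ∇_u ∂ⱼ, …, w_k)`, where `u θ` is
the derivative of the components of `θ` in that chart. -/
def formCov (cov : TConn n M) (θ : DForm n M) (x : M) (u : TSp n x) : Ext (TSp n x) :=
  let φ := chartAt (Model n) x
  let Γ : TSp n x →L[ℝ] TSp n x :=
    ∑ j : Fin n, ((EuclideanSpace.proj j : Model n →L[ℝ] ℝ) ∘L chartD φ x).smulRight
      (cov (coordField φ j) x u)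
  (fun k ↦ (fderiv ℝ (coordForm φ θ k) (φ x) (chartD φ x u)).compContinuousLinearMap (chartD φ x))
    - derivAction Γ (θ x)

/-- The covariant derivative `∇_u A` of a field `A` of endomorphisms of `∧* T*M`, applied to a form:
`(∇_u A) θ = ∇_u (A θ) - A (∇_u θ)`. -/
def endCov (cov : TConn n M) (A : (x : M) → Module.End ℝ (Ext (TSp n x)))
    (x : M) (u : TSp n x) (θ : DForm n M) : Ext (TSp n x) :=
  formCov cov (fun y ↦ A y (θ y)) x u - A x (formCov cov θ x u)

/-- The curvature tensor `R(X,Y)Z = ∇_X ∇_Y Z - ∇_Y ∇_X Z - ∇_{[X,Y]} Z`, on tangent vectors at `x`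
that are extended to vector fields near `x`. -/
def curv (cov : TConn n M) (x : M) (u v w : TSp n x) : TSp n x :=
  let X : VField n M := FiberBundle.extend (Model n) u
  let Y : VField n M := FiberBundle.extend (Model n) v
  let Z : VField n M := FiberBundle.extend (Model n) w
  cov (fun y ↦ cov Z y (Y y)) x (X x) - cov (fun y ↦ cov Z y (X y)) x (Y x)
    - cov Z x (VectorField.mlieBracket 𝓘(ℝ, Model n) X Y x)

/-- The scalar curvature `s = ∑ᵢⱼ ⟨R(eᵢ,eⱼ)eⱼ, eᵢ⟩`. -/
def scalarCurv (cov : TConn n M) (x : M) : ℝ :=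
  let b := stdOrthonormalBasis ℝ (TSp n x)
  ∑ i, ∑ j, inner ℝ (curv cov x (b i) (b j) (b j)) (b i)

/-- The operator `∑ R_{ijkl} c̄(eᵢ) c̄(eⱼ) c(e_k) c(e_l)` at `x`, with
`R_{ijkl} = ⟨R(eᵢ,eⱼ)e_k, e_l⟩`. -/
def curvClifford (cov : TConn n M) (x : M) (e : Fin n → TSp n x) : Module.End ℝ (Ext (TSp n x)) :=
  ∑ i, ∑ j, ∑ k, ∑ l, (inner ℝ (curv cov x (e i) (e j) (e k)) (e l) : ℝ) •
    (cliffBar (e i) * cliffBar (e j) * cliff (e k) * cliff (e l))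

/-- A smooth local orthonormal frame `e₁, …, eₙ` on an open set `U`. -/
structure IsOrthonormalFrame (e : Fin n → VField n M) (U : Set M) : Prop where
  isOpen : IsOpen U
  smooth : ∀ i, (e i).SmoothOn U
  orthonormal : ∀ x ∈ U, Orthonormal ℝ (fun i ↦ e i x)

/-- The type of operators `∇`, with `∇ θ x u` to be read as `∇_u θ` at `x`. -/
abbrev FormOp (n : ℕ) (M : Type*) [TopologicalSpace M] [ChartedSpace (Model n) M]
    [RiemannianBundle (fun x : M ↦ TangentSpace 𝓘(ℝ, Model n) x)] : Type _ :=
  DForm n M → (x : M) → TSp n x → Ext (TSp n x)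

/-- `nab` is a smooth connection on the vector bundle `∧* T*M`. -/
structure IsFormConnection (nab : FormOp n M) : Prop where
  linear : ∀ U : Set M, IsOpen U → ∀ θ : DForm n M, θ.SmoothOn U → ∀ x ∈ U,
    ∀ (a : ℝ) (u w : TSp n x), nab θ x (a • u + w) = a • nab θ x u + nab θ x w
  add : ∀ U : Set M, IsOpen U → ∀ θ η : DForm n M, θ.SmoothOn U → η.SmoothOn U → ∀ x ∈ U,
    ∀ u : TSp n x, nab (θ + η) x u = nab θ x u + nab η x u
  leibniz : ∀ U : Set M, IsOpen U → ∀ θ : DForm n M, θ.SmoothOn U →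
    ∀ f : M → ℝ, ContMDiffOn 𝓘(ℝ, Model n) 𝓘(ℝ, ℝ) ∞ f U → ∀ x ∈ U, ∀ u : TSp n x,
      nab (fun y ↦ f y • θ y) x u
        = f x • nab θ x u + mvfderiv 𝓘(ℝ, Model n) f x u • θ x
  smooth : ∀ U : Set M, IsOpen U → ∀ θ : DForm n M, θ.SmoothOn U →
    ∀ X : VField n M, X.SmoothOn U → DForm.SmoothOn (fun y ↦ nab θ y (X y)) U

/-- `∑ᵢⱼ g^{ij} (∇_{∂ᵢ} ∇_{∂ⱼ} - ∇_{∇ᴸ_{∂ᵢ} ∂ⱼ}) θ` at `x`, in the chart `φ`, for the connection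
`nab` on `∧* T*M` and the connection `cov` on `TM`. -/
def connLaplacian (cov : TConn n M) (nab : FormOp n M) (φ : OpenPartialHomeomorph M (Model n))
    (θ : DForm n M) (x : M) : Ext (TSp n x) :=
  ∑ i, ∑ j, ((metricMatrix φ x)⁻¹ i j) •
    (nab (fun y ↦ nab θ y (coordField φ j y)) x (coordField φ i x)
      - nab θ x (cov (coordField φ j) x (coordField φ i x)))

/-- `nab` is the connection of the Laplace type operator `P`: for some field `F` of endomorphisms,
`P = -(∑ᵢⱼ g^{ij} (∇_{∂ᵢ} ∇_{∂ⱼ} - ∇_{∇ᴸ_{∂ᵢ} ∂ⱼ}) + F)` in all charts. -/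
def IsLaplaceConnection (cov : TConn n M) (P : DForm n M → DForm n M) (nab : FormOp n M) : Prop :=
  IsFormConnection nab ∧
  ∃ F : (x : M) → Module.End ℝ (Ext (TSp n x)),
    ∀ θ : DForm n M, θ.SmoothOn univ → ∀ φ ∈ Charts n M, ∀ x ∈ φ.source,
      P θ x = -(connLaplacian cov nab φ θ x + F x (θ x))

/-- `nab` is the unique connection of the Laplace type operator `P`. -/
def IsUniqueLaplaceConnection (cov : TConn n M) (P : DForm n M → DForm n M)
    (nab : FormOp n M) : Prop :=
  IsLaplaceConnection cov P nab ∧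
  ∀ nab' : FormOp n M, IsLaplaceConnection cov P nab' →
    ∀ θ : DForm n M, θ.SmoothOn univ → nab' θ = nab θ

/-- The operator `∇_u = ∇ᴸ_u - ½ (c(u) A + B c(u))` for fields `A`, `B` of endomorphisms. -/
def twistedCov (cov : TConn n M) (A B : (x : M) → Module.End ℝ (Ext (TSp n x))) : FormOp n M :=
  fun θ x u ↦ formCov cov θ x u - (1 / 2 : ℝ) • (cliff u * A x + B x * cliff u) (θ x)

end Connection

end StatHodge

end

open StatHodge

/-!
Write `D = d + δ`. Once `D` is identified with the Dirac operator `∑ c(e_a) ∇_{e_a}` of the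
connection `∇` that the Levi-Civita connection induces on forms, all three operators have the form
`(D + B) (D + A)` with `A` and `B` equal to `l(v)` or `ε(v*)`, and one formula covers them.

* *Identification of `D`* (`IsLeviCivita.opD_eq`, `IsLeviCivita.opDStar_eq`). As `∇` is torsion
  free, `d = ∑ ε(e_a) ∇_{e_a}` (`IsLeviCivita.extD_eq_sum_dual`). As `∇` is metric and the
  logarithmic derivative of `√det g` is the trace of the connection form,
  `√det g (⟨dα, θ⟩ - ⟨α, -∑ l(e_a) ∇_{e_a} θ⟩)` is a coordinate divergence
  (`IsLeviCivita.sum_mvfderiv_volDensity_mul_extInner`), whose integral vanishes when `α` has compact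
  support in the chart. So `-∑ l(e_a) ∇_{e_a}` is a formal adjoint of `d`, and bump functions show
  that there is only one (`IsCodiff.unique`); it is therefore the form that `codiff` chooses.
* *The square of `D`* (`IsLeviCivita.dirac_dirac_eq`). The Clifford relations split
  `D² = ∑ c(e_a) c(e_b) ∇²_{a,b}` into `-∑ ∇²_{a,a}` and a term in the commutators of `∇²`. By the
  Ricci identity (`IsLeviCivita.formCov_commutator`) these act through the curvature operator, and the
  symmetries of the curvature tensor turn the resulting sum into
  `-⅛ ∑ R_{ijkl} c̄ᵢ c̄ⱼ cₖ cₗ + ¼ s` (`IsCurvatureLike.lichnerowicz`).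
* *The perturbed square* (`IsLeviCivita.twisted_weitzenboeck`). The new first order terms
  `∑ (c(e_a) A + B c(e_a)) ∇_{e_a}` are absorbed by completing the square: replacing `∇_u` by
  `∇_u - ½ (c(u) A + B c(u))` changes `-∑ ∇²_{a,a}` by exactly these terms, a quarter of the square of
  the coefficients, and derivatives of `A` and `B`. The zeroth order term `B A` vanishes if
  `A = B`, because `l(v)² = ε(v*)² = 0`.
* *Uniqueness of the connection* (`IsLaplaceConnection.unique`). The commutator of the operator with
  a function `f` is, up to a zeroth order term that only depends on `f` and `g`, equal to
  `-2 ∇_{grad f}`, and gradients fill every tangent space.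

Computations in a chart use the coordinate fields `∂_a` together with the `g`-dual fields
`E^a = ∑ g^{ab} ∂_b`; `sum_dual_eq_sum_orthonormal` passes between contractions over this pair of
dual bases and over an orthonormal basis.
-/


open Bundle Manifold Set
open scoped ContDiff Topology

noncomputable section

namespace StatHodge

/-! ### Exterior and Clifford algebra -/

section ExteriorAlgebra

variable {V : Type*} [NormedAddCommGroup V] [NormedSpace ℝ V]

theorem ext_ext {η ζ : Ext V} (h : ∀ k (w : Fin k → V), η k w = ζ k w) : η = ζ :=
  funext fun k ↦ ContinuousAlternatingMap.ext (h k)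

@[simp]
theorem wedge_apply_zero (α : V →L[ℝ] ℝ) (η : Ext V) (w : Fin 0 → V) : wedge α η 0 w = 0 := rfl

theorem wedge_apply_succ (α : V →L[ℝ] ℝ) (η : Ext V) (k : ℕ) (w : Fin (k + 1) → V) :
    wedge α η (k + 1) w = ∑ i : Fin (k + 1), (-1 : ℝ) ^ (i : ℕ) * (α (w i) * η k (i.removeNth w)) := by
  change ContinuousAlternatingMap.alternatizeUncurryFin (α.smulRight (η k)) w = _
  rw [ContinuousAlternatingMap.alternatizeUncurryFin_apply]
  simp

theorem contract_apply (v : V) (η : Ext V) (k : ℕ) (w : Fin k → V) :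
    contract v η k w = η (k + 1) (Fin.cons v w : Fin (k + 1) → V) := rfl

theorem contract_add (u v : V) : contract (u + v) = contract u + contract v := by
  ext1 η
  refine ext_ext fun k w ↦ ?_
  exact (η (k + 1)).cons_add w u v

theorem contract_smul (a : ℝ) (v : V) : contract (a • v) = a • contract v := by
  ext1 η
  refine ext_ext fun k w ↦ ?_
  exact (η (k + 1)).cons_smul w a v

theorem wedge_add (α β : V →L[ℝ] ℝ) : wedge (α + β) = wedge α + wedge β := by
  ext1 η
  refine ext_ext fun k w ↦ ?_
  cases k with
  | zero => simp
  | succ k =>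
    simp only [LinearMap.add_apply, Pi.add_apply, ContinuousAlternatingMap.add_apply,
      wedge_apply_succ, add_apply, ← Finset.sum_add_distrib]
    exact Finset.sum_congr rfl fun i _ ↦ by ring

theorem wedge_smul (a : ℝ) (α : V →L[ℝ] ℝ) : wedge (a • α) = a • wedge α := by
  ext1 η
  refine ext_ext fun k w ↦ ?_
  cases k with
  | zero => simp
  | succ k =>
    simp only [LinearMap.smul_apply, Pi.smul_apply, ContinuousAlternatingMap.smul_apply,
      wedge_apply_succ, smul_apply, smul_eq_mul, Finset.mul_sum]
    exact Finset.sum_congr rfl fun i _ ↦ by ring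

theorem contract_mul_self (v : V) : contract v * contract v = 0 := by
  ext1 η
  refine ext_ext fun k w ↦ ?_
  change η (k + 2) (Fin.cons v (Fin.cons v w : Fin (k + 1) → V) : Fin (k + 2) → V) = 0
  exact (η (k + 2)).map_eq_zero_of_eq _ (i := 0) (j := 1) (by simp [Fin.cons]; rfl) (by simp)

theorem wedge_mul_self (α : V →L[ℝ] ℝ) : wedge α * wedge α = 0 := by
  ext1 η
  refine funext fun k ↦ ?_
  match k with
  | 0 => rfl
  | 1 =>
    refine ContinuousAlternatingMap.ext fun w ↦ ?_
    rw [Module.End.mul_apply, wedge_apply_succ]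
    simp
  | k + 2 =>
    -- `α ∧ (α ∧ η)` is the double alternation of the symmetric map `(u, v) ↦ α(u) α(v) η`.
    have h := ContinuousAlternatingMap.alternatizeUncurryFin_alternatizeUncurryFinCLM_comp_of_symmetric
      (f := α.smulRight (α.smulRight (η k)))
      (fun x y ↦ by simp [smul_smul, mul_comm])
    refine Eq.trans ?_ h
    change ContinuousAlternatingMap.alternatizeUncurryFin
      (α.smulRight (ContinuousAlternatingMap.alternatizeUncurryFin (α.smulRight (η k)))) = _
    congr 1
    ext u : 1
    simp only [ContinuousLinearMap.smulRight_apply, ContinuousLinearMap.comp_apply,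
      ContinuousLinearMap.map_smul, ContinuousAlternatingMap.alternatizeUncurryFinCLM_apply]

theorem contract_mul_wedge (v : V) (α : V →L[ℝ] ℝ) :
    contract v * wedge α + wedge α * contract v = α v • (1 : Module.End ℝ (Ext V)) := by
  ext1 η
  refine ext_ext fun k w ↦ ?_
  simp only [LinearMap.add_apply, Module.End.mul_apply, Pi.add_apply,
    ContinuousAlternatingMap.add_apply, LinearMap.smul_apply, Module.End.one_apply, Pi.smul_apply,
    ContinuousAlternatingMap.smul_apply, smul_eq_mul, contract_apply]
  cases k with
  | zero =>
    rw [wedge_apply_succ]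
    simp
  | succ k =>
    rw [wedge_apply_succ, wedge_apply_succ, Fin.sum_univ_succ]
    simp only [Fin.cons_zero, Fin.cons_succ, Fin.val_succ, contract_apply]
    have h (i : Fin (k + 1)) : (i.succ.removeNth (Fin.cons v w : Fin (k + 2) → V)) =
        (Fin.cons v (i.removeNth w) : Fin (k + 1) → V) := by
      funext j
      refine Fin.cases ?_ (fun j ↦ ?_) j
      · simp [Fin.removeNth]
      · simp [Fin.removeNth]
    have h0 : ((0 : Fin (k + 2)).removeNth (Fin.cons v w : Fin (k + 2) → V)) = w := by
      funext j
      simp [Fin.removeNth]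
    simp only [h, h0, pow_succ, Fin.val_zero, pow_zero]
    simp only [mul_neg_one, neg_mul, Finset.sum_neg_distrib, one_mul]
    ring

/-- The derivation action of `A` is `∑ ε(fₐ) l(A bₐ)` for dual bases `f` and `b`; note that
`derivAction` carries no sign. -/
theorem derivAction_eq_sum {ι : Type*} [Fintype ι] (f : ι → V →L[ℝ] ℝ) (b : ι → V)
    (hfb : ∀ u, ∑ a, f a u • b a = u) (A : V →L[ℝ] V) (η : Ext V) :
    derivAction A η = ∑ a, wedge (f a) (contract (A (b a)) η) := by
  refine ext_ext fun k w ↦ ?_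
  have hs : (∑ a, wedge (f a) (contract (A (b a)) η)) k w
      = ∑ a, wedge (f a) (contract (A (b a)) η) k w := by
    simp
  rw [derivAction_apply, hs]
  cases k with
  | zero => simp
  | succ k =>
    simp only [wedge_apply_succ, contract_apply]
    rw [Finset.sum_comm]
    refine Finset.sum_congr rfl fun i _ ↦ ?_
    have h1 (z : V) : (-1 : ℝ) ^ (i : ℕ) * η (k + 1) (Fin.cons z (i.removeNth w) : Fin (k + 1) → V)
        = η (k + 1) (Function.update w i z) := by
      have h := (η (k + 1)).toAlternatingMap.map_insertNth i z (i.removeNth w)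
      have h2 : i.insertNth z (i.removeNth w) = Function.update w i z := by simp
      rw [h2] at h
      have h3 : η (k + 1) (Function.update w i z) = (-1 : ℝ) ^ (i : ℕ) *
          η (k + 1) (Fin.cons z (i.removeNth w) : Fin (k + 1) → V) := by
        simpa [Matrix.vecCons] using h
      exact h3.symm
    have h2 (a : ι) : (-1 : ℝ) ^ (i : ℕ) * (f a (w i) *
        η (k + 1) (Fin.cons (A (b a)) (i.removeNth w) : Fin (k + 1) → V))
        = f a (w i) * η (k + 1) (Function.update w i (A (b a))) := by
      rw [← h1]; ring
    simp only [h2]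
    have h3 := (η (k + 1)).toAlternatingMap.toMultilinearMap.map_update_sum Finset.univ i
      (fun a ↦ f a (w i) • A (b a)) w
    have h4 : A (w i) = ∑ a, f a (w i) • A (b a) := by
      conv_lhs => rw [← hfb (w i)]
      simp
    rw [h4]
    refine h3.trans (Finset.sum_congr rfl fun a _ ↦ ?_)
    exact (η (k + 1)).map_update_smul w i _ _

end ExteriorAlgebra

section CliffordRelations

variable {V : Type*} [NormedAddCommGroup V] [InnerProductSpace ℝ V]

theorem wedgeDual_add (u v : V) : wedgeDual (u + v) = wedgeDual u + wedgeDual v := by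
  simp only [wedgeDual, map_add, wedge_add]

theorem wedgeDual_smul (a : ℝ) (v : V) : wedgeDual (a • v) = a • wedgeDual v := by
  simp only [wedgeDual, map_smul, wedge_smul]

theorem cliff_add (u v : V) : cliff (u + v) = cliff u + cliff v := by
  simp only [cliff, wedgeDual_add, contract_add]; abel

theorem cliff_smul (a : ℝ) (v : V) : cliff (a • v) = a • cliff v := by
  rw [cliff, wedgeDual_smul, contract_smul]
  exact (smul_sub a (wedgeDual v) (contract v)).symm

theorem contract_anticomm (u v : V) : contract u * contract v + contract v * contract u = 0 := by
  have h := contract_mul_self (u + v)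
  rw [contract_add, mul_add, add_mul, add_mul, contract_mul_self, contract_mul_self] at h
  rw [← h]; abel

theorem wedgeDual_anticomm (u v : V) :
    wedgeDual u * wedgeDual v + wedgeDual v * wedgeDual u = 0 := by
  have hs (u : V) : wedgeDual u * wedgeDual u = 0 := wedge_mul_self _
  have h := hs (u + v)
  rw [wedgeDual_add, mul_add, add_mul, add_mul, hs, hs] at h
  rw [← h]; abel

theorem contract_mul_wedgeDual (u v : V) :
    contract u * wedgeDual v + wedgeDual v * contract u
      = inner ℝ u v • (1 : Module.End ℝ (Ext V)) := by
  rw [wedgeDual, contract_mul_wedge, innerSL_apply_apply, real_inner_comm]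

theorem cliff_anticomm (u v : V) :
    cliff u * cliff v + cliff v * cliff u
      = (-2 * inner ℝ u v) • (1 : Module.End ℝ (Ext V)) := by
  have key {A : Type _} [Ring A] [Algebra ℝ A] (p q p' q' : A) (t : ℝ) (h1 : q * q' + q' * q = 0)
      (h2 : p * p' + p' * p = 0) (h3 : q * p' + p' * q = t • (1 : A))
      (h4 : q' * p + p * q' = t • (1 : A)) :
      (p - q) * (p' - q') + (p' - q') * (p - q) = (-2 * t) • (1 : A) := by
    have : (p - q) * (p' - q') + (p' - q') * (p - q) = (q * q' + q' * q) + (p * p' + p' * p)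
        - (q * p' + p' * q) - (q' * p + p * q') := by noncomm_ring
    rw [this, h1, h2, h3, h4]
    module
  exact key (wedgeDual u) (contract u) (wedgeDual v) (contract v) _ (contract_anticomm u v)
    (wedgeDual_anticomm u v) (contract_mul_wedgeDual u v)
    (by rw [real_inner_comm]; exact contract_mul_wedgeDual v u)

theorem cliff_cliffBar_anticomm (u v : V) :
    cliff u * cliffBar v + cliffBar v * cliff u = 0 := by
  have key {A : Type _} [Ring A] [Algebra ℝ A] (p q p' q' : A) (t : ℝ) (h1 : q * q' + q' * q = 0)
      (h2 : p * p' + p' * p = 0) (h3 : q * p' + p' * q = t • (1 : A))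
      (h4 : q' * p + p * q' = t • (1 : A)) :
      (p - q) * (p' + q') + (p' + q') * (p - q) = 0 := by
    have : (p - q) * (p' + q') + (p' + q') * (p - q) = -(q * q' + q' * q) + (p * p' + p' * p)
        - (q * p' + p' * q) + (q' * p + p * q') := by noncomm_ring
    rw [this, h1, h2, h3, h4]
    module
  exact key (wedgeDual u) (contract u) (wedgeDual v) (contract v) _ (contract_anticomm u v)
    (wedgeDual_anticomm u v) (contract_mul_wedgeDual u v)
    (by rw [real_inner_comm]; exact contract_mul_wedgeDual v u)

/-- The contraction of a bilinear map over a pair of dual families of vectors is the same as over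
an orthonormal basis. -/
theorem sum_dual_eq_sum_orthonormal {ι κ W : Type*} [Fintype ι] [Fintype κ] [AddCommGroup W]
    [Module ℝ W] (E D : ι → V) (hED : ∀ u, ∑ j, (inner ℝ (E j) u : ℝ) • D j = u)
    (e : κ → V) (he : ∀ u, ∑ a, (inner ℝ (e a) u : ℝ) • e a = u)
    (b : V → V → W) (hl : ∀ w, IsLinearMap ℝ fun u ↦ b u w) (hr : ∀ u, IsLinearMap ℝ (b u)) :
    ∑ j, b (E j) (D j) = ∑ a, b (e a) (e a) := by
  have hL (w : V) (t : κ → ℝ) : b (∑ a, t a • e a) w = ∑ a, t a • b (e a) w := by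
    refine (map_sum ((hl w).mk' _) (fun a ↦ t a • e a) Finset.univ).trans ?_
    exact Finset.sum_congr rfl fun a _ ↦ (hl w).map_smul _ _
  have hR (u : V) (t : ι → ℝ) : b u (∑ j, t j • D j) = ∑ j, t j • b u (D j) := by
    refine (map_sum ((hr u).mk' _) (fun j ↦ t j • D j) Finset.univ).trans ?_
    exact Finset.sum_congr rfl fun j _ ↦ (hr u).map_smul _ _
  calc ∑ j, b (E j) (D j) = ∑ j, ∑ a, (inner ℝ (e a) (E j) : ℝ) • b (e a) (D j) := by
        refine Finset.sum_congr rfl fun j _ ↦ ?_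
        rw [← hL, he]
    _ = ∑ a, ∑ j, (inner ℝ (E j) (e a) : ℝ) • b (e a) (D j) := by
        rw [Finset.sum_comm]
        simp only [real_inner_comm]
    _ = ∑ a, b (e a) (e a) := by
        refine Finset.sum_congr rfl fun a _ ↦ ?_
        rw [← hR, hED]

end CliffordRelations

/-! ### Algebraic curvature tensors -/

section CurvatureAlgebra

variable {ι : Type*}

/-- A four-index array with the symmetries of a Riemann curvature tensor. -/
structure IsCurvatureLike (R : ι → ι → ι → ι → ℝ) : Prop where
  swap_left : ∀ i j k l, R j i k l = -R i j k l
  swap_right : ∀ i j k l, R i j l k = -R i j k l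
  bianchi : ∀ i j k l, R i j k l + R j k i l + R k i j l = 0

theorem IsCurvatureLike.pair_symm {R : ι → ι → ι → ι → ℝ} (hR : IsCurvatureLike R)
    (i j k l : ι) : R k l i j = R i j k l := by
  -- The octahedron argument: combine the four Bianchi identities on `i, j, k, l`.
  linarith [hR.bianchi i j k l, hR.bianchi j k l i, hR.bianchi k l i j, hR.bianchi l i j k,
    hR.swap_left i j k l, hR.swap_left j k i l, hR.swap_left k i j l, hR.swap_left i j l k,
    hR.swap_right i j k l, hR.swap_right j k i l, hR.swap_right k i j l, hR.swap_right k l i j,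
    hR.swap_right j l k i, hR.swap_right l i j k, hR.swap_left j l k i, hR.swap_left l i j k,
    hR.swap_left i l j k, hR.swap_right j k l i, hR.swap_right i l j k, hR.swap_left l j k i,
    hR.swap_right l j i k, hR.swap_right i k j l, hR.swap_left i k j l, hR.swap_left k l i j,
    hR.swap_left i l k j, hR.swap_left j l i k]

theorem sum_rotate {W : Type*} [Fintype ι] [AddCommMonoid W] (F : ι → ι → ι → W) :
    ∑ i, ∑ j, ∑ k, F j k i = ∑ i, ∑ j, ∑ k, F i j k := by
  rw [Finset.sum_comm]
  refine Finset.sum_congr rfl fun i _ ↦ ?_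
  rw [Finset.sum_comm]

variable {A : Type*} [Ring A] [Algebra ℝ A] [Fintype ι] [DecidableEq ι]

/-- The first Bianchi identity contracts `∑ R_{ijkl} cᵢ cⱼ c_k` to the Ricci tensor. -/
theorem IsCurvatureLike.sum_cliff_three {R : ι → ι → ι → ι → ℝ} (hR : IsCurvatureLike R)
    {c : ι → A} (hc : ∀ i j, c i * c j + c j * c i = (if i = j then (-2 : ℝ) else 0) • (1 : A))
    (l : ι) :
    ∑ i, ∑ j, ∑ k, R i j k l • (c i * c j * c k) = (-2 : ℝ) • ∑ i, ∑ j, R i j j l • c i := by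
  set T := ∑ i, ∑ j, ∑ k, R i j k l • (c i * c j * c k) with hT
  set Q := ∑ i, ∑ j, R i j j l • c i with hQ
  let d (i j : ι) : ℝ := if i = j then 1 else 0
  have hc' (i j : ι) : c i * c j = -(c j * c i) - (2 * d i j) • (1 : A) := by
    rw [eq_sub_iff_add_eq, eq_neg_iff_add_eq_zero, add_right_comm, hc i j]
    simp only [d]
    split_ifs <;> simp
  have e1 (i j k : ι) : c i * c j * c k = c k * c i * c j - (2 * d j k) • c i
      + (2 * d i k) • c j := by
    rw [mul_assoc, hc' j k, mul_sub, mul_neg, ← mul_assoc, hc' i k]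
    simp only [sub_mul, neg_mul, mul_smul_comm, mul_one, smul_mul_assoc, one_mul, neg_sub]
    abel
  have e2 (i j k : ι) : c i * c j * c k = c j * c k * c i - (2 * d i j) • c k
      + (2 * d i k) • c j := by
    rw [hc' i j, sub_mul, neg_mul, mul_assoc, hc' i k, mul_sub, mul_neg, ← mul_assoc]
    simp only [mul_smul_comm, mul_one, smul_mul_assoc, one_mul, neg_sub]
    abel
  have hsum : ∑ i, ∑ j, ∑ k, R i j k l • (c i * c j * c k + c k * c i * c j + c j * c k * c i)
      = 0 := by
    simp only [smul_add, Finset.sum_add_distrib]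
    have h1 : ∑ i, ∑ j, ∑ k, R i j k l • (c k * c i * c j)
        = ∑ i, ∑ j, ∑ k, R j k i l • (c i * c j * c k) :=
      (sum_rotate (fun i j k ↦ R i j k l • (c k * c i * c j))).symm
    have h2 : ∑ i, ∑ j, ∑ k, R i j k l • (c j * c k * c i)
        = ∑ i, ∑ j, ∑ k, R k i j l • (c i * c j * c k) :=
      (sum_rotate (fun i j k ↦ R k i j l • (c i * c j * c k)))
    rw [h1, h2, ← Finset.sum_add_distrib, ← Finset.sum_add_distrib]
    refine Finset.sum_eq_zero fun i _ ↦ ?_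
    rw [← Finset.sum_add_distrib, ← Finset.sum_add_distrib]
    refine Finset.sum_eq_zero fun j _ ↦ ?_
    rw [← Finset.sum_add_distrib, ← Finset.sum_add_distrib]
    refine Finset.sum_eq_zero fun k _ ↦ ?_
    rw [← add_smul, ← add_smul, hR.bianchi, zero_smul]
  have q1 : ∑ i, ∑ j, ∑ k, (R i j k l * d j k) • c i = Q := by
    simp [d, hQ]
  have q2 : ∑ i, ∑ j, ∑ k, (R i j k l * d i k) • c j = -Q := by
    rw [hQ, Finset.sum_comm, ← Finset.sum_neg_distrib]
    refine Finset.sum_congr rfl fun j _ ↦ ?_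
    rw [← Finset.sum_neg_distrib]
    refine Finset.sum_congr rfl fun i _ ↦ ?_
    simp [d, hR.swap_left i j]
  have q3 : ∑ i, ∑ j, ∑ k, (R i j k l * d i j) • c k = 0 := by
    refine Finset.sum_eq_zero fun i _ ↦ ?_
    rw [Finset.sum_comm]
    refine Finset.sum_eq_zero fun k _ ↦ ?_
    have : R i i k l = 0 := by linarith [hR.swap_left i i k l]
    simp [d, this]
  -- Cyclic permutations of `cᵢ cⱼ cₖ` differ by terms linear in `c`, and their sum contracts to zero.
  have h3 : (3 : ℝ) • T = (-6 : ℝ) • Q := by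
    have : (3 : ℝ) • T = ∑ i, ∑ j, ∑ k, R i j k l •
        (c i * c j * c k + c k * c i * c j + c j * c k * c i)
        + ((-2 : ℝ) • ∑ i, ∑ j, ∑ k, (R i j k l * d j k) • c i
        + (4 : ℝ) • ∑ i, ∑ j, ∑ k, (R i j k l * d i k) • c j
        + (-2 : ℝ) • ∑ i, ∑ j, ∑ k, (R i j k l * d i j) • c k) := by
      simp only [hT, Finset.smul_sum, ← Finset.sum_add_distrib]
      refine Finset.sum_congr rfl fun i _ ↦ Finset.sum_congr rfl fun j _ ↦
        Finset.sum_congr rfl fun k _ ↦ ?_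
      have a1 := e1 i j k
      have a2 := e2 i j k
      have a3 : (3 : ℝ) • (c i * c j * c k) = c i * c j * c k
          + (c k * c i * c j - (2 * d j k) • c i + (2 * d i k) • c j)
          + (c j * c k * c i - (2 * d i j) • c k + (2 * d i k) • c j) := by
        rw [← a1, ← a2]; module
      rw [smul_comm, a3]
      module
    rw [this, hsum, q1, q2, q3]
    module
  have h4 : T = (1 / 3 : ℝ) • ((3 : ℝ) • T) := by module
  rw [h4, h3]
  module

/-- `∑ R_{ijkl} cᵢ cⱼ cₖ cₗ` is a scalar. -/
theorem IsCurvatureLike.sum_cliff_four {R : ι → ι → ι → ι → ℝ} (hR : IsCurvatureLike R)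
    {c : ι → A} (hc : ∀ i j, c i * c j + c j * c i = (if i = j then (-2 : ℝ) else 0) • (1 : A)) :
    ∑ i, ∑ j, ∑ k, ∑ l, R i j k l • (c i * c j * c k * c l)
      = (2 * ∑ i, ∑ j, R i j j i) • (1 : A) := by
  have h1 : ∑ i, ∑ j, ∑ k, ∑ l, R i j k l • (c i * c j * c k * c l)
      = ∑ l, (∑ i, ∑ j, ∑ k, R i j k l • (c i * c j * c k)) * c l := by
    simp only [Finset.sum_mul, smul_mul_assoc]
    rw [Finset.sum_comm' (t' := Finset.univ) (s' := fun _ ↦ Finset.univ) (by simp)]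
    conv_rhs => rw [Finset.sum_comm]
    conv_lhs => rw [Finset.sum_comm]
    refine Finset.sum_congr rfl fun i _ ↦ ?_
    conv_rhs => rw [Finset.sum_comm]
    refine Finset.sum_congr rfl fun j _ ↦ ?_
    rw [Finset.sum_comm]
  simp only [h1, hR.sum_cliff_three hc]
  -- The Ricci tensor `ric` is symmetric, so only `cᵢ cₗ + cₗ cᵢ` enters.
  set ric : ι → ι → ℝ := fun i l ↦ ∑ j, R i j j l with hric
  have hsym (i l : ι) : ric i l = ric l i := by
    refine Finset.sum_congr rfl fun j _ ↦ ?_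
    rw [← hR.pair_symm i j j l, hR.swap_left l j, hR.swap_right l j]
    simp
  have h2 : ∑ l, ((-2 : ℝ) • ∑ i, ∑ j, R i j j l • c i) * c l
      = (-2 : ℝ) • ∑ l, ∑ i, ric i l • (c i * c l) := by
    simp only [Finset.smul_sum, Finset.sum_mul, hric, Finset.sum_smul, smul_mul_assoc]
  have h3 : ∑ l, ∑ i, ric i l • (c i * c l)
      = (1 / 2 : ℝ) • ∑ l, ∑ i, ric i l • (c i * c l + c l * c i) := by
    simp only [smul_add, Finset.sum_add_distrib]
    have : ∑ l, ∑ i, ric i l • (c l * c i) = ∑ l, ∑ i, ric i l • (c i * c l) := by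
      rw [Finset.sum_comm]
      refine Finset.sum_congr rfl fun l _ ↦ Finset.sum_congr rfl fun i _ ↦ ?_
      rw [hsym]
    rw [this]
    module
  rw [h2, h3]
  simp only [hc, smul_smul, ← Finset.sum_smul]
  congr 1
  simp [hric, ← Finset.sum_mul]
  ring

/-- The algebra behind the Lichnerowicz formula for `d + δ`: with `εₖ = (cₖ + c̄ₖ) / 2` and
`iₗ = (c̄ₗ - cₗ) / 2`, the operator `∑ R_{ijkl} cᵢ cⱼ εₖ iₗ` in which the curvature first appears is
expressed by `∑ R_{ijkl} c̄ᵢ c̄ⱼ cₖ cₗ` and the scalar curvature. -/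
theorem IsCurvatureLike.lichnerowicz {R : ι → ι → ι → ι → ℝ} (hR : IsCurvatureLike R)
    {c c' : ι → A}
    (hc : ∀ i j, c i * c j + c j * c i = (if i = j then (-2 : ℝ) else 0) • (1 : A))
    (hcc' : ∀ i j, c i * c' j + c' j * c i = 0) {p q : ι → A}
    (hp : ∀ i, p i = (1 / 2 : ℝ) • (c i + c' i)) (hq : ∀ i, q i = (1 / 2 : ℝ) • (c' i - c i)) :
    ∑ i, ∑ j, ∑ k, ∑ l, R i j k l • (c i * c j * (p k * q l))
      = (1 / 4 : ℝ) • ∑ i, ∑ j, ∑ k, ∑ l, R i j k l • (c' i * c' j * c k * c l)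
        - (1 / 2 * ∑ i, ∑ j, R i j j i) • (1 : A) := by
  have hcom (i j : ι) : c' i * c j = -(c j * c' i) := by
    rw [eq_neg_iff_add_eq_zero, add_comm, hcc']
  have hpq (i j : ι) : ∑ k, ∑ l, R i j k l • (p k * q l)
      = (1 / 4 : ℝ) • ∑ k, ∑ l, R i j k l • (c' k * c' l - c k * c l) := by
    -- The mixed terms of `pₖ qₗ` are symmetric in `k` and `l`.
    have hzero : ∑ k, ∑ l, R i j k l • (c k * c' l + c l * c' k) = 0 := by
      have h : ∑ k, ∑ l, R i j k l • (c l * c' k) = -∑ k, ∑ l, R i j k l • (c k * c' l) := by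
        rw [Finset.sum_comm, ← Finset.sum_neg_distrib]
        refine Finset.sum_congr rfl fun k _ ↦ ?_
        rw [← Finset.sum_neg_distrib]
        refine Finset.sum_congr rfl fun l _ ↦ ?_
        rw [hR.swap_right, neg_smul]
      simp only [smul_add, Finset.sum_add_distrib, h]
      abel
    rw [← add_zero ((1 / 4 : ℝ) • _), ← smul_zero (1 / 4 : ℝ), ← hzero, ← smul_add,
      ← Finset.sum_add_distrib, Finset.smul_sum]
    refine Finset.sum_congr rfl fun k _ ↦ ?_
    rw [← Finset.sum_add_distrib, Finset.smul_sum]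
    refine Finset.sum_congr rfl fun l _ ↦ ?_
    rw [hp, hq, smul_mul_smul_comm, add_mul, mul_sub, mul_sub, hcom k l]
    module
  have h1 : ∑ i, ∑ j, ∑ k, ∑ l, R i j k l • (c i * c j * (p k * q l))
      = (1 / 4 : ℝ) • (∑ i, ∑ j, ∑ k, ∑ l, R i j k l • (c i * c j * c' k * c' l)
        - ∑ i, ∑ j, ∑ k, ∑ l, R i j k l • (c i * c j * c k * c l)) := by
    rw [← Finset.sum_sub_distrib, Finset.smul_sum]
    refine Finset.sum_congr rfl fun i _ ↦ ?_
    rw [← Finset.sum_sub_distrib, Finset.smul_sum]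
    refine Finset.sum_congr rfl fun j _ ↦ ?_
    have : ∑ k, ∑ l, R i j k l • (c i * c j * (p k * q l))
        = c i * c j * ∑ k, ∑ l, R i j k l • (p k * q l) := by
      simp only [Finset.mul_sum, mul_smul_comm]
    rw [this, hpq]
    simp only [mul_smul_comm, Finset.mul_sum, mul_sub, smul_sub, Finset.sum_sub_distrib, mul_assoc]
  have h2 : ∑ i, ∑ j, ∑ k, ∑ l, R i j k l • (c i * c j * c' k * c' l)
      = ∑ i, ∑ j, ∑ k, ∑ l, R i j k l • (c' i * c' j * c k * c l) := by
    have hsw (i j k l : ι) : c i * c j * c' k * c' l = c' k * c' l * c i * c j := by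
      have e1 : c j * (c' k * c' l) = c' k * c' l * c j := by
        rw [← mul_assoc, mul_assoc (c' k), hcom l j, mul_neg, ← mul_assoc, hcom k j]
        simp
      have e2 : c i * (c' k * c' l) = c' k * c' l * c i := by
        rw [← mul_assoc, mul_assoc (c' k), hcom l i, mul_neg, ← mul_assoc, hcom k i]
        simp
      rw [mul_assoc (c i * c j), mul_assoc (c i), e1, ← mul_assoc, e2]
    calc _ = ∑ i, ∑ j, ∑ k, ∑ l, R k l i j • (c' k * c' l * c i * c j) := by
          simp only [hsw, hR.pair_symm]
      _ = ∑ k, ∑ l, ∑ i, ∑ j, R k l i j • (c' k * c' l * c i * c j) := by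
          have (F : ι → ι → ι → ι → A) : ∑ i, ∑ j, ∑ k, ∑ l, F i j k l
              = ∑ k, ∑ l, ∑ i, ∑ j, F i j k l := by
            calc _ = ∑ i, ∑ k, ∑ l, ∑ j, F i j k l := by
                  refine Finset.sum_congr rfl fun i _ ↦ ?_
                  rw [Finset.sum_comm]
                  exact Finset.sum_congr rfl fun k _ ↦ Finset.sum_comm
              _ = _ := by
                  rw [Finset.sum_comm]
                  exact Finset.sum_congr rfl fun k _ ↦ Finset.sum_comm
          exact this _
  rw [h1, h2, hR.sum_cliff_four hc, smul_sub, smul_smul]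
  congr 2
  ring

end CurvatureAlgebra

/-! ### The inner product on forms -/

theorem sum_fin_succ_arrow {κ W : Type*} [Fintype κ] [AddCommMonoid W] (k : ℕ) (i : Fin (k + 1))
    (F : (Fin (k + 1) → κ) → W) :
    ∑ f, F f = ∑ a, ∑ g : Fin k → κ, F (i.insertNth a g) := by
  rw [← (Fin.insertNthEquiv (fun _ ↦ κ) i).sum_comp, Fintype.sum_prod_type]
  rfl

theorem comp_insertNth {κ W : Type*} (D : κ → W) {k : ℕ} (i : Fin (k + 1)) (a : κ) (g : Fin k → κ) :
    (fun j ↦ D ((i.insertNth a g : Fin (k + 1) → κ) j))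
      = (i.insertNth (D a) (fun j ↦ D (g j)) : Fin (k + 1) → W) := by
  funext j
  refine i.succAboveCases ?_ (fun j ↦ ?_) j <;> simp

section ExtInner

variable {V : Type*} [NormedAddCommGroup V] [InnerProductSpace ℝ V]

theorem sum_inner_smul_orthonormalBasis {ι : Type*} [Fintype ι] (b : OrthonormalBasis ι ℝ V)
    (u : V) : ∑ a, (inner ℝ (b a) u : ℝ) • b a = u := by
  simpa only [b.repr_apply_apply] using b.sum_repr u

/-- The full contraction of two alternating forms over a pair of dual families is the same as over
an orthonormal basis. -/
theorem sum_alternating_dual_eq {ι κ : Type*} [Fintype ι] [Fintype κ]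
    (E D : ι → V) (hED : ∀ u, ∑ j, (inner ℝ (E j) u : ℝ) • D j = u)
    (e : κ → V) (he : ∀ u, ∑ a, (inner ℝ (e a) u : ℝ) • e a = u)
    (k : ℕ) (η ζ : V [⋀^Fin k]→L[ℝ] ℝ) :
    ∑ f : Fin k → ι, η (fun i ↦ E (f i)) * ζ (fun i ↦ D (f i))
      = ∑ f : Fin k → κ, η (fun i ↦ e (f i)) * ζ (fun i ↦ e (f i)) := by
  induction k with
  | zero =>
    simp only [Finset.univ_unique, Finset.sum_singleton]
    congr 2 <;> exact funext fun i ↦ i.elim0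
  | succ k ih =>
    rw [sum_fin_succ_arrow k 0, sum_fin_succ_arrow k 0]
    simp only [comp_insertNth]
    have h1 (u : V) (w : Fin k → V) (θ : V [⋀^Fin (k + 1)]→L[ℝ] ℝ) :
        θ ((0 : Fin (k + 1)).insertNth u w : Fin (k + 1) → V) = θ.curryLeft u w := by
      rw [Fin.insertNth_zero']
      rfl
    simp only [h1, ih]
    refine sum_dual_eq_sum_orthonormal E D hED e he
      (fun u w ↦ ∑ f : Fin k → κ, η.curryLeft u (fun i ↦ e (f i)) * ζ.curryLeft w (fun i ↦ e (f i)))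
      (fun w ↦ ⟨fun x y ↦ ?_, fun c x ↦ ?_⟩) (fun w ↦ ⟨fun x y ↦ ?_, fun c x ↦ ?_⟩)
    · simp [add_mul, Finset.sum_add_distrib]
    · simp [mul_assoc, Finset.mul_sum]
    · simp [mul_add, Finset.sum_add_distrib]
    · simp [mul_left_comm, Finset.mul_sum]

variable [FiniteDimensional ℝ V]

theorem ext_eq_zero_of_finrank_lt (η : Ext V) {k : ℕ} (hk : Module.finrank ℝ V < k) : η k = 0 := by
  refine ContinuousAlternatingMap.ext fun w ↦ ?_
  refine (η k).toAlternatingMap.map_linearDependent w fun h ↦ ?_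
  have := h.fintype_card_le_finrank
  simp at this
  omega

theorem extInner_eq_of_dual {ι : Type*} [Fintype ι]
    (E D : ι → V) (hED : ∀ u, ∑ j, (inner ℝ (E j) u : ℝ) • D j = u) (η ζ : Ext V) :
    extInner η ζ = ∑ k ∈ Finset.range (Module.finrank ℝ V + 1), ((k.factorial : ℝ))⁻¹ *
      ∑ f : Fin k → ι, η k (fun i ↦ E (f i)) * ζ k (fun i ↦ D (f i)) := by
  refine Finset.sum_congr rfl fun k _ ↦ ?_
  rw [sum_alternating_dual_eq E D hED _ (sum_inner_smul_orthonormalBasis (stdOrthonormalBasis ℝ V))]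

theorem extInner_comm (η ζ : Ext V) : extInner η ζ = extInner ζ η := by
  simp only [extInner, mul_comm]

theorem extInner_add_left (η η' ζ : Ext V) :
    extInner (η + η') ζ = extInner η ζ + extInner η' ζ := by
  simp [extInner, add_mul, mul_add, Finset.sum_add_distrib]

theorem extInner_smul_left (a : ℝ) (η ζ : Ext V) :
    extInner (a • η) ζ = a * extInner η ζ := by
  simp [extInner, Finset.mul_sum, mul_assoc, mul_left_comm]

theorem extInner_add_right (η ζ ζ' : Ext V) :
    extInner η (ζ + ζ') = extInner η ζ + extInner η ζ' := by
  simp [extInner, mul_add, Finset.sum_add_distrib]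

theorem extInner_smul_right (a : ℝ) (η ζ : Ext V) :
    extInner η (a • ζ) = a * extInner η ζ := by
  rw [extInner_comm, extInner_smul_left, extInner_comm]

theorem extInner_zero_left (ζ : Ext V) : extInner 0 ζ = 0 := by
  simp [extInner]

theorem extInner_sum_left {ι : Type*} (s : Finset ι) (η : ι → Ext V) (ζ : Ext V) :
    extInner (∑ i ∈ s, η i) ζ = ∑ i ∈ s, extInner (η i) ζ :=
  map_sum (AddMonoidHom.mk' (fun η ↦ extInner η ζ) fun η η' ↦ extInner_add_left η η' ζ) η s

theorem extInner_sum_right {ι : Type*} (s : Finset ι) (η : ι → Ext V) (ζ : Ext V) :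
    extInner ζ (∑ i ∈ s, η i) = ∑ i ∈ s, extInner ζ (η i) := by
  simp only [extInner_comm ζ, extInner_sum_left]

theorem extInner_neg_right (η ζ : Ext V) : extInner η (-ζ) = -extInner η ζ := by
  rw [← neg_one_smul ℝ, extInner_smul_right, neg_one_mul]

theorem extInner_sub_right (η ζ ζ' : Ext V) :
    extInner η (ζ - ζ') = extInner η ζ - extInner η ζ' := by
  rw [sub_eq_add_neg, extInner_add_right, extInner_neg_right, sub_eq_add_neg]

theorem extInner_self_nonneg (η : Ext V) : 0 ≤ extInner η η :=
  Finset.sum_nonneg fun k _ ↦ mul_nonneg (by positivity)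
    (Finset.sum_nonneg fun f _ ↦ mul_self_nonneg _)

theorem eq_zero_of_extInner_self (η : Ext V) (h : extInner η η = 0) : η = 0 := by
  funext k
  rcases lt_or_ge (Module.finrank ℝ V) k with hk | hk
  · exact ext_eq_zero_of_finrank_lt η hk
  rw [extInner, Finset.sum_eq_zero_iff_of_nonneg fun k _ ↦ mul_nonneg (by positivity)
    (Finset.sum_nonneg fun f _ ↦ mul_self_nonneg _)] at h
  have h1 := h k (Finset.mem_range.2 (by omega))
  have h2 := (mul_eq_zero.1 h1).resolve_left (by positivity)
  rw [Finset.sum_eq_zero_iff_of_nonneg fun f _ ↦ mul_self_nonneg _] at h2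
  refine ContinuousAlternatingMap.toAlternatingMap_injective ?_
  refine Module.Basis.ext_alternating (stdOrthonormalBasis ℝ V).toBasis fun f _ ↦ ?_
  have h3 := mul_self_eq_zero.1 (h2 f (Finset.mem_univ f))
  simpa using h3

/-- Interior multiplication is adjoint to exterior multiplication. -/
theorem extInner_wedgeDual (u : V) (η ζ : Ext V) :
    extInner (wedgeDual u η) ζ = extInner η (contract u ζ) := by
  set b := stdOrthonormalBasis ℝ V with hb
  -- The sums over degrees match after a shift: `wedgeDual` has no part in degree `0`, and `contract`
  -- has none in the top degree.
  have hlast : contract u ζ (Module.finrank ℝ V) = 0 := by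
    refine ContinuousAlternatingMap.ext fun w ↦ ?_
    rw [contract_apply, ext_eq_zero_of_finrank_lt ζ (Nat.lt_succ_self _)]
    rfl
  rw [extInner, extInner, Finset.sum_range_succ', Finset.sum_range_succ, hlast]
  have h0 : wedgeDual u η 0 = 0 := rfl
  simp only [h0, ContinuousAlternatingMap.coe_zero, Pi.zero_apply, zero_mul, mul_zero, Finset.sum_const_zero,
    add_zero]
  refine Finset.sum_congr rfl fun k _ ↦ ?_
  rw [← hb]
  -- Each of the `k + 1` positions of `u` in the wedge product contributes the same, which turns
  -- `1 / (k + 1)!` into `1 / k!`.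
  have hi (i : Fin (k + 1)) : ∑ f : Fin (k + 1) → Fin (Module.finrank ℝ V), ((-1 : ℝ) ^ (i : ℕ) *
      (inner ℝ u (b (f i)) * η k (i.removeNth fun j ↦ b (f j)))) * ζ (k + 1) (fun j ↦ b (f j))
      = ∑ g : Fin k → Fin (Module.finrank ℝ V), η k (fun j ↦ b (g j)) * contract u ζ k (fun j ↦ b (g j)) := by
    rw [sum_fin_succ_arrow k i, Finset.sum_comm]
    refine Finset.sum_congr rfl fun g _ ↦ ?_
    have hz (z : V) : ζ (k + 1) (i.insertNth z (fun j ↦ b (g j)) : Fin (k + 1) → V)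
        = (-1 : ℝ) ^ (i : ℕ) * contract z ζ k (fun j ↦ b (g j)) := by
      have h := (ζ (k + 1)).toAlternatingMap.map_insertNth i z (fun j ↦ b (g j))
      simpa [Matrix.vecCons, contract_apply] using h
    have hs : contract u ζ k (fun j ↦ b (g j))
        = ∑ a, inner ℝ u (b a) * contract (b a) ζ k (fun j ↦ b (g j)) := by
      have h := map_sum (AddMonoidHom.mk' (fun z ↦ contract z ζ k (fun j ↦ b (g j))) fun x y ↦ by
        rw [contract_add]; rfl) (fun a ↦ (inner ℝ (b a) u : ℝ) • b a) Finset.univ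
      rw [sum_inner_smul_orthonormalBasis] at h
      refine h.trans (Finset.sum_congr rfl fun a _ ↦ ?_)
      simp only [AddMonoidHom.mk'_apply, contract_smul, real_inner_comm]
      rfl
    rw [hs, Finset.mul_sum]
    refine Finset.sum_congr rfl fun a _ ↦ ?_
    rw [comp_insertNth, hz]
    simp only [Fin.insertNth_apply_same, Fin.removeNth_insertNth]
    have : ((-1 : ℝ) ^ (i : ℕ)) * (-1) ^ (i : ℕ) = 1 := by
      rw [← mul_pow]; simp
    linear_combination (inner ℝ u (b a) * η k (fun j ↦ b (g j))
      * contract (b a) ζ k (fun j ↦ b (g j))) * this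
  have hw (f : Fin (k + 1) → Fin (Module.finrank ℝ V)) : wedgeDual u η (k + 1) (fun j ↦ b (f j))
      = ∑ i : Fin (k + 1), (-1 : ℝ) ^ (i : ℕ) *
        (inner ℝ u (b (f i)) * η k (i.removeNth fun j ↦ b (f j))) := by
    rw [wedgeDual, wedge_apply_succ]
    rfl
  simp only [hw, Finset.sum_mul]
  rw [Finset.sum_comm]
  simp only [hi, Finset.sum_const, Finset.card_univ, Fintype.card_fin, nsmul_eq_mul]
  rw [Nat.factorial_succ]
  have : ((k : ℝ) + 1) ≠ 0 := by positivity
  push_cast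
  field_simp

end ExtInner

/-! ### Charts and coordinate vector fields -/

section Charts

variable {n : ℕ} {M : Type*} [TopologicalSpace M] [ChartedSpace (Model n) M]

/-- The vector field on `M` that is constant, with value `w`, in the chart `φ`. -/
def constField (φ : OpenPartialHomeomorph M (Model n)) (w : Model n) : VField n M :=
  fun x ↦ (chartD φ x).inverse w

theorem coordField_eq_constField (φ : OpenPartialHomeomorph M (Model n)) (i : Fin n) :
    coordField φ i = constField φ (EuclideanSpace.single i 1) := rfl

theorem constField_add (φ : OpenPartialHomeomorph M (Model n)) (w w' : Model n) (x : M) :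
    constField φ (w + w') x = constField φ w x + constField φ w' x :=
  map_add _ _ _

theorem constField_smul (φ : OpenPartialHomeomorph M (Model n)) (a : ℝ) (w : Model n) (x : M) :
    constField φ (a • w) x = a • constField φ w x :=
  map_smul _ _ _

theorem constField_eq_sum (φ : OpenPartialHomeomorph M (Model n)) (w : Model n) (x : M) :
    constField φ w x = ∑ i, w i • coordField φ i x := by
  have h : w = ∑ i, w i • EuclideanSpace.single i (1 : ℝ) := by
    ext j; simp [Pi.single_apply]
  conv_lhs => rw [h]
  simp only [constField, coordField, map_sum, map_smul]

theorem chart_mdifferentiable {φ : OpenPartialHomeomorph M (Model n)} (hφ : φ ∈ Charts n M) :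
    φ.MDifferentiable 𝓘(ℝ, Model n) 𝓘(ℝ, Model n) := by
  have h1 : φ ∈ IsManifold.maximalAtlas 𝓘(ℝ, Model n) 1 M :=
    IsManifold.maximalAtlas_subset_of_le (by simp) hφ
  exact ⟨fun x hx ↦ (mdifferentiableAt_of_mem_maximalAtlas h1 hx).mdifferentiableWithinAt,
    fun y hy ↦ (mdifferentiableAt_symm_of_mem_maximalAtlas h1 hy).mdifferentiableWithinAt⟩

theorem isInvertible_chartD {φ : OpenPartialHomeomorph M (Model n)} (hφ : φ ∈ Charts n M)
    {x : M} (hx : x ∈ φ.source) : (chartD φ x).IsInvertible :=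
  ⟨(chart_mdifferentiable hφ).mfderiv hx, rfl⟩

theorem chartD_constField {φ : OpenPartialHomeomorph M (Model n)} (hφ : φ ∈ Charts n M)
    {x : M} (hx : x ∈ φ.source) (w : Model n) : chartD φ x (constField φ w x) = w := by
  obtain ⟨e, he⟩ := isInvertible_chartD hφ hx
  simp only [constField, ← he, ContinuousLinearMap.inverse_equiv]
  exact e.apply_symm_apply w

theorem constField_chartD {φ : OpenPartialHomeomorph M (Model n)} (hφ : φ ∈ Charts n M)
    {x : M} (hx : x ∈ φ.source) (u : TSp n x) : constField φ (chartD φ x u) x = u := by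
  obtain ⟨e, he⟩ := isInvertible_chartD hφ hx
  simp only [constField, ← he, ContinuousLinearMap.inverse_equiv]
  exact e.symm_apply_apply u

theorem sum_chartD_smul_coordField {φ : OpenPartialHomeomorph M (Model n)} (hφ : φ ∈ Charts n M)
    {x : M} (hx : x ∈ φ.source) (u : TSp n x) : ∑ i, chartD φ x u i • coordField φ i x = u := by
  rw [← constField_eq_sum, constField_chartD hφ hx]

theorem chartD_coordField {φ : OpenPartialHomeomorph M (Model n)} (hφ : φ ∈ Charts n M)
    {x : M} (hx : x ∈ φ.source) (i j : Fin n) :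
    chartD φ x (coordField φ i x) j = if i = j then 1 else 0 := by
  rw [coordField_eq_constField, chartD_constField hφ hx]
  simp [eq_comm]

theorem mfderiv_symm_eq_constField {φ : OpenPartialHomeomorph M (Model n)} (hφ : φ ∈ Charts n M)
    {x : M} (hx : x ∈ φ.source) (w : Model n) :
    (mfderiv 𝓘(ℝ, Model n) 𝓘(ℝ, Model n) φ.symm (φ x) : Model n →L[ℝ] _) w = constField φ w x := by
  have h := congrArg (fun f ↦ f (constField φ w x)) ((chart_mdifferentiable hφ).symm_comp_deriv hx)
  have h2 : (mfderiv 𝓘(ℝ, Model n) 𝓘(ℝ, Model n) φ.symm (φ x) : Model n →L[ℝ] _)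
      (chartD φ x (constField φ w x)) = constField φ w x := h
  rwa [chartD_constField hφ hx] at h2

theorem constField_eq_mpullback (φ : OpenPartialHomeomorph M (Model n)) (w : Model n) :
    constField φ w = VectorField.mpullback 𝓘(ℝ, Model n) 𝓘(ℝ, Model n) φ
      (fun _ ↦ (w : Model n)) := rfl

theorem mvfderiv_congr {F : Type*} [NormedAddCommGroup F] [NormedSpace ℝ F] {f g : M → F} {x : M}
    (h : f =ᶠ[𝓝 x] g) :
    mvfderiv 𝓘(ℝ, Model n) f x = mvfderiv 𝓘(ℝ, Model n) g x := by
  ext u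
  exact congrArg (fun T : TSp n x →L[ℝ] F ↦ T u) (h.mfderiv_eq (I := 𝓘(ℝ, Model n)) (I' := 𝓘(ℝ, F)))

theorem linearIndependent_coordField {φ : OpenPartialHomeomorph M (Model n)}
    (hφ : φ ∈ Charts n M) {x : M} (hx : x ∈ φ.source) :
    LinearIndependent ℝ (fun i ↦ coordField φ i x) := by
  rw [Fintype.linearIndependent_iff]
  intro g hg i
  have h := congrArg (fun u ↦ chartD φ x u i) hg
  simpa [map_sum, chartD_coordField hφ hx] using h

variable [IsManifold 𝓘(ℝ, Model n) ∞ M]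

theorem smoothOn_constField {φ : OpenPartialHomeomorph M (Model n)} (hφ : φ ∈ Charts n M)
    (w : Model n) : (constField φ w).SmoothOn φ.source := by
  intro x hx
  refine ContMDiffAt.contMDiffWithinAt ?_
  rw [constField_eq_mpullback]
  exact ContMDiffAt.mpullback_vectorField_preimage (n := ∞)
    (contMDiffAt_vectorSpace_iff_contDiffAt.2 contDiffAt_const)
    (contMDiffAt_of_mem_maximalAtlas hφ hx) (isInvertible_chartD hφ hx) (by simp)

theorem smoothOn_coordField {φ : OpenPartialHomeomorph M (Model n)} (hφ : φ ∈ Charts n M)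
    (i : Fin n) : (coordField φ i).SmoothOn φ.source :=
  smoothOn_constField hφ _

theorem mlieBracket_constField {φ : OpenPartialHomeomorph M (Model n)} (hφ : φ ∈ Charts n M)
    {x : M} (hx : x ∈ φ.source) (w w' : Model n) :
    VectorField.mlieBracket 𝓘(ℝ, Model n) (constField φ w) (constField φ w') x = 0 := by
  have : IsManifold 𝓘(ℝ, Model n) (minSmoothness ℝ 3) M := by
    rw [minSmoothness_of_isRCLikeNormedField]
    exact IsManifold.of_le (n := ∞) (WithTop.coe_le_coe.2 (le_top : (3 : ℕ∞) ≤ ⊤))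
  let W : Model n → (y : Model n) → TangentSpace 𝓘(ℝ, Model n) y := fun w _ ↦ w
  have hW (w : Model n) : MDifferentiableAt 𝓘(ℝ, Model n) 𝓘(ℝ, Model n).tangent
      (fun y ↦ (⟨y, W w y⟩ : TangentBundle 𝓘(ℝ, Model n) (Model n))) (φ x) :=
    ContMDiffAt.mdifferentiableAt (n := 1)
      (contMDiffAt_vectorSpace_iff_contDiffAt.2 contDiffAt_const) (by simp)
  have h := VectorField.mpullback_mlieBracket (n := ∞) (hW w) (hW w')
    (contMDiffAt_of_mem_maximalAtlas hφ hx)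
    (by
      rw [minSmoothness_of_isRCLikeNormedField]
      exact WithTop.coe_le_coe.2 (le_top : (2 : ℕ∞) ≤ ⊤))
  refine h.symm.trans ?_
  have h0 : VectorField.mlieBracket 𝓘(ℝ, Model n) (W w) (W w') (φ x) = 0 := by
    rw [← VectorField.mlieBracketWithin_univ, VectorField.mlieBracketWithin_eq_lieBracketWithin]
    simp [VectorField.lieBracketWithin, W]
    rfl
  rw [VectorField.mpullback, h0, map_zero]

theorem VField.SmoothOn.mono {X : VField n M} {U W : Set M} (h : X.SmoothOn U) (hW : W ⊆ U) :
    X.SmoothOn W := ContMDiffOn.mono h hW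

theorem VField.SmoothOn.contMDiffAt {X : VField n M} {U : Set M} (h : X.SmoothOn U)
    (hU : IsOpen U) {x : M} (hx : x ∈ U) :
    ContMDiffAt 𝓘(ℝ, Model n) 𝓘(ℝ, Model n).tangent ∞
      (fun x ↦ (⟨x, X x⟩ : TangentBundle 𝓘(ℝ, Model n) M)) x :=
  ContMDiffOn.contMDiffAt h (hU.mem_nhds hx)

theorem VField.SmoothOn.mdifferentiableAt {X : VField n M} {U : Set M} (h : X.SmoothOn U)
    (hU : IsOpen U) {x : M} (hx : x ∈ U) :
    MDifferentiableAt 𝓘(ℝ, Model n) 𝓘(ℝ, Model n).tangent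
      (fun x ↦ (⟨x, X x⟩ : TangentBundle 𝓘(ℝ, Model n) M)) x :=
  (h.contMDiffAt hU hx).mdifferentiableAt (by simp)

/-- The derivative of a smooth function along a smooth vector field is smooth. -/
theorem contMDiffOn_mvfderiv_apply {F : Type*} [NormedAddCommGroup F] [NormedSpace ℝ F]
    {f : M → F} {X : VField n M} {U : Set M} (hU : IsOpen U)
    (hf : ContMDiffOn 𝓘(ℝ, Model n) 𝓘(ℝ, F) ∞ f U) (hX : X.SmoothOn U) :
    ContMDiffOn 𝓘(ℝ, Model n) 𝓘(ℝ, F) ∞ (fun x ↦ mvfderiv 𝓘(ℝ, Model n) f x (X x)) U := by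
  have h := hf.contMDiffOn_tangentMapWithin (m := ∞) (by simp) hU.uniqueMDiffOn
  have h2 := h.comp hX (fun x hx ↦ hx)
  have h3 := (contMDiff_snd_tangentBundle_modelSpace F 𝓘(ℝ, F)).comp_contMDiffOn h2
  refine h3.congr fun x hx ↦ ?_
  simp only [Function.comp, tangentMapWithin, mvfderiv, mfderivWithin_of_isOpen hU hx]
  rfl

theorem smoothOn_sum_smul {ι : Type*} [Fintype ι] {f : ι → M → ℝ} {X : ι → VField n M} {U : Set M}
    (hf : ∀ i, ContMDiffOn 𝓘(ℝ, Model n) 𝓘(ℝ, ℝ) ∞ (f i) U) (hX : ∀ i, (X i).SmoothOn U) :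
    VField.SmoothOn (fun x ↦ ∑ i, f i x • X i x) U :=
  ContMDiffOn.sum_section fun i _ ↦ (hf i).smul_section (hX i)

theorem contMDiffOn_chartD {φ : OpenPartialHomeomorph M (Model n)} (hφ : φ ∈ Charts n M)
    {X : VField n M} {U : Set M} (hU : IsOpen U) (hUφ : U ⊆ φ.source) (hX : X.SmoothOn U) :
    ContMDiffOn 𝓘(ℝ, Model n) 𝓘(ℝ, Model n) ∞ (fun x ↦ (chartD φ x (X x) : Model n)) U :=
  contMDiffOn_mvfderiv_apply hU ((contMDiffOn_of_mem_maximalAtlas hφ).mono hUφ) hX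

theorem contMDiffOn_chartD_coord {φ : OpenPartialHomeomorph M (Model n)} (hφ : φ ∈ Charts n M)
    {X : VField n M} {U : Set M} (hU : IsOpen U) (hUφ : U ⊆ φ.source) (hX : X.SmoothOn U)
    (j : Fin n) : ContMDiffOn 𝓘(ℝ, Model n) 𝓘(ℝ, ℝ) ∞ (fun x ↦ chartD φ x (X x) j) U :=
  (EuclideanSpace.proj (𝕜 := ℝ) j).contMDiff.comp_contMDiffOn (contMDiffOn_chartD hφ hU hUφ hX)

end Charts

/-! ### The metric and the Levi-Civita connection in a chart -/

section MatrixSmooth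

variable {E : Type*} [NormedAddCommGroup E] [NormedSpace ℝ E] {H : Type*} [TopologicalSpace H]
  {I : ModelWithCorners ℝ E H} {N : Type*} [TopologicalSpace N] [ChartedSpace H N]
  {ι : Type*} [Fintype ι] [DecidableEq ι]

theorem contMDiffOn_det {A : N → Matrix ι ι ℝ} {U : Set N}
    (hA : ∀ i j, ContMDiffOn I 𝓘(ℝ, ℝ) ∞ (fun x ↦ A x i j) U) :
    ContMDiffOn I 𝓘(ℝ, ℝ) ∞ (fun x ↦ (A x).det) U := by
  simp only [Matrix.det_apply, zsmul_eq_mul, Units.smul_def]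
  refine contMDiffOn_finsetSum fun σ _ ↦ ?_
  exact contMDiffOn_const.mul (contMDiffOn_finsetProd fun i _ ↦ hA _ _)

theorem contMDiffOn_inv {A : N → Matrix ι ι ℝ} {U : Set N}
    (hA : ∀ i j, ContMDiffOn I 𝓘(ℝ, ℝ) ∞ (fun x ↦ A x i j) U) (hdet : ∀ x ∈ U, (A x).det ≠ 0)
    (i j : ι) : ContMDiffOn I 𝓘(ℝ, ℝ) ∞ (fun x ↦ (A x)⁻¹ i j) U := by
  have h1 : ContMDiffOn I 𝓘(ℝ, ℝ) ∞ (fun x ↦ (A x).adjugate i j) U := by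
    simp only [Matrix.adjugate_apply]
    refine contMDiffOn_det fun k l ↦ ?_
    by_cases hk : k = j
    · subst hk
      simpa using contMDiffOn_const
    · simpa [Matrix.updateRow_ne hk] using hA k l
  have h2 : ContMDiffOn I 𝓘(ℝ, ℝ) ∞ (fun x ↦ (A x).det⁻¹) U := by
    intro x hx
    exact ((contDiffAt_inv ℝ (hdet x hx)).contMDiffAt).comp_contMDiffWithinAt x
      (contMDiffOn_det hA x hx)
  refine (h2.mul h1).congr fun x hx ↦ ?_
  simp [Matrix.inv_def]

end MatrixSmooth

section Metric

variable {n : ℕ} {M : Type*} [TopologicalSpace M] [ChartedSpace (Model n) M]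
  [RiemannianBundle (fun x : M ↦ TangentSpace 𝓘(ℝ, Model n) x)]

/-- The vector field `∑_b g^{ab} ∂_b` dual to the coordinate covector field `dx_a`. -/
def dualField (φ : OpenPartialHomeomorph M (Model n)) (a : Fin n) : VField n M :=
  fun x ↦ ∑ b, (metricMatrix φ x)⁻¹ a b • coordField φ b x

theorem det_metricMatrix_pos {φ : OpenPartialHomeomorph M (Model n)}
    (hφ : φ ∈ Charts n M) {x : M} (hx : x ∈ φ.source) : 0 < (metricMatrix φ x).det :=
  (Matrix.posDef_gram_of_linearIndependent (𝕜 := ℝ) (linearIndependent_coordField hφ hx)).det_pos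

theorem inner_dualField {φ : OpenPartialHomeomorph M (Model n)} (hφ : φ ∈ Charts n M)
    {x : M} (hx : x ∈ φ.source) (a : Fin n) (u : TSp n x) :
    (inner ℝ (dualField φ a x) u : ℝ) = chartD φ x u a := by
  have h1 (c : Fin n) : (inner ℝ (dualField φ a x) (coordField φ c x) : ℝ)
      = if a = c then 1 else 0 := by
    have h := congrFun (congrFun (Matrix.nonsing_inv_mul (metricMatrix φ x)
      (det_metricMatrix_pos hφ hx).ne'.isUnit) a) c
    rw [Matrix.mul_apply, Matrix.one_apply] at h
    rw [dualField, sum_inner, ← h]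
    refine Finset.sum_congr rfl fun b _ ↦ ?_
    rw [real_inner_smul_left]
    rfl
  conv_lhs => rw [← sum_chartD_smul_coordField hφ hx u]
  simp [inner_sum, real_inner_smul_right, h1]

theorem sum_inner_dualField {φ : OpenPartialHomeomorph M (Model n)} (hφ : φ ∈ Charts n M)
    {x : M} (hx : x ∈ φ.source) (u : TSp n x) :
    ∑ a, (inner ℝ (dualField φ a x) u : ℝ) • coordField φ a x = u := by
  simp only [inner_dualField hφ hx, sum_chartD_smul_coordField hφ hx]

theorem inner_dualField_coordField {φ : OpenPartialHomeomorph M (Model n)} (hφ : φ ∈ Charts n M)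
    {x : M} (hx : x ∈ φ.source) (a b : Fin n) :
    (inner ℝ (dualField φ a x) (coordField φ b x) : ℝ) = if a = b then 1 else 0 := by
  rw [inner_dualField hφ hx, chartD_coordField hφ hx]
  simp [eq_comm]

theorem sum_inner_coordField {φ : OpenPartialHomeomorph M (Model n)} (hφ : φ ∈ Charts n M)
    {x : M} (hx : x ∈ φ.source) (u : TSp n x) :
    ∑ a, (inner ℝ (coordField φ a x) u : ℝ) • dualField φ a x = u := by
  refine ext_inner_right ℝ fun w ↦ ?_
  conv_rhs => rw [← sum_inner_dualField hφ hx w]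
  simp only [sum_inner, inner_sum, real_inner_smul_left, real_inner_smul_right]
  refine Finset.sum_congr rfl fun a _ ↦ ?_
  rw [mul_comm, real_inner_comm u]

theorem inner_dualField_dualField {φ : OpenPartialHomeomorph M (Model n)} (hφ : φ ∈ Charts n M)
    {x : M} (hx : x ∈ φ.source) (a b : Fin n) :
    (inner ℝ (dualField φ a x) (dualField φ b x) : ℝ) = (metricMatrix φ x)⁻¹ a b := by
  conv_lhs => rw [dualField, sum_inner]
  simp only [real_inner_smul_left]
  simp [real_inner_comm (dualField φ b x), inner_dualField_coordField hφ hx]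

variable [IsManifold 𝓘(ℝ, Model n) ∞ M]
  [IsContMDiffRiemannianBundle 𝓘(ℝ, Model n) ∞ (Model n)
    (fun x : M ↦ TangentSpace 𝓘(ℝ, Model n) x)]

theorem contMDiffOn_inner {X Y : VField n M} {U : Set M} (hX : X.SmoothOn U) (hY : Y.SmoothOn U) :
    ContMDiffOn 𝓘(ℝ, Model n) 𝓘(ℝ, ℝ) ∞ (fun x ↦ (inner ℝ (X x) (Y x) : ℝ)) U :=
  ContMDiffOn.inner_bundle hX hY

theorem contMDiffOn_metricMatrix {φ : OpenPartialHomeomorph M (Model n)}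
    (hφ : φ ∈ Charts n M) (i j : Fin n) :
    ContMDiffOn 𝓘(ℝ, Model n) 𝓘(ℝ, ℝ) ∞ (fun x ↦ metricMatrix φ x i j) φ.source :=
  contMDiffOn_inner (smoothOn_coordField hφ _) (smoothOn_coordField hφ _)

theorem contMDiffOn_metricMatrix_inv {φ : OpenPartialHomeomorph M (Model n)}
    (hφ : φ ∈ Charts n M) (i j : Fin n) :
    ContMDiffOn 𝓘(ℝ, Model n) 𝓘(ℝ, ℝ) ∞ (fun x ↦ (metricMatrix φ x)⁻¹ i j) φ.source :=
  contMDiffOn_inv (contMDiffOn_metricMatrix hφ) (fun _ hx ↦ (det_metricMatrix_pos hφ hx).ne') i j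

theorem smoothOn_dualField {φ : OpenPartialHomeomorph M (Model n)}
    (hφ : φ ∈ Charts n M) (a : Fin n) : (dualField φ a).SmoothOn φ.source :=
  smoothOn_sum_smul (fun b ↦ contMDiffOn_metricMatrix_inv hφ a b)
    fun _ ↦ smoothOn_coordField hφ _

end Metric

section LeviCivita

variable {n : ℕ} {M : Type*} [TopologicalSpace M] [ChartedSpace (Model n) M]
  [IsManifold 𝓘(ℝ, Model n) ∞ M]

theorem cov_add (cov : TConn n M) {X Y : VField n M} {U : Set M} (hU : IsOpen U)
    (hX : X.SmoothOn U) (hY : Y.SmoothOn U) {x : M} (hx : x ∈ U) :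
    cov (fun y ↦ X y + Y y) x = cov X x + cov Y x :=
  cov.isCovariantDerivativeOn.add (hX.mdifferentiableAt hU hx) (hY.mdifferentiableAt hU hx)

theorem cov_smul (cov : TConn n M) {f : M → ℝ} {Y : VField n M} {U : Set M} (hU : IsOpen U)
    (hf : ContMDiffOn 𝓘(ℝ, Model n) 𝓘(ℝ, ℝ) ∞ f U) (hY : Y.SmoothOn U) {x : M} (hx : x ∈ U)
    (u : TSp n x) :
    cov (fun y ↦ f y • Y y) x u = f x • cov Y x u + mvfderiv 𝓘(ℝ, Model n) f x u • Y x := by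
  have h := cov.isCovariantDerivativeOn.leibniz (hY.mdifferentiableAt hU hx)
    ((hf.contMDiffAt (hU.mem_nhds hx)).mdifferentiableAt (by simp))
  exact congrArg (fun T ↦ T u) h

theorem cov_congr (cov : TConn n M) {X Y : VField n M} {U : Set M} (hU : IsOpen U)
    (hX : X.SmoothOn U) (hXY : ∀ y ∈ U, X y = Y y) {x : M} (hx : x ∈ U) :
    cov X x = cov Y x := by
  have hY : Y.SmoothOn U := by
    refine ContMDiffOn.congr hX fun y hy ↦ ?_
    rw [hXY y hy]
  exact cov.isCovariantDerivativeOn.congr_of_eventuallyEq (hX.mdifferentiableAt hU hx)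
    (hY.mdifferentiableAt hU hx) Filter.univ_mem (Filter.eventually_of_mem (hU.mem_nhds hx) hXY)

theorem cov_sum (cov : TConn n M) {ι : Type*} (s : Finset ι) {X : ι → VField n M} {U : Set M}
    (hU : IsOpen U) (hX : ∀ i, (X i).SmoothOn U) {x : M} (hx : x ∈ U) :
    cov (fun y ↦ ∑ i ∈ s, X i y) x = ∑ i ∈ s, cov (X i) x := by
  classical
  induction s using Finset.induction_on with
  | empty => exact cov.isCovariantDerivativeOn.zero (mem_univ x)
  | insert a s ha ih =>
    simp only [Finset.sum_insert ha]
    rw [cov_add cov hU (hX a) (ContMDiffOn.sum_section fun i _ ↦ hX i) hx, ih]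

theorem cov_sum_smul (cov : TConn n M) {ι : Type*} [Fintype ι] {f : ι → M → ℝ}
    {X : ι → VField n M} {U : Set M} (hU : IsOpen U)
    (hf : ∀ i, ContMDiffOn 𝓘(ℝ, Model n) 𝓘(ℝ, ℝ) ∞ (f i) U) (hX : ∀ i, (X i).SmoothOn U)
    {x : M} (hx : x ∈ U) (u : TSp n x) :
    cov (fun y ↦ ∑ i, f i y • X i y) x u
      = ∑ i, (f i x • cov (X i) x u + mvfderiv 𝓘(ℝ, Model n) (f i) x u • X i x) := by
  have h := cov_sum cov Finset.univ (X := fun i y ↦ f i y • X i y) hU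
    (fun i ↦ (hf i).smul_section (hX i)) hx
  rw [h, sum_apply]
  exact Finset.sum_congr rfl fun i _ ↦ cov_smul cov hU (hf i) (hX i) hx u

/-- The coordinate expression of a connection on `TM`. -/
theorem cov_apply_eq_sum (cov : TConn n M) {φ : OpenPartialHomeomorph M (Model n)}
    (hφ : φ ∈ Charts n M) {Y : VField n M} {U : Set M} (hU : IsOpen U) (hUφ : U ⊆ φ.source)
    (hY : Y.SmoothOn U) {x : M} (hx : x ∈ U) (u : TSp n x) :
    cov Y x u = ∑ j, (chartD φ x (Y x) j • cov (coordField φ j) x u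
      + mvfderiv 𝓘(ℝ, Model n) (fun y ↦ chartD φ y (Y y) j) x u • coordField φ j x) := by
  rw [← cov_sum_smul cov (X := fun j ↦ coordField φ j) hU
    (fun j ↦ contMDiffOn_chartD_coord hφ hU hUφ hY j)
    (fun j ↦ (smoothOn_coordField hφ _).mono hUφ) hx]
  refine congrArg (fun T ↦ T u) (cov_congr cov hU hY (fun y hy ↦ ?_) hx)
  exact (sum_chartD_smul_coordField hφ (hUφ hy) _).symm

variable [RiemannianBundle (fun x : M ↦ TangentSpace 𝓘(ℝ, Model n) x)]
  [IsContMDiffRiemannianBundle 𝓘(ℝ, Model n) ∞ (Model n)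
    (fun x : M ↦ TangentSpace 𝓘(ℝ, Model n) x)] {cov : TConn n M}

set_option synthInstance.maxHeartbeats 400000 in
theorem IsLeviCivita.mvfderiv_inner (hcov : IsLeviCivita cov) {X Y : VField n M} {U : Set M}
    (hU : IsOpen U) (hX : X.SmoothOn U) (hY : Y.SmoothOn U) {x : M} (hx : x ∈ U) (u : TSp n x) :
    mvfderiv 𝓘(ℝ, Model n) (fun y ↦ (inner ℝ (X y) (Y y) : ℝ)) x u
      = inner ℝ (cov X x u) (Y x) + inner ℝ (X x) (cov Y x u) := by
  have h := hcov.metric.mvfderiv_inner_eq (x := x) (FiberBundle.extend (Model n) u)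
    (hX.mdifferentiableAt hU hx) (hY.mdifferentiableAt hU hx)
  simpa using h

theorem IsLeviCivita.cov_constField_comm (hcov : IsLeviCivita cov)
    {φ : OpenPartialHomeomorph M (Model n)} (hφ : φ ∈ Charts n M) {x : M} (hx : x ∈ φ.source)
    (w w' : Model n) :
    cov (constField φ w) x (constField φ w' x) = cov (constField φ w') x (constField φ w x) := by
  have h := (CovariantDerivative.torsion_eq_zero_iff cov).1 hcov.torsion_eq_zero
    ((smoothOn_constField hφ w').mdifferentiableAt φ.open_source hx)
    ((smoothOn_constField hφ w).mdifferentiableAt φ.open_source hx)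
  rw [mlieBracket_constField hφ hx] at h
  exact sub_eq_zero.1 h

/-- The Koszul formula in coordinates. -/
theorem IsLeviCivita.inner_cov_coordField (hcov : IsLeviCivita cov)
    {φ : OpenPartialHomeomorph M (Model n)} (hφ : φ ∈ Charts n M) {x : M} (hx : x ∈ φ.source)
    (i j k : Fin n) :
    (inner ℝ (cov (coordField φ j) x (coordField φ i x)) (coordField φ k x) : ℝ) =
      (1 / 2) * (mvfderiv 𝓘(ℝ, Model n) (fun y ↦ metricMatrix φ y j k) x (coordField φ i x)
        + mvfderiv 𝓘(ℝ, Model n) (fun y ↦ metricMatrix φ y i k) x (coordField φ j x)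
        - mvfderiv 𝓘(ℝ, Model n) (fun y ↦ metricMatrix φ y i j) x (coordField φ k x)) := by
  have hs (i : Fin n) := smoothOn_coordField hφ i
  have hm (i j k : Fin n) : mvfderiv 𝓘(ℝ, Model n) (fun y ↦ metricMatrix φ y j k) x
      (coordField φ i x) = _ :=
    hcov.mvfderiv_inner φ.open_source (hs j) (hs k) hx (coordField φ i x)
  rw [hm, hm, hm]
  have hc (i j : Fin n) : cov (coordField φ j) x (coordField φ i x)
    = cov (coordField φ i) x (coordField φ j x) := hcov.cov_constField_comm hφ hx _ _
  rw [hc k j, hc k i, hc j i, real_inner_comm _ (coordField φ j x),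
    real_inner_comm _ (coordField φ i x)]
  ring

theorem IsLeviCivita.smoothOn_cov_coordField (hcov : IsLeviCivita cov)
    {φ : OpenPartialHomeomorph M (Model n)} (hφ : φ ∈ Charts n M) (i j : Fin n) :
    VField.SmoothOn (fun x ↦ cov (coordField φ j) x (coordField φ i x)) φ.source := by
  have hs (i : Fin n) : (coordField φ i).SmoothOn φ.source :=
    smoothOn_coordField hφ i
  have hd (i j k : Fin n) := contMDiffOn_mvfderiv_apply φ.open_source
    (contMDiffOn_metricMatrix hφ j k) (hs i)
  have h := smoothOn_sum_smul (f := fun k x ↦ (1 / 2 : ℝ) *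
        (mvfderiv 𝓘(ℝ, Model n) (fun y ↦ metricMatrix φ y j k) x (coordField φ i x)
        + mvfderiv 𝓘(ℝ, Model n) (fun y ↦ metricMatrix φ y i k) x (coordField φ j x)
        - mvfderiv 𝓘(ℝ, Model n) (fun y ↦ metricMatrix φ y i j) x (coordField φ k x)))
    (fun k ↦ contMDiffOn_const.mul (((hd i j k).add (hd j i k)).sub (hd k i j)))
    (fun k ↦ smoothOn_dualField hφ k)
  refine ContMDiffOn.congr h fun x hx ↦ ?_
  simp only [← hcov.inner_cov_coordField hφ hx, TotalSpace.mk_inj]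
  conv_lhs => rw [← sum_inner_coordField hφ hx (cov (coordField φ j) x (coordField φ i x))]
  exact Finset.sum_congr rfl fun k _ ↦ by rw [real_inner_comm]

/-- The Levi-Civita connection is smooth, by the Koszul formula. -/
theorem IsLeviCivita.smoothOn_cov (hcov : IsLeviCivita cov) {X Y : VField n M} {U : Set M}
    (hU : IsOpen U) (hX : X.SmoothOn U) (hY : Y.SmoothOn U) :
    VField.SmoothOn (fun x ↦ cov Y x (X x)) U := by
  intro x hx
  set φ := chartAt (Model n) x
  have hφ : φ ∈ Charts n M := IsManifold.chart_mem_maximalAtlas x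
  set W := U ∩ φ.source
  have hW : IsOpen W := hU.inter φ.open_source
  have hxW : x ∈ W := ⟨hx, mem_chart_source _ x⟩
  have hXW := hX.mono (inter_subset_left : W ⊆ U)
  have hYW := hY.mono (inter_subset_left : W ⊆ U)
  have hWφ : W ⊆ φ.source := inter_subset_right
  have hc (j : Fin n) : VField.SmoothOn (fun x ↦ cov (coordField φ j) x (X x)) W := by
    refine ContMDiffOn.congr (smoothOn_sum_smul
      (fun i ↦ contMDiffOn_chartD_coord hφ hW hWφ hXW i)
      (fun i ↦ (hcov.smoothOn_cov_coordField hφ i j).mono hWφ)) fun y hy ↦ ?_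
    have h := congrArg (cov (coordField φ j) y) (sum_chartD_smul_coordField hφ (hWφ hy) (X y))
    simp only [map_sum, map_smul] at h
    exact congrArg _ h.symm
  have h : VField.SmoothOn (fun x ↦ cov Y x (X x)) W := by
    refine ContMDiffOn.congr (ContMDiffOn.add_section
      (smoothOn_sum_smul (fun j ↦ contMDiffOn_chartD_coord hφ hW hWφ hYW j) hc)
      (smoothOn_sum_smul (fun j ↦ contMDiffOn_mvfderiv_apply hW
        (contMDiffOn_chartD_coord hφ hW hWφ hYW j) hXW)
        (fun j ↦ (smoothOn_coordField hφ j).mono hWφ))) fun y hy ↦ ?_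
    exact congrArg _ ((cov_apply_eq_sum cov hφ hW hWφ hYW hy (X y)).trans Finset.sum_add_distrib)
  exact (ContMDiffOn.contMDiffAt h (hW.mem_nhds hxW)).contMDiffWithinAt

theorem IsLeviCivita.inner_cov_dualField_add (hcov : IsLeviCivita cov)
    {φ : OpenPartialHomeomorph M (Model n)} (hφ : φ ∈ Charts n M) {x : M} (hx : x ∈ φ.source)
    (u : TSp n x) (a c : Fin n) :
    (inner ℝ (cov (dualField φ a) x u) (coordField φ c x) : ℝ)
      + inner ℝ (dualField φ a x) (cov (coordField φ c) x u) = 0 := by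
  have h1 := hcov.mvfderiv_inner φ.open_source (smoothOn_dualField hφ a)
    (smoothOn_coordField hφ c) hx u
  refine h1.symm.trans ?_
  have h2 : (fun y ↦ (inner ℝ (dualField φ a y)
      (coordField φ c y) : ℝ))
      =ᶠ[𝓝 x] fun _ ↦ if a = c then (1 : ℝ) else 0 :=
    Filter.eventually_of_mem (φ.open_source.mem_nhds hx) fun y hy ↦
      inner_dualField_coordField hφ hy a c
  have h3 : mvfderiv 𝓘(ℝ, Model n) (fun y ↦ (inner ℝ (dualField φ a y)
      (coordField φ c y) : ℝ)) x = 0 :=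
    (mvfderiv_congr h2).trans (mvfderiv_const _)
  rw [h3]; rfl

/-- The dual frame differentiates by minus the transposed connection form: `∑_a ∇_u E^a ⊗ ∂_a` and
`∑_a E^a ⊗ ∇_u ∂_a` cancel. -/
theorem IsLeviCivita.sum_cov_dual_add (hcov : IsLeviCivita cov)
    {φ : OpenPartialHomeomorph M (Model n)} (hφ : φ ∈ Charts n M) {x : M} (hx : x ∈ φ.source)
    (u : TSp n x) {W : Type*} [AddCommGroup W] [Module ℝ W]
    (b : TSp n x →ₗ[ℝ] TSp n x →ₗ[ℝ] W) :
    ∑ a, (b (cov (dualField φ a) x u) (coordField φ a x)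
      + b (dualField φ a x) (cov (coordField φ a) x u)) = 0 := by
  have e1 (a : Fin n) : b (cov (dualField φ a) x u) (coordField φ a x)
      = ∑ c, (inner ℝ (cov (dualField φ a) x u) (coordField φ c x) : ℝ)
        • b (dualField φ c x) (coordField φ a x) := by
    conv_lhs => rw [← sum_inner_coordField hφ hx (cov (dualField φ a) x u)]
    simp [real_inner_comm]
  have e2 (a : Fin n) : b (dualField φ a x) (cov (coordField φ a) x u)
      = ∑ c, (inner ℝ (dualField φ c x) (cov (coordField φ a) x u) : ℝ)
        • b (dualField φ a x) (coordField φ c x) := by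
    conv_lhs => rw [← sum_inner_dualField hφ hx (cov (coordField φ a) x u)]
    simp
  rw [Finset.sum_add_distrib]
  simp only [e1, e2]
  rw [Finset.sum_comm, ← Finset.sum_add_distrib]
  refine Finset.sum_eq_zero fun c _ ↦ ?_
  rw [← Finset.sum_add_distrib]
  refine Finset.sum_eq_zero fun a _ ↦ ?_
  rw [← add_smul, hcov.inner_cov_dualField_add hφ hx, zero_smul]

end LeviCivita

/-! ### Smooth forms and the product rule for the induced connection -/

section Evaluation

variable {n : ℕ} {M : Type*} [TopologicalSpace M] [ChartedSpace (Model n) M]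

theorem chart_contMDiffOn {φ : OpenPartialHomeomorph M (Model n)} (hφ : φ ∈ Charts n M) :
    ContMDiffOn 𝓘(ℝ, Model n) 𝓘(ℝ, Model n) ∞ φ φ.source :=
  contMDiffOn_of_mem_maximalAtlas hφ

theorem chart_symm_contMDiffOn {φ : OpenPartialHomeomorph M (Model n)} (hφ : φ ∈ Charts n M) :
    ContMDiffOn 𝓘(ℝ, Model n) 𝓘(ℝ, Model n) ∞ φ.symm φ.target :=
  contMDiffOn_symm_of_mem_maximalAtlas hφ

theorem contMDiffOn_comp_chart {F : Type*} [NormedAddCommGroup F] [NormedSpace ℝ F]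
    {φ : OpenPartialHomeomorph M (Model n)} (hφ : φ ∈ Charts n M) {f : Model n → F} {U : Set M}
    (hf : ContDiffOn ℝ ∞ f (φ.target ∩ φ.symm ⁻¹' U)) :
    ContMDiffOn 𝓘(ℝ, Model n) 𝓘(ℝ, F) ∞ (fun x ↦ f (φ x)) (U ∩ φ.source) := by
  refine hf.contMDiffOn.comp ((chart_contMDiffOn hφ).mono inter_subset_right) fun x hx ↦ ?_
  exact ⟨φ.map_source hx.2, by simpa [φ.left_inv hx.2] using hx.1⟩

theorem contDiffOn_comp_chart_symm {F : Type*} [NormedAddCommGroup F] [NormedSpace ℝ F]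
    {φ : OpenPartialHomeomorph M (Model n)} (hφ : φ ∈ Charts n M) {f : M → F} {U : Set M}
    (hf : ContMDiffOn 𝓘(ℝ, Model n) 𝓘(ℝ, F) ∞ f (U ∩ φ.source)) :
    ContDiffOn ℝ ∞ (fun y ↦ f (φ.symm y)) (φ.target ∩ φ.symm ⁻¹' U) := by
  refine (hf.comp ((chart_symm_contMDiffOn hφ).mono inter_subset_left) fun y hy ↦ ?_).contDiffOn
  exact ⟨hy.2, φ.map_target hy.1⟩

/-- The derivative of a function, computed in a chart. -/
theorem mvfderiv_eq_fderiv {F : Type*} [NormedAddCommGroup F] [NormedSpace ℝ F]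
    {φ : OpenPartialHomeomorph M (Model n)} (hφ : φ ∈ Charts n M) {f : M → F} {x : M}
    (hx : x ∈ φ.source) (hf : MDifferentiableAt 𝓘(ℝ, Model n) 𝓘(ℝ, F) f x) (u : TSp n x) :
    mvfderiv 𝓘(ℝ, Model n) f x u = fderiv ℝ (fun y ↦ f (φ.symm y)) (φ x) (chartD φ x u) := by
  have hφd := chart_mdifferentiable hφ
  have h1 : f =ᶠ[𝓝 x] (fun y ↦ f (φ.symm y)) ∘ φ :=
    Filter.eventually_of_mem (φ.open_source.mem_nhds hx) fun y hy ↦ by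
      simp [φ.left_inv hy]
  have h2 : MDifferentiableAt 𝓘(ℝ, Model n) 𝓘(ℝ, F) (fun y ↦ f (φ.symm y)) (φ x) := by
    refine MDifferentiableAt.comp (I' := 𝓘(ℝ, Model n)) (φ x) ?_
      (hφd.mdifferentiableAt_symm (φ.map_source hx))
    rwa [φ.left_inv hx]
  rw [mvfderiv_congr h1]
  refine (mfderiv_comp_apply (I' := 𝓘(ℝ, Model n)) x h2 (hφd.mdifferentiableAt hx) u).trans ?_
  exact congrArg (fun T : Model n →L[ℝ] F ↦ T (chartD φ x u)) (mfderiv_eq_fderiv)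

theorem mvfderiv_comp_chart {F : Type*} [NormedAddCommGroup F] [NormedSpace ℝ F]
    {φ : OpenPartialHomeomorph M (Model n)} (hφ : φ ∈ Charts n M) {f : Model n → F} {x : M}
    (hx : x ∈ φ.source) (hf : DifferentiableAt ℝ f (φ x)) (u : TSp n x) :
    mvfderiv 𝓘(ℝ, Model n) (fun x ↦ f (φ x)) x u = fderiv ℝ f (φ x) (chartD φ x u) := by
  refine (mfderiv_comp_apply (I' := 𝓘(ℝ, Model n)) (g := f) x hf.mdifferentiableAt
    ((chart_mdifferentiable hφ).mdifferentiableAt hx) u).trans ?_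
  exact congrArg (fun T : Model n →L[ℝ] F ↦ T (chartD φ x u)) (mfderiv_eq_fderiv)

theorem mvfderiv_alternating_apply {k : ℕ} {f : M → (Model n) [⋀^Fin k]→L[ℝ] ℝ}
    {g : Fin k → M → Model n} {x : M}
    (hf : MDifferentiableAt 𝓘(ℝ, Model n) 𝓘(ℝ, (Model n) [⋀^Fin k]→L[ℝ] ℝ) f x)
    (hg : ∀ i, MDifferentiableAt 𝓘(ℝ, Model n) 𝓘(ℝ, Model n) (g i) x)
    [IsManifold 𝓘(ℝ, Model n) ∞ M] (u : TSp n x) :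
    mvfderiv 𝓘(ℝ, Model n) (fun y ↦ f y (fun i ↦ g i y)) x u =
      mvfderiv 𝓘(ℝ, Model n) f x u (fun i ↦ g i x) +
        ∑ i, f x (Function.update (fun i ↦ g i x) i (mvfderiv 𝓘(ℝ, Model n) (g i) x u)) := by
  have hφ : chartAt (Model n) x ∈ Charts n M := IsManifold.chart_mem_maximalAtlas x
  set φ := chartAt (Model n) x
  have hx : x ∈ φ.source := mem_chart_source _ x
  have key {F : Type _} [NormedAddCommGroup F] [NormedSpace ℝ F] {h : M → F}
      (hh : MDifferentiableAt 𝓘(ℝ, Model n) 𝓘(ℝ, F) h x) :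
      DifferentiableAt ℝ (fun y ↦ h (φ.symm y)) (φ x) := by
    refine MDifferentiableAt.differentiableAt ?_
    refine MDifferentiableAt.comp (I' := 𝓘(ℝ, Model n)) (φ x) ?_
      ((chart_mdifferentiable hφ).mdifferentiableAt_symm (φ.map_source hx))
    rwa [φ.left_inv hx]
  have hfg : MDifferentiableAt 𝓘(ℝ, Model n) 𝓘(ℝ, ℝ) (fun y ↦ f y (fun i ↦ g i y)) x := by
    have h1 := (key hf).continuousAlternatingMap_apply (fun i ↦ key (hg i))
    have h2 := (h1.mdifferentiableAt).comp x ((chart_mdifferentiable hφ).mdifferentiableAt hx)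
    refine h2.congr_of_eventuallyEq ?_
    exact Filter.eventually_of_mem (φ.open_source.mem_nhds hx) fun y hy ↦ by
      simp [φ.left_inv hy]
  rw [mvfderiv_eq_fderiv hφ hx hfg, mvfderiv_eq_fderiv hφ hx hf,
    fderiv_continuousAlternatingMap_apply_apply (key hf) (fun i ↦ key (hg i))]
  simp only [φ.left_inv hx, mvfderiv_eq_fderiv hφ hx (hg _)]

end Evaluation

section SmoothForms

variable {n : ℕ}

/-- A family of alternating forms is smooth as soon as its values on the multi-indices of the
standard basis are. -/
theorem contDiffOn_alternating {k : ℕ} {f : Model n → (Model n) [⋀^Fin k]→L[ℝ] ℝ} {s : Set (Model n)}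
    (hf : ∀ J : Fin k → Fin n, ContDiffOn ℝ ∞
      (fun y ↦ f y (fun i ↦ EuclideanSpace.single (J i) (1 : ℝ))) s) :
    ContDiffOn ℝ ∞ f s := by
  let ev : ((Model n) [⋀^Fin k]→L[ℝ] ℝ) →ₗ[ℝ] ((Fin k → Fin n) → ℝ) :=
    LinearMap.pi fun J ↦ (ContinuousAlternatingMap.apply ℝ (Model n) ℝ
      (fun i ↦ EuclideanSpace.single (J i) (1 : ℝ))).toLinearMap
  have hev : LinearMap.ker ev = ⊥ := by
    refine LinearMap.ker_eq_bot'.2 fun m hm ↦ ?_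
    refine ContinuousAlternatingMap.toAlternatingMap_injective ?_
    refine Module.Basis.ext_alternating (EuclideanSpace.basisFun (Fin n) ℝ).toBasis fun J _ ↦ ?_
    have h : m (fun i ↦ EuclideanSpace.single (J i) (1 : ℝ)) = 0 := congrFun hm J
    simpa using h
  obtain ⟨L, hL⟩ := ev.exists_leftInverse_of_injective hev
  have h1 : ContDiffOn ℝ ∞ (fun y ↦ ev (f y)) s := contDiffOn_pi.2 hf
  refine (L.toContinuousLinearMap.contDiff.comp_contDiffOn h1).congr fun y _ ↦ ?_
  exact (LinearMap.congr_fun hL (f y)).symm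

variable {M : Type*} [TopologicalSpace M] [ChartedSpace (Model n) M]
  [RiemannianBundle (fun x : M ↦ TangentSpace 𝓘(ℝ, Model n) x)]

/-- The value of `coordForm` on constant vectors; the points `φ.symm (φ x)` and `x` are identified
through a dependent pair, as the tangent spaces there are different types. -/
theorem coordForm_apply {φ : OpenPartialHomeomorph M (Model n)} (hφ : φ ∈ Charts n M)
    (θ : DForm n M) (k : ℕ) {x : M} (hx : x ∈ φ.source) (w : Fin k → Model n) :
    coordForm φ θ k (φ x) w = θ x k (fun i ↦ constField φ (w i) x) := by
  have h : (⟨φ.symm (φ x), fun i ↦ mfderiv 𝓘(ℝ, Model n) 𝓘(ℝ, Model n) φ.symm (φ x) (w i)⟩ :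
      (x : M) × (Fin k → TSp n x)) = ⟨x, fun i ↦ constField φ (w i) x⟩ := by
    exact Sigma.ext (φ.left_inv hx) (@heq_of_eq (Fin k → Model n) _ _
      (funext fun i ↦ mfderiv_symm_eq_constField hφ hx (w i)))
  exact congrArg (fun p : (x : M) × (Fin k → TSp n x) ↦ θ p.1 k p.2) h

theorem coordForm_apply_chartD {φ : OpenPartialHomeomorph M (Model n)} (hφ : φ ∈ Charts n M)
    (θ : DForm n M) (k : ℕ) {x : M} (hx : x ∈ φ.source) (w : Fin k → TSp n x) :
    coordForm φ θ k (φ x) (fun i ↦ chartD φ x (w i)) = θ x k w := by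
  rw [coordForm_apply hφ θ k hx]
  simp only [constField_chartD hφ hx]

theorem DForm.SmoothOn.mono {θ : DForm n M} {U W : Set M} (h : θ.SmoothOn U) (hW : W ⊆ U) :
    θ.SmoothOn W :=
  fun φ hφ k ↦ (h φ hφ k).mono (inter_subset_inter_right _ (preimage_mono hW))

theorem DForm.SmoothOn.congr {θ η : DForm n M} {U : Set M} (h : θ.SmoothOn U)
    (hη : ∀ x ∈ U, η x = θ x) : η.SmoothOn U := by
  refine fun φ hφ k ↦ (h φ hφ k).congr fun y hy ↦ ?_
  simp only [coordForm, hη _ hy.2]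

theorem DForm.smoothOn_zero (U : Set M) : DForm.SmoothOn (fun _ ↦ 0 : DForm n M) U := by
  intro φ hφ k
  exact (contDiffOn_const (c := 0)).congr fun y _ ↦ by ext w; rfl

variable [IsManifold 𝓘(ℝ, Model n) ∞ M]

/-- A smooth form is smooth on smooth vector fields. -/
theorem DForm.SmoothOn.apply {θ : DForm n M} {U : Set M} (hU : IsOpen U) (hθ : θ.SmoothOn U)
    {k : ℕ} {X : Fin k → VField n M} (hX : ∀ i, (X i).SmoothOn U) :
    ContMDiffOn 𝓘(ℝ, Model n) 𝓘(ℝ, ℝ) ∞ (fun x ↦ θ x k (fun i ↦ X i x)) U := by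
  intro x hx
  have hφ : chartAt (Model n) x ∈ Charts n M := IsManifold.chart_mem_maximalAtlas x
  set φ := chartAt (Model n) x
  set W := U ∩ φ.source
  have hW : IsOpen W := hU.inter φ.open_source
  have hxW : x ∈ W := ⟨hx, mem_chart_source _ x⟩
  have hXW (i : Fin k) : (X i).SmoothOn W := (hX i).mono inter_subset_left
  have h1 (J : Fin k → Fin n) : ContMDiffOn 𝓘(ℝ, Model n) 𝓘(ℝ, ℝ) ∞
      (fun x ↦ coordForm φ θ k (φ x) (fun i ↦ EuclideanSpace.single (J i) (1 : ℝ))) W :=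
    (ContinuousAlternatingMap.apply ℝ (Model n) ℝ
      (fun i ↦ EuclideanSpace.single (J i) (1 : ℝ))).contMDiff.comp_contMDiffOn
      (contMDiffOn_comp_chart hφ (hθ φ hφ k))
  have h2 : ContMDiffOn 𝓘(ℝ, Model n) 𝓘(ℝ, ℝ) ∞ (fun x ↦ ∑ J : Fin k → Fin n,
      (∏ i, chartD φ x (X i x) (J i)) *
        coordForm φ θ k (φ x) (fun i ↦ EuclideanSpace.single (J i) (1 : ℝ))) W :=
    contMDiffOn_finsetSum fun J _ ↦ (contMDiffOn_finsetProd fun i _ ↦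
      contMDiffOn_chartD_coord hφ hW inter_subset_right (hXW i) (J i)).mul (h1 J)
  refine (ContMDiffOn.contMDiffAt (h2.congr fun y hy ↦ ?_) (hW.mem_nhds hxW)).contMDiffWithinAt
  rw [← coordForm_apply_chartD hφ θ k hy.2]
  have h3 (i : Fin k) : chartD φ y (X i y)
      = ∑ j, chartD φ y (X i y) j • (EuclideanSpace.single j (1 : ℝ) : Model n) := by
    ext l; simp [Pi.single_apply]
  have h4 := (coordForm φ θ k (φ y)).toMultilinearMap.map_sum
    (fun i j ↦ chartD φ y (X i y) j • (EuclideanSpace.single j (1 : ℝ) : Model n))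
  simp only [← h3] at h4
  refine h4.trans (Finset.sum_congr rfl fun J _ ↦ ?_)
  exact (coordForm φ θ k (φ y)).toMultilinearMap.map_smul_univ _ _

theorem DForm.smoothOn_of_apply {θ : DForm n M} {U : Set M} (hU : IsOpen U)
    (h : ∀ W ⊆ U, IsOpen W → ∀ (k : ℕ) (X : Fin k → VField n M), (∀ i, (X i).SmoothOn W) →
      ContMDiffOn 𝓘(ℝ, Model n) 𝓘(ℝ, ℝ) ∞ (fun x ↦ θ x k (fun i ↦ X i x)) W) :
    θ.SmoothOn U := by
  intro φ hφ k
  refine contDiffOn_alternating fun J ↦ ?_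
  have h1 := h (U ∩ φ.source) inter_subset_left (hU.inter φ.open_source) k
    (fun i ↦ coordField φ (J i)) (fun i ↦ (smoothOn_coordField hφ _).mono inter_subset_right)
  refine (contDiffOn_comp_chart_symm hφ h1).congr fun y hy ↦ ?_
  have h2 := coordForm_apply hφ θ k (φ.map_target hy.1)
    (fun i ↦ EuclideanSpace.single (J i) (1 : ℝ))
  rwa [φ.right_inv hy.1] at h2

theorem DForm.smoothOn_of_locally {θ : DForm n M} {U : Set M} (hU : IsOpen U)
    (h : ∀ x ∈ U, ∃ W, IsOpen W ∧ x ∈ W ∧ θ.SmoothOn W) : θ.SmoothOn U := by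
  refine DForm.smoothOn_of_apply hU fun V hVU hV k X hX x hx ↦ ?_
  obtain ⟨W, hW, hxW, hθ⟩ := h x (hVU hx)
  have h1 := DForm.SmoothOn.apply (hV.inter hW) (hθ.mono inter_subset_right)
    (fun i ↦ (hX i).mono (inter_subset_left : V ∩ W ⊆ V))
  exact (h1.contMDiffAt ((hV.inter hW).mem_nhds ⟨hx, hxW⟩)).contMDiffWithinAt

theorem DForm.SmoothOn.add {θ η : DForm n M} {U : Set M} (hU : IsOpen U) (hθ : θ.SmoothOn U)
    (hη : η.SmoothOn U) : DForm.SmoothOn (fun x ↦ θ x + η x) U :=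
  DForm.smoothOn_of_apply hU fun _ hWU hW _ _ hX ↦
    ((hθ.mono hWU).apply hW hX).add ((hη.mono hWU).apply hW hX)

theorem DForm.SmoothOn.smul {f : M → ℝ} {θ : DForm n M} {U : Set M} (hU : IsOpen U)
    (hf : ContMDiffOn 𝓘(ℝ, Model n) 𝓘(ℝ, ℝ) ∞ f U) (hθ : θ.SmoothOn U) :
    DForm.SmoothOn (fun x ↦ f x • θ x) U :=
  DForm.smoothOn_of_apply hU fun _ hWU hW _ _ hX ↦
    (hf.mono hWU).mul ((hθ.mono hWU).apply hW hX)

theorem DForm.SmoothOn.const_smul (a : ℝ) {θ : DForm n M} {U : Set M} (hU : IsOpen U)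
    (hθ : θ.SmoothOn U) : DForm.SmoothOn (fun x ↦ a • θ x) U :=
  DForm.SmoothOn.smul hU contMDiffOn_const hθ

theorem DForm.SmoothOn.sub {θ η : DForm n M} {U : Set M} (hU : IsOpen U) (hθ : θ.SmoothOn U)
    (hη : η.SmoothOn U) : DForm.SmoothOn (fun x ↦ θ x - η x) U :=
  DForm.smoothOn_of_apply hU fun _ hWU hW _ _ hX ↦
    ((hθ.mono hWU).apply hW hX).sub ((hη.mono hWU).apply hW hX)

theorem DForm.SmoothOn.sum {ι : Type*} {s : Finset ι} {θ : ι → DForm n M} {U : Set M}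
    (hU : IsOpen U) (hθ : ∀ i ∈ s, (θ i).SmoothOn U) :
    DForm.SmoothOn (fun x ↦ ∑ i ∈ s, θ i x) U := by
  classical
  induction s using Finset.induction_on with
  | empty => simpa using DForm.smoothOn_zero U
  | insert a s ha ih =>
    simp only [Finset.sum_insert ha]
    exact (hθ a (Finset.mem_insert_self a s)).add hU
      (ih fun i hi ↦ hθ i (Finset.mem_insert_of_mem hi))

theorem DForm.SmoothOn.contract {v : VField n M} {θ : DForm n M} {U : Set M} (hU : IsOpen U)
    (hv : v.SmoothOn U) (hθ : θ.SmoothOn U) :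
    DForm.SmoothOn (fun x ↦ contract (v x) (θ x)) U := by
  refine DForm.smoothOn_of_apply hU fun W hWU hW k X hX ↦ ?_
  have h := (hθ.mono hWU).apply hW (X := Fin.cons v X) (k := k + 1) (fun i ↦ by
    refine Fin.cases ?_ (fun i ↦ ?_) i
    · exact hv.mono hWU
    · exact hX i)
  refine h.congr fun x _ ↦ ?_
  rw [contract_apply]
  refine congrArg _ (funext fun i ↦ ?_)
  refine Fin.cases rfl (fun i ↦ rfl) i

variable [IsContMDiffRiemannianBundle 𝓘(ℝ, Model n) ∞ (Model n)
    (fun x : M ↦ TangentSpace 𝓘(ℝ, Model n) x)]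

theorem DForm.SmoothOn.wedgeDual {v : VField n M} {θ : DForm n M} {U : Set M} (hU : IsOpen U)
    (hv : v.SmoothOn U) (hθ : θ.SmoothOn U) :
    DForm.SmoothOn (fun x ↦ wedgeDual (v x) (θ x)) U := by
  refine DForm.smoothOn_of_apply hU fun W hWU hW k X hX ↦ ?_
  cases k with
  | zero =>
    exact (contMDiffOn_const (c := 0)).congr fun x _ ↦ by simp [StatHodge.wedgeDual, wedge_apply_zero]
  | succ k =>
    have h : ContMDiffOn 𝓘(ℝ, Model n) 𝓘(ℝ, ℝ) ∞ (fun x ↦ ∑ i : Fin (k + 1), (-1 : ℝ) ^ (i : ℕ) *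
        ((inner ℝ (v x) (X i x) : ℝ) * θ x k (fun j ↦ i.removeNth X j x))) W :=
      contMDiffOn_finsetSum fun i _ ↦ contMDiffOn_const.mul
        ((contMDiffOn_inner (hv.mono hWU) (hX i)).mul
          ((hθ.mono hWU).apply hW fun j ↦ hX _))
    refine h.congr fun x _ ↦ ?_
    rw [StatHodge.wedgeDual, wedge_apply_succ]
    rfl

theorem DForm.SmoothOn.cliff {v : VField n M} {θ : DForm n M} {U : Set M} (hU : IsOpen U)
    (hv : v.SmoothOn U) (hθ : θ.SmoothOn U) :
    DForm.SmoothOn (fun x ↦ cliff (v x) (θ x)) U :=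
  (DForm.SmoothOn.wedgeDual hU hv hθ).sub hU (DForm.SmoothOn.contract hU hv hθ)

end SmoothForms

/-! ### The induced connection on forms -/

section FunctionDerivatives

variable {n : ℕ} {M : Type*} [TopologicalSpace M] [ChartedSpace (Model n) M]
  {U : Set M} {f g : M → ℝ} {x : M}

theorem ContMDiffOn.mdifferentiableAt_of_isOpen (hU : IsOpen U)
    (hf : ContMDiffOn 𝓘(ℝ, Model n) 𝓘(ℝ, ℝ) ∞ f U) (hx : x ∈ U) :
    MDifferentiableAt 𝓘(ℝ, Model n) 𝓘(ℝ, ℝ) f x :=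
  (hf.contMDiffAt (hU.mem_nhds hx)).mdifferentiableAt (by simp)

theorem mvfderiv_add_apply (hU : IsOpen U) (hf : ContMDiffOn 𝓘(ℝ, Model n) 𝓘(ℝ, ℝ) ∞ f U)
    (hg : ContMDiffOn 𝓘(ℝ, Model n) 𝓘(ℝ, ℝ) ∞ g U) (hx : x ∈ U) (u : TSp n x) :
    mvfderiv 𝓘(ℝ, Model n) (fun y ↦ f y + g y) x u
      = mvfderiv 𝓘(ℝ, Model n) f x u + mvfderiv 𝓘(ℝ, Model n) g x u :=
  congrArg (fun T ↦ T u) (mvfderiv_add (ContMDiffOn.mdifferentiableAt_of_isOpen hU hf hx)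
    (ContMDiffOn.mdifferentiableAt_of_isOpen hU hg hx))

theorem mvfderiv_mul_apply (hU : IsOpen U) (hf : ContMDiffOn 𝓘(ℝ, Model n) 𝓘(ℝ, ℝ) ∞ f U)
    (hg : ContMDiffOn 𝓘(ℝ, Model n) 𝓘(ℝ, ℝ) ∞ g U) (hx : x ∈ U) (u : TSp n x) :
    mvfderiv 𝓘(ℝ, Model n) (fun y ↦ f y * g y) x u
      = mvfderiv 𝓘(ℝ, Model n) f x u * g x + f x * mvfderiv 𝓘(ℝ, Model n) g x u := by
  have h := congrArg (fun T ↦ T u) (mvfderiv_mul (ContMDiffOn.mdifferentiableAt_of_isOpen hU hf hx)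
    (ContMDiffOn.mdifferentiableAt_of_isOpen hU hg hx))
  refine h.trans ?_
  simp
  ring

theorem mvfderiv_const_mul_apply (hU : IsOpen U)
    (hf : ContMDiffOn 𝓘(ℝ, Model n) 𝓘(ℝ, ℝ) ∞ f U) (hx : x ∈ U) (u : TSp n x) (c : ℝ) :
    mvfderiv 𝓘(ℝ, Model n) (fun y ↦ c * f y) x u = c * mvfderiv 𝓘(ℝ, Model n) f x u := by
  rw [mvfderiv_mul_apply hU contMDiffOn_const hf hx, mvfderiv_const]
  simp

theorem mvfderiv_sum_apply {ι : Type*} (s : Finset ι) {f : ι → M → ℝ} (hU : IsOpen U)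
    (hf : ∀ i, ContMDiffOn 𝓘(ℝ, Model n) 𝓘(ℝ, ℝ) ∞ (f i) U) (hx : x ∈ U) (u : TSp n x) :
    mvfderiv 𝓘(ℝ, Model n) (fun y ↦ ∑ i ∈ s, f i y) x u
      = ∑ i ∈ s, mvfderiv 𝓘(ℝ, Model n) (f i) x u := by
  classical
  induction s using Finset.induction_on with
  | empty => simp [mvfderiv_const]
  | insert a s ha ih =>
    simp only [Finset.sum_insert ha]
    rw [mvfderiv_add_apply hU (hf a) (contMDiffOn_finsetSum fun i _ ↦ hf i) hx, ih]

end FunctionDerivatives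

section FormCov

variable {n : ℕ} {M : Type*} [TopologicalSpace M] [ChartedSpace (Model n) M]
  [RiemannianBundle (fun x : M ↦ TangentSpace 𝓘(ℝ, Model n) x)]
  [IsManifold 𝓘(ℝ, Model n) ∞ M]

/-- Forms at a point are determined by their values on vector fields. -/
theorem ext_of_fields {U : Set M} (hU : IsOpen U) {x : M} (hx : x ∈ U) {η ζ : Ext (TSp n x)}
    {k : ℕ} (h : ∀ W ⊆ U, IsOpen W → x ∈ W → ∀ X : Fin k → VField n M,
      (∀ i, (X i).SmoothOn W) → η k (fun i ↦ X i x) = ζ k (fun i ↦ X i x)) : η k = ζ k := by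
  have hφ : chartAt (Model n) x ∈ Charts n M := IsManifold.chart_mem_maximalAtlas x
  set φ := chartAt (Model n) x
  have hxφ : x ∈ φ.source := mem_chart_source _ x
  ext w
  have h1 := h (U ∩ φ.source) inter_subset_left (hU.inter φ.open_source) ⟨hx, hxφ⟩
    (fun i ↦ constField φ (chartD φ x (w i)))
    (fun i ↦ (smoothOn_constField hφ _).mono inter_subset_right)
  simpa only [constField_chartD hφ hxφ] using h1

/-- The product rule for the connection on forms, evaluated on vector fields. It shows that
`formCov` does not depend on the chart in which it is defined. -/
theorem formCov_apply (cov : TConn n M) {U : Set M} (hU : IsOpen U) {θ : DForm n M}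
    (hθ : θ.SmoothOn U) {k : ℕ} {X : Fin k → VField n M} (hX : ∀ i, (X i).SmoothOn U)
    {x : M} (hx : x ∈ U) (u : TSp n x) :
    formCov cov θ x u k (fun i ↦ X i x) =
      mvfderiv 𝓘(ℝ, Model n) (fun y ↦ θ y k (fun i ↦ X i y)) x u
        - ∑ i, θ x k (Function.update (fun i ↦ X i x) i (cov (X i) x u)) := by
  have hφ : chartAt (Model n) x ∈ Charts n M := IsManifold.chart_mem_maximalAtlas x
  set φ := chartAt (Model n) x
  have hxφ : x ∈ φ.source := mem_chart_source _ x
  set W := U ∩ φ.source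
  have hW : IsOpen W := hU.inter φ.open_source
  have hxW : x ∈ W := ⟨hx, hxφ⟩
  have hWφ : W ⊆ φ.source := inter_subset_right
  have hXW (i : Fin k) : (X i).SmoothOn W := (hX i).mono inter_subset_left
  have hmem : φ.target ∩ φ.symm ⁻¹' U ∈ 𝓝 (φ x) :=
    (φ.isOpen_inter_preimage_symm hU).mem_nhds ⟨φ.map_source hxφ, by
      simpa only [mem_preimage, φ.left_inv hxφ] using hx⟩
  have hfd : DifferentiableAt ℝ (coordForm φ θ k) (φ x) :=
    ((hθ φ hφ k).contDiffAt hmem).differentiableAt (by simp)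
  have hG (i : Fin k) := contMDiffOn_chartD hφ hW hWφ (hXW i)
  have hGd (i : Fin k) : MDifferentiableAt 𝓘(ℝ, Model n) 𝓘(ℝ, Model n)
      (fun x ↦ (chartD φ x (X i x) : Model n)) x :=
    ((hG i).contMDiffAt (hW.mem_nhds hxW)).mdifferentiableAt (by simp)
  have h1 : (fun y ↦ θ y k (fun i ↦ X i y)) =ᶠ[𝓝 x]
      fun y ↦ coordForm φ θ k (φ y) (fun i ↦ chartD φ y (X i y)) :=
    Filter.eventually_of_mem (hW.mem_nhds hxW) fun y hy ↦
      (coordForm_apply_chartD hφ θ k (hWφ hy) _).symm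
  rw [mvfderiv_congr h1, mvfderiv_alternating_apply (f := fun y ↦ coordForm φ θ k (φ y))
    ((hfd.mdifferentiableAt).comp x ((chart_mdifferentiable hφ).mdifferentiableAt hxφ)) hGd,
    mvfderiv_comp_chart hφ hxφ hfd]
  have h2 (i : Fin k) : coordForm φ θ k (φ x) (Function.update (fun i ↦ chartD φ x (X i x)) i
      (mvfderiv 𝓘(ℝ, Model n) (fun x ↦ (chartD φ x (X i x) : Model n)) x u))
      = θ x k (Function.update (fun i ↦ X i x) i
        (constField φ (mvfderiv 𝓘(ℝ, Model n) (fun x ↦ (chartD φ x (X i x) : Model n)) x u) x)) := by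
    rw [coordForm_apply hφ θ k hxφ]
    refine congrArg _ (funext fun j ↦ ?_)
    by_cases hj : j = i
    · subst hj; simp
    · simp [hj, constField_chartD hφ hxφ]
  have h3 (i : Fin k) : cov (X i) x u = ∑ j, chartD φ x (X i x) j • cov (coordField φ j) x u
      + constField φ (mvfderiv 𝓘(ℝ, Model n) (fun x ↦ (chartD φ x (X i x) : Model n)) x u) x := by
    rw [cov_apply_eq_sum cov hφ hW hWφ (hXW i) hxW, Finset.sum_add_distrib, constField_eq_sum]
    congr 1
    refine Finset.sum_congr rfl fun j _ ↦ ?_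
    congr 1
    exact (mfderiv_comp_apply (I' := 𝓘(ℝ, Model n)) (I'' := 𝓘(ℝ, ℝ)) x
      (EuclideanSpace.proj (𝕜 := ℝ) j).differentiableAt.mdifferentiableAt (hGd i) u).trans
      (congrArg (fun T : Model n →L[ℝ] ℝ ↦ T (mvfderiv 𝓘(ℝ, Model n)
        (fun x ↦ (chartD φ x (X i x) : Model n)) x u))
        (mfderiv_eq_fderiv.trans (EuclideanSpace.proj (𝕜 := ℝ) j).fderiv))
  simp only [h2]
  have h4 (i : Fin k) : θ x k (Function.update (fun i ↦ X i x) i (cov (X i) x u))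
      = θ x k (Function.update (fun i ↦ X i x) i
          (∑ j, chartD φ x (X i x) j • cov (coordField φ j) x u))
        + θ x k (Function.update (fun i ↦ X i x) i (constField φ
          (mvfderiv 𝓘(ℝ, Model n) (fun x ↦ (chartD φ x (X i x) : Model n)) x u) x)) := by
    rw [h3 i, (θ x k).map_update_add]
  simp only [h4, Finset.sum_add_distrib]
  have h5 : formCov cov θ x u k (fun i ↦ X i x)
      = fderiv ℝ (coordForm φ θ k) (φ x) (chartD φ x u) (fun i ↦ chartD φ x (X i x))
        - ∑ i, θ x k (Function.update (fun i ↦ X i x) i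
          (∑ j, chartD φ x (X i x) j • cov (coordField φ j) x u)) := by
    simp only [formCov]
    refine congrArg₂ (fun a b : ℝ ↦ a - b) rfl ?_
    refine (derivAction_apply _ _ _ _).trans (Finset.sum_congr rfl fun i _ ↦ ?_)
    congr 2
    rw [sum_apply]
    rfl
  rw [h5]
  ring

variable {cov : TConn n M} {U : Set M} {θ η : DForm n M} {x : M}

theorem formCov_zero_degree (hU : IsOpen U) (hθ : θ.SmoothOn U) (hx : x ∈ U) (u : TSp n x)
    (w : Fin 0 → TSp n x) :
    formCov cov θ x u 0 w = mvfderiv 𝓘(ℝ, Model n) (fun y ↦ θ y 0 ![]) x u := by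
  have h := formCov_apply cov hU hθ (X := ![]) (fun i ↦ i.elim0) hx u
  rw [Finset.univ_eq_empty, Finset.sum_empty, sub_zero] at h
  refine Eq.trans (congrArg _ (Subsingleton.elim _ _)) (h.trans ?_)
  congr 1
  refine mvfderiv_congr (Filter.Eventually.of_forall fun y ↦ ?_)
  exact congrArg _ (Subsingleton.elim _ _)

theorem formCov_congr (hU : IsOpen U) (hθ : θ.SmoothOn U) (h : ∀ y ∈ U, η y = θ y) (hx : x ∈ U)
    (u : TSp n x) : formCov cov η x u = formCov cov θ x u := by
  funext k
  refine ext_of_fields hU hx fun W hWU hW hxW X hX ↦ ?_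
  rw [formCov_apply cov hW (hθ.mono hWU) hX hxW, formCov_apply cov hW ((hθ.congr h).mono hWU) hX hxW,
    h x hx]
  congr 2
  exact mvfderiv_congr (Filter.eventually_of_mem (hW.mem_nhds hxW) fun y hy ↦ by
    simp only [h y (hWU hy)])

theorem formCov_add (hU : IsOpen U) (hθ : θ.SmoothOn U) (hη : η.SmoothOn U) (hx : x ∈ U)
    (u : TSp n x) :
    formCov cov (fun y ↦ θ y + η y) x u = formCov cov θ x u + formCov cov η x u := by
  funext k
  refine ext_of_fields hU hx (ζ := formCov cov θ x u + formCov cov η x u)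
    fun W hWU hW hxW X hX ↦ ?_
  have h1 := (hθ.mono hWU).apply hW hX
  have h2 := (hη.mono hWU).apply hW hX
  simp only [Pi.add_apply, ContinuousAlternatingMap.add_apply]
  rw [formCov_apply cov hW (hθ.mono hWU) hX hxW, formCov_apply cov hW (hη.mono hWU) hX hxW,
    formCov_apply cov hW ((hθ.mono hWU).add hW (hη.mono hWU)) hX hxW]
  simp only [Pi.add_apply, ContinuousAlternatingMap.add_apply]
  rw [mvfderiv_add_apply hW h1 h2 hxW, Finset.sum_add_distrib]
  ring

theorem formCov_smul {f : M → ℝ} (hU : IsOpen U)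
    (hf : ContMDiffOn 𝓘(ℝ, Model n) 𝓘(ℝ, ℝ) ∞ f U) (hθ : θ.SmoothOn U) (hx : x ∈ U)
    (u : TSp n x) :
    formCov cov (fun y ↦ f y • θ y) x u
      = f x • formCov cov θ x u + mvfderiv 𝓘(ℝ, Model n) f x u • θ x := by
  funext k
  refine ext_of_fields hU hx (ζ := f x • formCov cov θ x u + mvfderiv 𝓘(ℝ, Model n) f x u • θ x)
    fun W hWU hW hxW X hX ↦ ?_
  have h1 := (hθ.mono hWU).apply hW hX
  have h2 := hf.mono hWU
  simp only [Pi.add_apply, ContinuousAlternatingMap.add_apply, Pi.smul_apply,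
    ContinuousAlternatingMap.smul_apply]
  rw [formCov_apply cov hW (hθ.mono hWU) hX hxW,
    formCov_apply cov hW (DForm.SmoothOn.smul hW h2 (hθ.mono hWU)) hX hxW]
  simp only [Pi.smul_apply, ContinuousAlternatingMap.smul_apply, smul_eq_mul]
  rw [mvfderiv_mul_apply hW h2 h1 hxW, ← Finset.mul_sum]
  ring

theorem formCov_const_smul (a : ℝ) (hU : IsOpen U) (hθ : θ.SmoothOn U) (hx : x ∈ U)
    (u : TSp n x) : formCov cov (fun y ↦ a • θ y) x u = a • formCov cov θ x u := by
  rw [formCov_smul (f := fun _ ↦ a) hU contMDiffOn_const hθ hx, mvfderiv_const]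
  simp

theorem formCov_sub (hU : IsOpen U) (hθ : θ.SmoothOn U) (hη : η.SmoothOn U) (hx : x ∈ U)
    (u : TSp n x) :
    formCov cov (fun y ↦ θ y - η y) x u = formCov cov θ x u - formCov cov η x u := by
  have h := formCov_add (cov := cov) hU hθ (hη.const_smul (-1) hU) hx u
  rw [formCov_const_smul _ hU hη hx] at h
  have e (y : M) (α β : Ext (TSp n y)) : α + (-1 : ℝ) • β = α - β := by module
  simpa only [e] using h

theorem formCov_sum {ι : Type*} (s : Finset ι) {θ : ι → DForm n M} (hU : IsOpen U)
    (hθ : ∀ i, (θ i).SmoothOn U) (hx : x ∈ U) (u : TSp n x) :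
    formCov cov (fun y ↦ ∑ i ∈ s, θ i y) x u = ∑ i ∈ s, formCov cov (θ i) x u := by
  classical
  induction s using Finset.induction_on with
  | empty =>
    have h := formCov_const_smul (cov := cov) 0 hU (DForm.smoothOn_zero U) hx u
    simpa using h
  | insert a s ha ih =>
    simp only [Finset.sum_insert ha]
    rw [formCov_add hU (hθ a) (DForm.SmoothOn.sum hU fun i _ ↦ hθ i) hx, ih]

theorem formCov_add_right (hU : IsOpen U) (hθ : θ.SmoothOn U) (hx : x ∈ U) (u w : TSp n x) :
    formCov cov θ x (u + w) = formCov cov θ x u + formCov cov θ x w := by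
  funext k
  refine ext_of_fields hU hx (ζ := formCov cov θ x u + formCov cov θ x w)
    fun W hWU hW hxW X hX ↦ ?_
  simp only [Pi.add_apply, ContinuousAlternatingMap.add_apply]
  simp only [formCov_apply cov hW (hθ.mono hWU) hX hxW, map_add,
    ContinuousAlternatingMap.map_update_add, Finset.sum_add_distrib]
  ring

theorem formCov_smul_right (hU : IsOpen U) (hθ : θ.SmoothOn U) (hx : x ∈ U) (a : ℝ)
    (u : TSp n x) : formCov cov θ x (a • u) = a • formCov cov θ x u := by
  funext k
  refine ext_of_fields hU hx (ζ := a • formCov cov θ x u) fun W hWU hW hxW X hX ↦ ?_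
  simp only [Pi.smul_apply, ContinuousAlternatingMap.smul_apply]
  simp only [formCov_apply cov hW (hθ.mono hWU) hX hxW, map_smul,
    ContinuousAlternatingMap.map_update_smul, ← Finset.mul_sum, smul_eq_mul, mul_sub]

theorem isLinearMap_formCov (hU : IsOpen U) (hθ : θ.SmoothOn U) (hx : x ∈ U) :
    IsLinearMap ℝ (formCov cov θ x) :=
  ⟨formCov_add_right hU hθ hx, formCov_smul_right hU hθ hx⟩

theorem formCov_contract {v : VField n M} (hU : IsOpen U) (hv : v.SmoothOn U) (hθ : θ.SmoothOn U)
    (hx : x ∈ U) (u : TSp n x) :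
    formCov cov (fun y ↦ contract (v y) (θ y)) x u
      = contract (cov v x u) (θ x) + contract (v x) (formCov cov θ x u) := by
  funext k
  refine ext_of_fields hU hx
    (ζ := contract (cov v x u) (θ x) + contract (v x) (formCov cov θ x u))
    fun W hWU hW hxW X hX ↦ ?_
  have hvW := hv.mono hWU
  have hcons (Y : Fin k → VField n M) (y : M) :
      (fun i ↦ (Fin.cons v Y : Fin (k + 1) → VField n M) i y) = Fin.cons (v y) (fun i ↦ Y i y) := by
    funext i
    refine Fin.cases rfl (fun i ↦ rfl) i
  have hcX (i : Fin (k + 1)) : VField.SmoothOn ((Fin.cons v X : Fin (k + 1) → VField n M) i) W := by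
    refine Fin.cases ?_ (fun i ↦ ?_) i
    · exact hvW
    · exact hX i
  have h := formCov_apply cov hW (hθ.mono hWU) hcX hxW u
  simp only [hcons, Fin.sum_univ_succ, Fin.cons_zero, Fin.cons_succ, Fin.update_cons_zero,
    ← Fin.cons_update] at h
  rw [formCov_apply cov hW ((hθ.mono hWU).contract hW hvW) hX hxW]
  simp only [Pi.add_apply, ContinuousAlternatingMap.add_apply, contract_apply, h]
  ring

end FormCov

section FormCovMetric

variable {n : ℕ} {M : Type*} [TopologicalSpace M] [ChartedSpace (Model n) M]
  [RiemannianBundle (fun x : M ↦ TangentSpace 𝓘(ℝ, Model n) x)]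
  [IsManifold 𝓘(ℝ, Model n) ∞ M]
  [IsContMDiffRiemannianBundle 𝓘(ℝ, Model n) ∞ (Model n)
    (fun x : M ↦ TangentSpace 𝓘(ℝ, Model n) x)]
  {cov : TConn n M} {U : Set M} {θ η : DForm n M} {x : M}

theorem IsLeviCivita.smoothOn_formCov (hcov : IsLeviCivita cov) {X : VField n M} (hU : IsOpen U)
    (hθ : θ.SmoothOn U) (hX : X.SmoothOn U) :
    DForm.SmoothOn (fun x ↦ formCov cov θ x (X x)) U := by
  refine DForm.smoothOn_of_apply hU fun W hWU hW k Y hY ↦ ?_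
  have hXW := hX.mono hWU
  have h := (contMDiffOn_mvfderiv_apply hW ((hθ.mono hWU).apply hW hY) hXW).sub
    (contMDiffOn_finsetSum (t := Finset.univ) fun i _ ↦ (hθ.mono hWU).apply hW
      (X := Function.update Y i (fun x ↦ cov (Y i) x (X x))) fun j ↦ by
        by_cases hj : j = i
        · subst hj; simpa using hcov.smoothOn_cov hW hXW (hY j)
        · simpa [hj] using hY j)
  refine h.congr fun x hx ↦ ?_
  rw [formCov_apply cov hW (hθ.mono hWU) hY hx]
  refine congrArg₂ (· - ·) rfl (Finset.sum_congr rfl fun i _ ↦ congrArg _ (funext fun j ↦ ?_))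
  by_cases hj : j = i
  · subst hj; simp
  · simp [hj]

theorem IsLeviCivita.formCov_wedgeDual (hcov : IsLeviCivita cov) {v : VField n M} (hU : IsOpen U)
    (hv : v.SmoothOn U) (hθ : θ.SmoothOn U) (hx : x ∈ U) (u : TSp n x) :
    formCov cov (fun y ↦ wedgeDual (v y) (θ y)) x u
      = wedgeDual (cov v x u) (θ x) + wedgeDual (v x) (formCov cov θ x u) := by
  funext k
  refine ext_of_fields hU hx
    (ζ := wedgeDual (cov v x u) (θ x) + wedgeDual (v x) (formCov cov θ x u))
    fun W hWU hW hxW X hX ↦ ?_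
  have hvW := hv.mono hWU
  have hθW := hθ.mono hWU
  rw [formCov_apply cov hW (hθW.wedgeDual hW hvW) hX hxW]
  simp only [Pi.add_apply, ContinuousAlternatingMap.add_apply]
  cases k with
  | zero => simp [wedgeDual, wedge_apply_zero, mvfderiv_const]
  | succ k =>
    simp only [wedgeDual, wedge_apply_succ, innerSL_apply_apply]
    have h1 (i : Fin (k + 1)) : ContMDiffOn 𝓘(ℝ, Model n) 𝓘(ℝ, ℝ) ∞
        (fun y ↦ (inner ℝ (v y) (X i y) : ℝ)) W := contMDiffOn_inner hvW (hX i)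
    have h2 (i : Fin (k + 1)) : ContMDiffOn 𝓘(ℝ, Model n) 𝓘(ℝ, ℝ) ∞
        (fun y ↦ θ y k (i.removeNth fun j ↦ X j y)) W :=
      hθW.apply hW (X := i.removeNth X) fun j ↦ hX _
    have h12 (i : Fin (k + 1)) : ContMDiffOn 𝓘(ℝ, Model n) 𝓘(ℝ, ℝ) ∞
        (fun y ↦ (inner ℝ (v y) (X i y) : ℝ) * θ y k (i.removeNth fun j ↦ X j y)) W :=
      (h1 i).mul (h2 i)
    rw [mvfderiv_sum_apply Finset.univ hW
      (f := fun (i : Fin (k + 1)) y ↦ (-1 : ℝ) ^ (i : ℕ) * ((inner ℝ (v y) (X i y) : ℝ) *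
        θ y k (i.removeNth fun j ↦ X j y)))
      (fun i ↦ contMDiffOn_const.mul (h12 i)) hxW]
    have h3 (i : Fin (k + 1)) : mvfderiv 𝓘(ℝ, Model n) (fun y ↦ (-1 : ℝ) ^ (i : ℕ) *
        ((inner ℝ (v y) (X i y) : ℝ) * θ y k (i.removeNth fun j ↦ X j y))) x u
        = (-1 : ℝ) ^ (i : ℕ) * ((inner ℝ (cov v x u) (X i x) + inner ℝ (v x) (cov (X i) x u)) *
          θ x k (i.removeNth fun j ↦ X j x) + inner ℝ (v x) (X i x) *
          (formCov cov θ x u k (i.removeNth fun j ↦ X j x)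
            + ∑ j, θ x k (Function.update (i.removeNth fun j ↦ X j x) j
              (cov (X (i.succAbove j)) x u)))) := by
      rw [mvfderiv_const_mul_apply hW (h12 i) hxW, mvfderiv_mul_apply hW (h1 i) (h2 i) hxW,
        hcov.mvfderiv_inner hW hvW (hX i) hxW]
      have h4 : formCov cov θ x u k (i.removeNth fun j ↦ X j x) =
          mvfderiv 𝓘(ℝ, Model n) (fun y ↦ θ y k (i.removeNth fun j ↦ X j y)) x u
          - ∑ j, θ x k (Function.update (i.removeNth fun j ↦ X j x) j
              (cov (X (i.succAbove j)) x u)) :=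
        formCov_apply cov hW hθW (X := i.removeNth X) (fun j ↦ hX _) hxW u
      rw [h4, sub_add_cancel]
    simp only [h3]
    have h5 : ∑ j, ∑ i : Fin (k + 1), (-1 : ℝ) ^ (i : ℕ) *
        ((inner ℝ (v x) (Function.update (fun i ↦ X i x) j (cov (X j) x u) i) : ℝ) *
          θ x k (i.removeNth (Function.update (fun i ↦ X i x) j (cov (X j) x u))))
        = ∑ i : Fin (k + 1), (-1 : ℝ) ^ (i : ℕ) * (inner ℝ (v x) (cov (X i) x u) *
          θ x k (i.removeNth fun j ↦ X j x) + inner ℝ (v x) (X i x) *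
            ∑ j, θ x k (Function.update (i.removeNth fun j ↦ X j x) j
              (cov (X (i.succAbove j)) x u))) := by
      rw [Finset.sum_comm]
      refine Finset.sum_congr rfl fun i _ ↦ ?_
      rw [Fin.sum_univ_succAbove _ i, mul_add]
      congr 1
      · simp
      · rw [Finset.mul_sum, Finset.mul_sum]
        refine Finset.sum_congr rfl fun j _ ↦ ?_
        simp
    rw [h5, ← Finset.sum_add_distrib, ← Finset.sum_sub_distrib]
    refine Finset.sum_congr rfl fun i _ ↦ ?_
    ring

theorem IsLeviCivita.formCov_cliff (hcov : IsLeviCivita cov) {v : VField n M} (hU : IsOpen U)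
    (hv : v.SmoothOn U) (hθ : θ.SmoothOn U) (hx : x ∈ U) (u : TSp n x) :
    formCov cov (fun y ↦ cliff (v y) (θ y)) x u
      = cliff (cov v x u) (θ x) + cliff (v x) (formCov cov θ x u) := by
  have h := formCov_sub (cov := cov) hU (hθ.wedgeDual hU hv) (hθ.contract hU hv) hx u
  rw [hcov.formCov_wedgeDual hU hv hθ hx, formCov_contract hU hv hθ hx] at h
  simp only [cliff, LinearMap.sub_apply]
  rw [h]
  abel

end FormCovMetric

/-! ### Curvature -/

section ConstExt

variable {n : ℕ} {M : Type*} [TopologicalSpace M] [ChartedSpace (Model n) M]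

/-- The extension of a tangent vector at `x` to a vector field that is constant in the preferred
chart at `x`. -/
def constExt (x : M) (u : TSp n x) : VField n M :=
  constField (chartAt (Model n) x) (chartD (chartAt (Model n) x) x u)

theorem constExt_add (x : M) (u w : TSp n x) (y : M) :
    constExt x (u + w) y = constExt x u y + constExt x w y := by
  simp only [constExt, map_add, constField_add]

theorem constExt_smul (x : M) (a : ℝ) (u : TSp n x) (y : M) :
    constExt x (a • u) y = a • constExt x u y := by
  simp only [constExt, map_smul, constField_smul]

/-- Second derivatives along coordinate fields commute. -/
theorem mvfderiv_constField_comm {φ : OpenPartialHomeomorph M (Model n)} (hφ : φ ∈ Charts n M)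
    {f : M → ℝ} {U : Set M} (hU : IsOpen U) (hUφ : U ⊆ φ.source)
    (hf : ContMDiffOn 𝓘(ℝ, Model n) 𝓘(ℝ, ℝ) ∞ f U) {x : M} (hx : x ∈ U) (w w' : Model n) :
    mvfderiv 𝓘(ℝ, Model n) (fun y ↦ mvfderiv 𝓘(ℝ, Model n) f y (constField φ w y)) x
        (constField φ w' x)
      = mvfderiv 𝓘(ℝ, Model n) (fun y ↦ mvfderiv 𝓘(ℝ, Model n) f y (constField φ w' y)) x
        (constField φ w x) := by
  have hxφ := hUφ hx
  set F : Model n → ℝ := fun y ↦ f (φ.symm y)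
  have hmem : φ.target ∩ φ.symm ⁻¹' U ∈ 𝓝 (φ x) :=
    (φ.isOpen_inter_preimage_symm hU).mem_nhds ⟨φ.map_source hxφ, by
      simpa only [mem_preimage, φ.left_inv hxφ] using hx⟩
  have hF : ContDiffAt ℝ ∞ F (φ x) :=
    (contDiffOn_comp_chart_symm hφ (hf.mono inter_subset_left)).contDiffAt hmem
  have h1 (w : Model n) : (fun y ↦ mvfderiv 𝓘(ℝ, Model n) f y (constField φ w y)) =ᶠ[𝓝 x]
      fun y ↦ (fun z ↦ fderiv ℝ F z w) (φ y) :=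
    Filter.eventually_of_mem (hU.mem_nhds hx) fun y hy ↦ by
      simp only
      rw [mvfderiv_eq_fderiv hφ (hUφ hy)
        ((hf.contMDiffAt (hU.mem_nhds hy)).mdifferentiableAt (by simp)),
        chartD_constField hφ (hUφ hy)]
  have hF' : DifferentiableAt ℝ (fderiv ℝ F) (φ x) :=
    (hF.fderiv_right (m := ∞) (by simp)).differentiableAt (by simp)
  have h2 (w w' : Model n) : mvfderiv 𝓘(ℝ, Model n)
      (fun y ↦ mvfderiv 𝓘(ℝ, Model n) f y (constField φ w y)) x (constField φ w' x)
      = fderiv ℝ (fderiv ℝ F) (φ x) w' w := by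
    rw [mvfderiv_congr (h1 w), mvfderiv_comp_chart hφ hxφ (hF'.clm_apply (differentiableAt_const w)),
      chartD_constField hφ hxφ, fderiv_clm_apply hF' (differentiableAt_const w)]
    simp
  rw [h2, h2]
  refine (hF.isSymmSndFDerivAt ?_).eq w' w
  rw [minSmoothness_of_isRCLikeNormedField]
  exact WithTop.coe_le_coe.2 (le_top : (2 : ℕ∞) ≤ ⊤)

variable [IsManifold 𝓘(ℝ, Model n) ∞ M]

theorem chartAt_mem_charts (x : M) : chartAt (Model n) x ∈ Charts n M :=
  IsManifold.chart_mem_maximalAtlas x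

theorem constExt_self (x : M) (u : TSp n x) : constExt x u x = u :=
  constField_chartD (chartAt_mem_charts x) (mem_chart_source _ x) u

theorem smoothOn_constExt (x : M) (u : TSp n x) :
    (constExt x u).SmoothOn (chartAt (Model n) x).source :=
  smoothOn_constField (chartAt_mem_charts x) _

/-- The extension of tangent vectors used in the definition of `curv` is the one that is constant in
the preferred chart. -/
theorem extend_eq_constExt {x : M} (u : TSp n x) {y : M} (hy : y ∈ (chartAt (Model n) x).source) :
    FiberBundle.extend (Model n) u y = constExt x u y := by
  have hn : IsManifold 𝓘(ℝ, Model n) 1 M := IsManifold.of_le (n := ∞) (by simp)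
  have h1 (z : M) (hz : z ∈ (chartAt (Model n) x).source) (w : TSp n z) :
      chartD (chartAt (Model n) x) z w
        = (trivializationAt (Model n) (TangentSpace 𝓘(ℝ, Model n)) x ⟨z, w⟩).2 := by
    have h := congrArg (fun T ↦ T w)
      (TangentBundle.continuousLinearMapAt_trivializationAt (I := 𝓘(ℝ, Model n)) (𝕜 := ℝ) hz)
    have hz' : z ∈ (trivializationAt (Model n) (TangentSpace 𝓘(ℝ, Model n)) x).baseSet := by
      simpa using hz
    simp only [Trivialization.continuousLinearMapAt_apply,
      Trivialization.coe_linearMapAt_of_mem _ hz'] at h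
    exact h.symm
  rw [← constField_chartD (chartAt_mem_charts x) hy (FiberBundle.extend (Model n) u y), constExt,
    h1 y hy, h1 x (mem_chart_source _ x), FiberBundle.extend]
  have hy' : y ∈ (trivializationAt (Model n) (TangentSpace 𝓘(ℝ, Model n)) x).baseSet := by
    simpa using hy
  rw [Trivialization.apply_mk_symm _ hy']

end ConstExt

section Curvature

variable {n : ℕ} {M : Type*} [TopologicalSpace M] [ChartedSpace (Model n) M]
  [RiemannianBundle (fun x : M ↦ TangentSpace 𝓘(ℝ, Model n) x)]
  [IsManifold 𝓘(ℝ, Model n) ∞ M]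
  [IsContMDiffRiemannianBundle 𝓘(ℝ, Model n) ∞ (Model n)
    (fun x : M ↦ TangentSpace 𝓘(ℝ, Model n) x)]
  {cov : TConn n M}

theorem IsLeviCivita.smoothOn_cov_constExt (hcov : IsLeviCivita cov) (x : M) (u w : TSp n x) :
    VField.SmoothOn (fun y ↦ cov (constExt x w) y (constExt x u y)) (chartAt (Model n) x).source :=
  hcov.smoothOn_cov (chartAt (Model n) x).open_source (smoothOn_constExt x u) (smoothOn_constExt x w)

theorem IsLeviCivita.cov_constExt_comm (hcov : IsLeviCivita cov) (x : M) (u w : TSp n x) {y : M}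
    (hy : y ∈ (chartAt (Model n) x).source) :
    cov (constExt x w) y (constExt x u y) = cov (constExt x u) y (constExt x w y) :=
  hcov.cov_constField_comm (chartAt_mem_charts x) hy _ _

/-- The curvature tensor, computed with extensions that commute. -/
theorem IsLeviCivita.curv_eq (hcov : IsLeviCivita cov) (x : M) (u v w : TSp n x) :
    curv cov x u v w = cov (fun y ↦ cov (constExt x w) y (constExt x v y)) x u
      - cov (fun y ↦ cov (constExt x w) y (constExt x u y)) x v := by
  set φ := chartAt (Model n) x
  have hx : x ∈ φ.source := mem_chart_source _ x
  have hE (u : TSp n x) : ∀ y ∈ φ.source, constExt x u y = FiberBundle.extend (Model n) u y :=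
    fun y hy ↦ (extend_eq_constExt u hy).symm
  have hEf (u : TSp n x) : (FiberBundle.extend (Model n) u : VField n M) =ᶠ[𝓝 x] constExt x u :=
    Filter.eventually_of_mem (φ.open_source.mem_nhds hx) fun y hy ↦ (hE u y hy).symm
  have h1 (v w : TSp n x) : cov (fun y ↦ cov (FiberBundle.extend (Model n) w : VField n M) y
      ((FiberBundle.extend (Model n) v : VField n M) y)) x
      = cov (fun y ↦ cov (constExt x w) y (constExt x v y)) x := by
    refine (cov_congr cov φ.open_source (hcov.smoothOn_cov_constExt x v w) (fun y hy ↦ ?_) hx).symm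
    rw [hE v y hy, cov_congr cov φ.open_source (smoothOn_constExt x w) (hE w) hy]
  have h2 : VectorField.mlieBracket 𝓘(ℝ, Model n) (FiberBundle.extend (Model n) u : VField n M)
      (FiberBundle.extend (Model n) v : VField n M) x = 0 := by
    rw [(hEf u).mlieBracket_vectorField_eq (hEf v)]
    exact mlieBracket_constField (chartAt_mem_charts x) hx _ _
  simp only [curv]
  rw [h1, h1, h2, map_zero, sub_zero, FiberBundle.extend_apply_self, FiberBundle.extend_apply_self]

theorem IsLeviCivita.curv_swap_left (hcov : IsLeviCivita cov) (x : M) (u v w : TSp n x) :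
    curv cov x v u w = -curv cov x u v w := by
  rw [hcov.curv_eq, hcov.curv_eq, neg_sub]

theorem IsLeviCivita.curv_add_right (hcov : IsLeviCivita cov) (x : M) (u v w w' : TSp n x) :
    curv cov x u v (w + w') = curv cov x u v w + curv cov x u v w' := by
  set φ := chartAt (Model n) x
  have hx : x ∈ φ.source := mem_chart_source _ x
  have h (v : TSp n x) : cov (fun y ↦ cov (constExt x (w + w')) y (constExt x v y)) x
      = cov (fun y ↦ cov (constExt x w) y (constExt x v y)) x
        + cov (fun y ↦ cov (constExt x w') y (constExt x v y)) x := by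
    rw [← cov_add cov φ.open_source (hcov.smoothOn_cov_constExt x v w)
      (hcov.smoothOn_cov_constExt x v w') hx]
    refine cov_congr cov φ.open_source (hcov.smoothOn_cov_constExt x v _) (fun y hy ↦ ?_) hx
    rw [show constExt x (w + w') = fun y ↦ constExt x w y + constExt x w' y from
      funext (constExt_add x w w'), cov_add cov φ.open_source (smoothOn_constExt x w)
      (smoothOn_constExt x w') hy]
    rfl
  rw [hcov.curv_eq, hcov.curv_eq, hcov.curv_eq, h, h, add_apply, add_apply]
  abel

theorem IsLeviCivita.curv_smul_right (hcov : IsLeviCivita cov) (x : M) (a : ℝ) (u v w : TSp n x) :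
    curv cov x u v (a • w) = a • curv cov x u v w := by
  set φ := chartAt (Model n) x
  have hx : x ∈ φ.source := mem_chart_source _ x
  have hconst (Y : VField n M) (hY : Y.SmoothOn φ.source) {y : M} (hy : y ∈ φ.source) (z : TSp n y) :
      cov (fun y ↦ a • Y y) y z = a • cov Y y z := by
    rw [cov_smul cov (f := fun _ ↦ a) φ.open_source contMDiffOn_const hY hy, mvfderiv_const]
    simp
  have h (v z : TSp n x) : cov (fun y ↦ cov (constExt x (a • w)) y (constExt x v y)) x z
      = a • cov (fun y ↦ cov (constExt x w) y (constExt x v y)) x z := by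
    rw [← hconst _ (hcov.smoothOn_cov_constExt x v w) hx]
    refine congrArg (fun T ↦ T z) (cov_congr cov φ.open_source (hcov.smoothOn_cov_constExt x v _)
      (fun y hy ↦ ?_) hx)
    rw [show constExt x (a • w) = fun y ↦ a • constExt x w y from
      funext (constExt_smul x a w), hconst _ (smoothOn_constExt x w) hy]
  rw [hcov.curv_eq, hcov.curv_eq, h, h, smul_sub]

theorem IsLeviCivita.curv_add_left (hcov : IsLeviCivita cov) (x : M) (u u' v w : TSp n x) :
    curv cov x (u + u') v w = curv cov x u v w + curv cov x u' v w := by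
  set φ := chartAt (Model n) x
  have hx : x ∈ φ.source := mem_chart_source _ x
  have h : cov (fun y ↦ cov (constExt x w) y (constExt x (u + u') y)) x
      = cov (fun y ↦ cov (constExt x w) y (constExt x u y)) x
        + cov (fun y ↦ cov (constExt x w) y (constExt x u' y)) x := by
    rw [← cov_add cov φ.open_source (hcov.smoothOn_cov_constExt x u w)
      (hcov.smoothOn_cov_constExt x u' w) hx]
    refine congrArg (fun Y ↦ cov Y x) (funext fun y ↦ ?_)
    rw [constExt_add, map_add]
  rw [hcov.curv_eq, hcov.curv_eq, hcov.curv_eq, h, map_add, add_apply]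
  abel

theorem IsLeviCivita.curv_smul_left (hcov : IsLeviCivita cov) (x : M) (a : ℝ) (u v w : TSp n x) :
    curv cov x (a • u) v w = a • curv cov x u v w := by
  set φ := chartAt (Model n) x
  have hx : x ∈ φ.source := mem_chart_source _ x
  have h (z : TSp n x) : cov (fun y ↦ cov (constExt x w) y (constExt x (a • u) y)) x z
      = a • cov (fun y ↦ cov (constExt x w) y (constExt x u y)) x z := by
    have h1 : cov (fun y ↦ a • cov (constExt x w) y (constExt x u y)) x z
        = a • cov (fun y ↦ cov (constExt x w) y (constExt x u y)) x z := by
      rw [cov_smul cov (f := fun _ ↦ a) φ.open_source contMDiffOn_const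
        (hcov.smoothOn_cov_constExt x u w) hx, mvfderiv_const]
      simp
    rw [← h1]
    refine congrArg (fun Y : VField n M ↦ cov Y x z) (funext fun y ↦ ?_)
    rw [constExt_smul, map_smul]
  rw [hcov.curv_eq, hcov.curv_eq, h, map_smul, smul_sub]

theorem IsLeviCivita.isLinearMap_curv_mid (hcov : IsLeviCivita cov) (x : M) (u w : TSp n x) :
    IsLinearMap ℝ fun v ↦ curv cov x u v w := by
  refine ⟨fun v v' ↦ ?_, fun a v ↦ ?_⟩
  · simp only [hcov.curv_swap_left x _ u w, hcov.curv_add_left, neg_add]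
  · simp only [hcov.curv_swap_left x _ u w, hcov.curv_smul_left, smul_neg]

theorem IsLeviCivita.isLinearMap_curv_right (hcov : IsLeviCivita cov) (x : M) (u v : TSp n x) :
    IsLinearMap ℝ (curv cov x u v) :=
  ⟨hcov.curv_add_right x u v, fun a w ↦ hcov.curv_smul_right x a u v w⟩

/-- The first Bianchi identity. -/
theorem IsLeviCivita.curv_bianchi (hcov : IsLeviCivita cov) (x : M) (u v w : TSp n x) :
    curv cov x u v w + curv cov x v w u + curv cov x w u v = 0 := by
  set φ := chartAt (Model n) x
  have hx : x ∈ φ.source := mem_chart_source _ x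
  have h (u v : TSp n x) : cov (fun y ↦ cov (constExt x u) y (constExt x v y)) x
      = cov (fun y ↦ cov (constExt x v) y (constExt x u y)) x :=
    cov_congr cov φ.open_source (hcov.smoothOn_cov_constExt x v u)
      (fun y hy ↦ hcov.cov_constExt_comm x v u hy) hx
  simp only [hcov.curv_eq]
  rw [h w v, h w u, h v u]
  abel

/-- The curvature operators are skew-adjoint. -/
theorem IsLeviCivita.inner_curv_swap (hcov : IsLeviCivita cov) (x : M) (u v w z : TSp n x) :
    (inner ℝ (curv cov x u v z) w : ℝ) = -inner ℝ (curv cov x u v w) z := by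
  set φ := chartAt (Model n) x
  have hx : x ∈ φ.source := mem_chart_source _ x
  have hφ := φ.open_source
  have hs := smoothOn_constExt (n := n) x
  have hsc := hcov.smoothOn_cov_constExt x
  have h1 (u v : TSp n x) : mvfderiv 𝓘(ℝ, Model n) (fun y ↦ mvfderiv 𝓘(ℝ, Model n)
      (fun y ↦ (inner ℝ (constExt x w y) (constExt x z y) : ℝ)) y (constExt x v y)) x u
      = inner ℝ (cov (fun y ↦ cov (constExt x w) y (constExt x v y)) x u) z
        + inner ℝ (cov (constExt x w) x v) (cov (constExt x z) x u)
        + (inner ℝ (cov (constExt x w) x u) (cov (constExt x z) x v)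
        + inner ℝ w (cov (fun y ↦ cov (constExt x z) y (constExt x v y)) x u)) := by
    rw [mvfderiv_congr (Filter.eventually_of_mem (hφ.mem_nhds hx) fun y hy ↦
        hcov.mvfderiv_inner hφ (hs w) (hs z) hy (constExt x v y)),
      mvfderiv_add_apply hφ (contMDiffOn_inner (hsc v w) (hs z)) (contMDiffOn_inner (hs w) (hsc v z)) hx,
      hcov.mvfderiv_inner hφ (hsc v w) (hs z) hx, hcov.mvfderiv_inner hφ (hs w) (hsc v z) hx]
    simp only [constExt_self]
  have h2 := mvfderiv_constField_comm (chartAt_mem_charts x) hφ subset_rfl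
    (contMDiffOn_inner (hs w) (hs z)) hx (chartD φ x v) (chartD φ x u)
  have h3 := (h1 u v).symm.trans ((congrArg _ (constExt_self x u).symm).trans (h2.trans
    ((congrArg _ (constExt_self x v)).trans (h1 v u))))
  rw [hcov.curv_eq, hcov.curv_eq, inner_sub_left, inner_sub_left, real_inner_comm w, real_inner_comm w]
  linarith

theorem IsLeviCivita.isCurvatureLike (hcov : IsLeviCivita cov) (x : M) {ι : Type*} [Fintype ι]
    (e : ι → TSp n x) :
    IsCurvatureLike fun i j k l ↦ (inner ℝ (curv cov x (e i) (e j) (e k)) (e l) : ℝ) where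
  swap_left i j k l := by rw [hcov.curv_swap_left, inner_neg_left]
  swap_right i j k l := by rw [hcov.inner_curv_swap]
  bianchi i j k l := by
    rw [← inner_add_left, ← inner_add_left, hcov.curv_bianchi, inner_zero_left]

/-- The curvature operator `R(u, v)` on the tangent space. -/
def IsLeviCivita.curvOp (hcov : IsLeviCivita cov) (x : M) (u v : TSp n x) : TSp n x →L[ℝ] TSp n x :=
  LinearMap.toContinuousLinearMap ((hcov.isLinearMap_curv_right x u v).mk' _)

theorem IsLeviCivita.curvOp_apply (hcov : IsLeviCivita cov) (x : M) (u v w : TSp n x) :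
    hcov.curvOp x u v w = curv cov x u v w := rfl

/-- The Ricci identity: the commutator of covariant derivatives of forms along commuting vector
fields is minus the derivation action of the curvature operator. The contraction with a vector field
reduces the degree, which allows an induction. -/
theorem IsLeviCivita.formCov_commutator (hcov : IsLeviCivita cov) (x : M) (u v : TSp n x) (k : ℕ)
    {U : Set M} (hU : IsOpen U) (hUx : U ⊆ (chartAt (Model n) x).source) (hx : x ∈ U)
    {θ : DForm n M} (hθ : θ.SmoothOn U) :
    (formCov cov (fun y ↦ formCov cov θ y (constExt x v y)) x u
      - formCov cov (fun y ↦ formCov cov θ y (constExt x u y)) x v) k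
      = -derivAction (hcov.curvOp x u v) (θ x) k := by
  have hφ := chartAt_mem_charts (n := n) x
  set φ := chartAt (Model n) x
  have hs (u : TSp n x) : (constExt x u).SmoothOn U := (smoothOn_constExt (n := n) x u).mono hUx
  have hsc (u w : TSp n x) := (hcov.smoothOn_cov_constExt x u w).mono hUx
  induction k generalizing θ with
  | zero =>
    ext w
    have h1 (v : TSp n x) := hcov.smoothOn_formCov hU hθ (hs v)
    have h2 (u v : TSp n x) : formCov cov (fun y ↦ formCov cov θ y (constExt x v y)) x u 0 w
        = mvfderiv 𝓘(ℝ, Model n) (fun y ↦ mvfderiv 𝓘(ℝ, Model n) (fun y ↦ θ y 0 ![]) y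
          (constExt x v y)) x u := by
      rw [formCov_zero_degree hU (h1 v) hx]
      refine congrArg (fun T : TSp n x →L[ℝ] ℝ ↦ T u) (mvfderiv_congr
        (Filter.eventually_of_mem (hU.mem_nhds hx) fun y hy ↦ ?_))
      exact formCov_zero_degree hU hθ hy _ _
    have h3 : ContMDiffOn 𝓘(ℝ, Model n) 𝓘(ℝ, ℝ) ∞ (fun y ↦ θ y 0 ![]) U := by
      refine (hθ.apply hU (X := ![]) (fun i ↦ i.elim0)).congr fun y _ ↦ ?_
      exact congrArg _ (Subsingleton.elim _ _)
    have h4 := mvfderiv_constField_comm hφ hU hUx h3 hx (chartD φ x v) (chartD φ x u)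
    have h5 := (congrArg _ (constExt_self x u).symm).trans (h4.trans
      (congrArg _ (constExt_self x v)))
    have h6 : formCov cov (fun y ↦ formCov cov θ y (constExt x v y)) x u 0 w
      = formCov cov (fun y ↦ formCov cov θ y (constExt x u y)) x v 0 w := by
      rw [h2, h2]; exact h5
    exact (sub_eq_zero.2 h6).trans (neg_zero (G := ℝ)).symm
  | succ k ih =>
    ext w
    set z := w 0
    have hZ := hs z
    have h1 (u v : TSp n x) : formCov cov (fun y ↦ formCov cov
        (fun y ↦ contract (constExt x z y) (θ y)) y (constExt x v y)) x u
        = contract (cov (fun y ↦ cov (constExt x z) y (constExt x v y)) x u) (θ x)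
          + contract (cov (constExt x z) x v) (formCov cov θ x u)
          + (contract (cov (constExt x z) x u) (formCov cov θ x v)
          + contract z (formCov cov (fun y ↦ formCov cov θ y (constExt x v y)) x u)) := by
      have e1 := hcov.smoothOn_formCov hU hθ (hs v)
      rw [formCov_congr (θ := fun y ↦ contract (cov (constExt x z) y (constExt x v y)) (θ y)
          + contract (constExt x z y) (formCov cov θ y (constExt x v y))) hU
          ((hθ.contract hU (hsc v z)).add hU (e1.contract hU hZ))
          (fun y hy ↦ formCov_contract hU hZ hθ hy _) hx,
        formCov_add hU (hθ.contract hU (hsc v z)) (e1.contract hU hZ) hx,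
        formCov_contract hU (hsc v z) hθ hx, formCov_contract hU hZ e1 hx]
      simp only [constExt_self]
    -- Apply the induction hypothesis to `l(Z) θ`, where `Z` extends the first argument `z` of `w`.
    have h2 := DFunLike.congr_fun (ih (hθ.contract hU hZ)) (Fin.tail w)
    have hw : w = Fin.cons z (Fin.tail w) := (Fin.cons_self_tail w).symm
    rw [h1, h1] at h2
    have e (α : Ext (TSp n x)) : α (k + 1) w = contract z α k (Fin.tail w) := by
      rw [contract_apply, ← hw]
    have h3 (a b : TSp n x) : contract (a - b) (θ x) = contract a (θ x) - contract b (θ x) := by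
      rw [sub_eq_add_neg, contract_add, ← neg_one_smul ℝ b, contract_smul]
      simp only [LinearMap.add_apply, LinearMap.smul_apply]
      module
    have h4 : contract (curv cov x u v z) (θ x) k (Fin.tail w)
        + (formCov cov (fun y ↦ formCov cov θ y (constExt x v y)) x u
      - formCov cov (fun y ↦ formCov cov θ y (constExt x u y)) x v) (k + 1) w
        = -derivAction (hcov.curvOp x u v) (contract z (θ x)) k (Fin.tail w) := by
      have h5 : (-derivAction (hcov.curvOp x u v) (contract z (θ x)) k) (Fin.tail w)
        = -derivAction (hcov.curvOp x u v) (contract z (θ x)) k (Fin.tail w) := rfl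
      rw [constExt_self] at h2
      rw [← h5, ← h2, hcov.curv_eq, h3]
      simp only [Pi.sub_apply, Pi.add_apply, ContinuousAlternatingMap.sub_apply,
        ContinuousAlternatingMap.add_apply]
      rw [e, e]
      ring
    have h6 : derivAction (hcov.curvOp x u v) (θ x) (k + 1) w
        = contract (curv cov x u v z) (θ x) k (Fin.tail w)
          + derivAction (hcov.curvOp x u v) (contract z (θ x)) k (Fin.tail w) := by
      rw [derivAction_apply, derivAction_apply, Fin.sum_univ_succ]
      simp only [contract_apply]
      congr 1
      · conv_lhs => rw [hw, Fin.update_cons_zero]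
        rfl
      · refine Finset.sum_congr rfl fun i _ ↦ ?_
        rw [Fin.cons_update]
        conv_lhs => rw [hw]
        simp [Fin.tail]
    have h7 : (-derivAction (hcov.curvOp x u v) (θ x) (k + 1)) w
        = -derivAction (hcov.curvOp x u v) (θ x) (k + 1) w := rfl
    rw [h7]
    linarith

end Curvature

/-! ### The Dirac operator and its square -/

section Dirac

variable {n : ℕ} {M : Type*} [TopologicalSpace M] [ChartedSpace (Model n) M]
  [RiemannianBundle (fun x : M ↦ TangentSpace 𝓘(ℝ, Model n) x)]

theorem isLinearMap_cliff_left {V : Type*} [NormedAddCommGroup V] [InnerProductSpace ℝ V]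
    (η : Ext V) : IsLinearMap ℝ fun u : V ↦ cliff u η :=
  ⟨fun u w ↦ by rw [cliff_add]; rfl, fun a u ↦ by rw [cliff_smul]; rfl⟩

theorem isLinearMap_contract_left {V : Type*} [NormedAddCommGroup V] [NormedSpace ℝ V]
    (η : Ext V) : IsLinearMap ℝ fun u : V ↦ contract u η :=
  ⟨fun u w ↦ by rw [contract_add]; rfl, fun a u ↦ by rw [contract_smul]; rfl⟩

theorem isLinearMap_wedgeDual_left {V : Type*} [NormedAddCommGroup V] [InnerProductSpace ℝ V]
    (η : Ext V) : IsLinearMap ℝ fun u : V ↦ wedgeDual u η :=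
  ⟨fun u w ↦ by rw [wedgeDual_add]; rfl, fun a u ↦ by rw [wedgeDual_smul]; rfl⟩

theorem sum_inner_smul_of_orthonormal {x : M} {e : Fin n → TSp n x} (he : Orthonormal ℝ e)
    (u : TSp n x) : ∑ a, (inner ℝ (e a) u : ℝ) • e a = u := by
  have hcard : Fintype.card (Fin n) = Module.finrank ℝ (TSp n x) := by
    have h : Module.finrank ℝ (TSp n x) = Module.finrank ℝ (Model n) := rfl
    rw [h]; simp
  have hspan : ⊤ ≤ Submodule.span ℝ (range e) :=
    (he.linearIndependent.span_eq_top_of_card_eq_finrank' hcard).ge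
  have h := sum_inner_smul_orthonormalBasis (OrthonormalBasis.mk he hspan) u
  simpa using h

variable [IsManifold 𝓘(ℝ, Model n) ∞ M]

/-- The Dirac operator `∑ c(e_a) ∇_{e_a}` of the connection on forms. -/
def dirac (cov : TConn n M) (θ : DForm n M) : DForm n M := fun x ↦
  ∑ a, cliff (stdOrthonormalBasis ℝ (TSp n x) a)
    (formCov cov θ x (stdOrthonormalBasis ℝ (TSp n x) a))

variable {cov : TConn n M} {U : Set M} {θ : DForm n M} {x : M}

theorem dirac_eq_sum_dual (hU : IsOpen U) (hθ : θ.SmoothOn U) (hx : x ∈ U) {ι : Type*} [Fintype ι]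
    (E D : ι → TSp n x) (hED : ∀ u, ∑ j, (inner ℝ (E j) u : ℝ) • D j = u) :
    dirac cov θ x = ∑ j, cliff (E j) (formCov cov θ x (D j)) := by
  have hl := isLinearMap_formCov (cov := cov) hU hθ hx
  exact (sum_dual_eq_sum_orthonormal E D hED _ (sum_inner_smul_orthonormalBasis _)
    (fun u w ↦ cliff u (formCov cov θ x w)) (fun w ↦ isLinearMap_cliff_left _)
    (fun u ↦ ⟨fun w w' ↦ by rw [hl.map_add, map_add], fun a w ↦ by rw [hl.map_smul, map_smul]⟩)).symm

variable [IsContMDiffRiemannianBundle 𝓘(ℝ, Model n) ∞ (Model n)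
    (fun x : M ↦ TangentSpace 𝓘(ℝ, Model n) x)]

theorem IsLeviCivita.smoothOn_dirac (hcov : IsLeviCivita cov) (hU : IsOpen U)
    (hθ : θ.SmoothOn U) : (dirac cov θ).SmoothOn U := by
  refine DForm.smoothOn_of_locally hU fun x hx ↦ ?_
  have hφ := chartAt_mem_charts (n := n) x
  set φ := chartAt (Model n) x
  have hW : IsOpen (U ∩ φ.source) := hU.inter φ.open_source
  refine ⟨U ∩ φ.source, hW, ⟨hx, mem_chart_source _ x⟩, ?_⟩
  refine DForm.SmoothOn.congr (DForm.SmoothOn.sum (s := Finset.univ) hW fun a _ ↦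
    DForm.SmoothOn.cliff hW ((smoothOn_dualField hφ a).mono inter_subset_right)
      (hcov.smoothOn_formCov hW (hθ.mono inter_subset_left)
        ((smoothOn_coordField hφ a).mono inter_subset_right))) fun y hy ↦ ?_
  exact dirac_eq_sum_dual hU hθ hy.1 _ _ (sum_inner_dualField hφ hy.2)

/-- The second covariant derivative `∇²_{u,w} θ`. -/
def formHess (cov : TConn n M) (θ : DForm n M) (x : M) (u w : TSp n x) : Ext (TSp n x) :=
  formCov cov (fun y ↦ formCov cov θ y (constExt x w y)) x u
    - formCov cov θ x (cov (constExt x w) x u)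

theorem IsLeviCivita.formHess_add_right (hcov : IsLeviCivita cov) (hU : IsOpen U)
    (hθ : θ.SmoothOn U) (hx : x ∈ U) (u w w' : TSp n x) :
    formHess cov θ x u (w + w') = formHess cov θ x u w + formHess cov θ x u w' := by
  set φ := chartAt (Model n) x
  have hV : IsOpen (U ∩ φ.source) := hU.inter φ.open_source
  have hxV : x ∈ U ∩ φ.source := ⟨hx, mem_chart_source _ x⟩
  have hθV := hθ.mono (inter_subset_left : U ∩ φ.source ⊆ U)
  have hs (w : TSp n x) := (smoothOn_constExt x w).mono (inter_subset_right : U ∩ φ.source ⊆ φ.source)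
  have hf (w : TSp n x) := hcov.smoothOn_formCov hV hθV (hs w)
  simp only [formHess]
  rw [formCov_congr (θ := fun y ↦ formCov cov θ y (constExt x w y) + formCov cov θ y (constExt x w' y))
      hV ((hf w).add hV (hf w')) (fun y hy ↦ by
        rw [constExt_add, formCov_add_right hV hθV hy]) hxV,
    formCov_add hV (hf w) (hf w') hxV,
    show constExt x (w + w') = fun y ↦ constExt x w y + constExt x w' y from
      funext (constExt_add x w w'), cov_add cov hV (hs w) (hs w') hxV, add_apply,
    formCov_add_right hV hθV hxV]
  abel

theorem IsLeviCivita.formHess_smul_right (hcov : IsLeviCivita cov) (hU : IsOpen U)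
    (hθ : θ.SmoothOn U) (hx : x ∈ U) (u : TSp n x) (a : ℝ) (w : TSp n x) :
    formHess cov θ x u (a • w) = a • formHess cov θ x u w := by
  set φ := chartAt (Model n) x
  have hV : IsOpen (U ∩ φ.source) := hU.inter φ.open_source
  have hxV : x ∈ U ∩ φ.source := ⟨hx, mem_chart_source _ x⟩
  have hθV := hθ.mono (inter_subset_left : U ∩ φ.source ⊆ U)
  have hs (w : TSp n x) := (smoothOn_constExt x w).mono (inter_subset_right : U ∩ φ.source ⊆ φ.source)
  have hf (w : TSp n x) := hcov.smoothOn_formCov hV hθV (hs w)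
  simp only [formHess]
  rw [formCov_congr (θ := fun y ↦ a • formCov cov θ y (constExt x w y))
      hV ((hf w).const_smul a hV) (fun y hy ↦ by
        rw [constExt_smul, formCov_smul_right hV hθV hy]) hxV,
    formCov_const_smul a hV (hf w) hxV,
    show constExt x (a • w) = fun y ↦ a • constExt x w y from
      funext (constExt_smul x a w), cov_smul cov (f := fun _ ↦ a) hV contMDiffOn_const (hs w) hxV,
    mvfderiv_const, zero_apply, zero_smul, add_zero,
    formCov_smul_right hV hθV hxV, smul_sub]

theorem IsLeviCivita.isLinearMap_formHess_right (hcov : IsLeviCivita cov) (hU : IsOpen U)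
    (hθ : θ.SmoothOn U) (hx : x ∈ U) (u : TSp n x) : IsLinearMap ℝ (formHess cov θ x u) :=
  ⟨hcov.formHess_add_right hU hθ hx u, hcov.formHess_smul_right hU hθ hx u⟩

theorem IsLeviCivita.isLinearMap_formHess_left (hcov : IsLeviCivita cov) (hU : IsOpen U)
    (hθ : θ.SmoothOn U) (hx : x ∈ U) (w : TSp n x) :
    IsLinearMap ℝ fun u ↦ formHess cov θ x u w := by
  set φ := chartAt (Model n) x
  have hV : IsOpen (U ∩ φ.source) := hU.inter φ.open_source
  have hxV : x ∈ U ∩ φ.source := ⟨hx, mem_chart_source _ x⟩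
  have hθV := hθ.mono (inter_subset_left : U ∩ φ.source ⊆ U)
  have hf := hcov.smoothOn_formCov hV hθV
    ((smoothOn_constExt x w).mono (inter_subset_right : U ∩ φ.source ⊆ φ.source))
  refine ⟨fun u u' ↦ ?_, fun a u ↦ ?_⟩
  · simp only [formHess]
    rw [formCov_add_right hV hf hxV, map_add, formCov_add_right hV hθV hxV]
    abel
  · simp only [formHess]
    rw [formCov_smul_right hV hf hxV, map_smul, formCov_smul_right hV hθV hxV, smul_sub]

/-- The second covariant derivative is tensorial: it can be computed with any extension. -/
theorem IsLeviCivita.formHess_eq (hcov : IsLeviCivita cov) (hU : IsOpen U) (hθ : θ.SmoothOn U)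
    (hx : x ∈ U) {Y : VField n M} (hY : Y.SmoothOn U) (u : TSp n x) :
    formCov cov (fun y ↦ formCov cov θ y (Y y)) x u - formCov cov θ x (cov Y x u)
      = formHess cov θ x u (Y x) := by
  have hφ := chartAt_mem_charts (n := n) x
  set φ := chartAt (Model n) x
  set V := U ∩ φ.source
  have hV : IsOpen V := hU.inter φ.open_source
  have hxV : x ∈ V := ⟨hx, mem_chart_source _ x⟩
  have hVφ : V ⊆ φ.source := inter_subset_right
  have hθV := hθ.mono (inter_subset_left : V ⊆ U)
  have hYV := hY.mono (inter_subset_left : V ⊆ U)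
  have hd (j : Fin n) : (coordField φ j).SmoothOn V := (smoothOn_coordField hφ j).mono hVφ
  have hc := contMDiffOn_chartD_coord hφ hV hVφ hYV
  have hlin {y : M} (hy : y ∈ V) := isLinearMap_formCov (cov := cov) hV hθV hy
  have hf (j : Fin n) := hcov.smoothOn_formCov hV hθV (hd j)
  have hconst (j : Fin n) : constExt x (coordField φ j x) = coordField φ j := by
    rw [constExt, coordField_eq_constField, chartD_constField hφ (hVφ hxV)]
  have hsum {y : M} (hy : y ∈ V) {ι : Type} (s : Finset ι) (w : ι → TSp n y) :
      formCov cov θ y (∑ i ∈ s, w i) = ∑ i ∈ s, formCov cov θ y (w i) :=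
    map_sum ((hlin hy).mk' _) w s
  have h1 : formCov cov (fun y ↦ formCov cov θ y (Y y)) x u
      = ∑ j, (chartD φ x (Y x) j • formCov cov (fun y ↦ formCov cov θ y (coordField φ j y)) x u
        + mvfderiv 𝓘(ℝ, Model n) (fun y ↦ chartD φ y (Y y) j) x u
          • formCov cov θ x (coordField φ j x)) := by
    rw [formCov_congr (θ := fun y ↦ ∑ j, chartD φ y (Y y) j • formCov cov θ y (coordField φ j y)) hV
      (DForm.SmoothOn.sum hV fun j _ ↦ DForm.SmoothOn.smul hV (hc j) (hf j)) (fun y hy ↦ ?_) hxV,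
      formCov_sum Finset.univ hV (fun j ↦ DForm.SmoothOn.smul hV (hc j) (hf j)) hxV]
    · exact Finset.sum_congr rfl fun j _ ↦ formCov_smul hV (hc j) (hf j) hxV u
    · conv_lhs => rw [← sum_chartD_smul_coordField hφ (hVφ hy) (Y y)]
      rw [hsum hy]
      exact Finset.sum_congr rfl fun j _ ↦ (hlin hy).map_smul _ _
  have h2 : formCov cov θ x (cov Y x u)
      = ∑ j, (chartD φ x (Y x) j • formCov cov θ x (cov (coordField φ j) x u)
        + mvfderiv 𝓘(ℝ, Model n) (fun y ↦ chartD φ y (Y y) j) x u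
          • formCov cov θ x (coordField φ j x)) := by
    rw [cov_apply_eq_sum cov hφ hV hVφ hYV hxV, hsum hxV]
    refine Finset.sum_congr rfl fun j _ ↦ ?_
    rw [(hlin hxV).map_add, (hlin hxV).map_smul, (hlin hxV).map_smul]
  have h3 : formHess cov θ x u (Y x) = ∑ j, chartD φ x (Y x) j • formHess cov θ x u (coordField φ j x) := by
    conv_lhs => rw [← sum_chartD_smul_coordField hφ (hVφ hxV) (Y x)]
    refine (map_sum ((hcov.isLinearMap_formHess_right hU hθ hx u).mk' _) _ _).trans ?_
    exact Finset.sum_congr rfl fun j _ ↦ (hcov.isLinearMap_formHess_right hU hθ hx u).map_smul _ _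
  rw [h1, h2, h3, ← Finset.sum_sub_distrib]
  refine Finset.sum_congr rfl fun j _ ↦ ?_
  rw [formHess, hconst]
  module

/-- The Ricci identity for the second covariant derivative. -/
theorem IsLeviCivita.formHess_sub_swap (hcov : IsLeviCivita cov) (hU : IsOpen U) (hθ : θ.SmoothOn U)
    (hx : x ∈ U) (u w : TSp n x) :
    formHess cov θ x u w - formHess cov θ x w u = -derivAction (hcov.curvOp x u w) (θ x) := by
  set φ := chartAt (Model n) x
  have hV : IsOpen (U ∩ φ.source) := hU.inter φ.open_source
  have hxV : x ∈ U ∩ φ.source := ⟨hx, mem_chart_source _ x⟩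
  have h1 : formCov cov (fun y ↦ formCov cov θ y (constExt x w y)) x u
      - formCov cov (fun y ↦ formCov cov θ y (constExt x u y)) x w
      = -derivAction (hcov.curvOp x u w) (θ x) :=
    funext fun k ↦ hcov.formCov_commutator x u w k hV inter_subset_right hxV
      (hθ.mono inter_subset_left)
  have h2 := hcov.cov_constExt_comm x u w (y := x) (mem_chart_source _ x)
  rw [constExt_self, constExt_self] at h2
  rw [← h1, formHess, formHess, h2]
  abel

/-- The covariant derivative of the Dirac operator: the derivatives of the frame cancel. -/
theorem IsLeviCivita.formCov_dirac (hcov : IsLeviCivita cov) (hU : IsOpen U) (hθ : θ.SmoothOn U)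
    (hx : x ∈ U) {e : Fin n → TSp n x} (he : Orthonormal ℝ e) (u : TSp n x) :
    formCov cov (dirac cov θ) x u = ∑ a, cliff (e a) (formHess cov θ x u (e a)) := by
  have hφ := chartAt_mem_charts (n := n) x
  set φ := chartAt (Model n) x
  set V := U ∩ φ.source
  have hV : IsOpen V := hU.inter φ.open_source
  have hxV : x ∈ V := ⟨hx, mem_chart_source _ x⟩
  have hVφ : V ⊆ φ.source := inter_subset_right
  have hθV := hθ.mono (inter_subset_left : V ⊆ U)
  have hd (j : Fin n) : (coordField φ j).SmoothOn V := (smoothOn_coordField hφ j).mono hVφ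
  have hE (j : Fin n) : (dualField φ j).SmoothOn V := (smoothOn_dualField hφ j).mono hVφ
  have hf (j : Fin n) := hcov.smoothOn_formCov hV hθV (hd j)
  have hlin := isLinearMap_formCov (cov := cov) hV hθV hxV
  have h1 : formCov cov (dirac cov θ) x u
      = ∑ a, (cliff (cov (dualField φ a) x u) (formCov cov θ x (coordField φ a x))
        + cliff (dualField φ a x)
          (formCov cov (fun y ↦ formCov cov θ y (coordField φ a y)) x u)) := by
    rw [formCov_congr (θ := fun y ↦ ∑ a, cliff (dualField φ a y) (formCov cov θ y (coordField φ a y)))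
      hV (DForm.SmoothOn.sum hV fun a _ ↦ DForm.SmoothOn.cliff hV (hE a) (hf a))
      (fun y hy ↦ dirac_eq_sum_dual hV hθV hy _ _ (sum_inner_dualField hφ (hVφ hy))) hxV,
      formCov_sum Finset.univ hV (fun a ↦ DForm.SmoothOn.cliff hV (hE a) (hf a)) hxV]
    exact Finset.sum_congr rfl fun a _ ↦ hcov.formCov_cliff hV (hE a) (hf a) hxV u
  let b : TSp n x →ₗ[ℝ] TSp n x →ₗ[ℝ] Ext (TSp n x) :=
    LinearMap.mk₂ ℝ (fun u w ↦ cliff u (formCov cov θ x w))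
      (fun u u' w ↦ (isLinearMap_cliff_left _).map_add u u')
      (fun a u w ↦ (isLinearMap_cliff_left _).map_smul a u)
      (fun u w w' ↦ by rw [hlin.map_add, map_add])
      (fun a u w ↦ by rw [hlin.map_smul, map_smul])
  have h2 := hcov.sum_cov_dual_add hφ (hVφ hxV) u b
  have h3 : ∑ a, (cliff (cov (dualField φ a) x u) (formCov cov θ x (coordField φ a x))
      + cliff (dualField φ a x) (formCov cov θ x (cov (coordField φ a) x u))) = 0 := h2
  have h4 : ∑ a, cliff (dualField φ a x) (formHess cov θ x u (coordField φ a x))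
      = ∑ a, cliff (e a) (formHess cov θ x u (e a)) := by
    have hr := hcov.isLinearMap_formHess_right hU hθ hx u
    exact sum_dual_eq_sum_orthonormal _ _ (sum_inner_dualField hφ (hVφ hxV)) e
      (sum_inner_smul_of_orthonormal he) (fun u' w ↦ cliff u' (formHess cov θ x u w))
      (fun w ↦ isLinearMap_cliff_left _)
      (fun u' ↦ ⟨fun w w' ↦ by rw [hr.map_add, map_add], fun a w ↦ by rw [hr.map_smul, map_smul]⟩)
  rw [h1, ← h4, ← sub_eq_zero, ← Finset.sum_sub_distrib, ← h3]
  refine Finset.sum_congr rfl fun a _ ↦ ?_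
  rw [← hcov.formHess_eq hV hθV hxV (hd a) u, map_sub]
  abel

theorem IsLeviCivita.dirac_dirac (hcov : IsLeviCivita cov) (hU : IsOpen U) (hθ : θ.SmoothOn U)
    (hx : x ∈ U) {e : Fin n → TSp n x} (he : Orthonormal ℝ e) :
    dirac cov (dirac cov θ) x
      = ∑ a, ∑ b, cliff (e a) (cliff (e b) (formHess cov θ x (e a) (e b))) := by
  rw [dirac_eq_sum_dual hU (hcov.smoothOn_dirac hU hθ) hx e e (sum_inner_smul_of_orthonormal he)]
  refine Finset.sum_congr rfl fun a _ ↦ ?_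
  rw [hcov.formCov_dirac hU hθ hx he, map_sum]

theorem IsLeviCivita.scalarCurv_eq (hcov : IsLeviCivita cov) {e : Fin n → TSp n x}
    (he : Orthonormal ℝ e) :
    scalarCurv cov x = ∑ i, ∑ j, (inner ℝ (curv cov x (e i) (e j) (e j)) (e i) : ℝ) := by
  have hs (κ : Type) [Fintype κ] (f : κ → TSp n x) (hf : ∀ u, ∑ a, (inner ℝ (f a) u : ℝ) • f a = u)
      (u : TSp n x) : ∑ j, (inner ℝ (curv cov x u (e j) (e j)) u : ℝ)
        = ∑ j, (inner ℝ (curv cov x u (f j) (f j)) u : ℝ) :=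
    sum_dual_eq_sum_orthonormal e e (sum_inner_smul_of_orthonormal he) f hf
      (fun v w ↦ (inner ℝ (curv cov x u v w) u : ℝ))
      (fun w ↦ ⟨fun v v' ↦ by rw [(hcov.isLinearMap_curv_mid x u w).map_add, inner_add_left],
        fun a v ↦ by rw [(hcov.isLinearMap_curv_mid x u w).map_smul, real_inner_smul_left]; rfl⟩)
      (fun v ↦ ⟨fun w w' ↦ by rw [hcov.curv_add_right, inner_add_left],
        fun a w ↦ by rw [hcov.curv_smul_right, real_inner_smul_left]; rfl⟩)
  have hb := sum_inner_smul_orthonormalBasis (stdOrthonormalBasis ℝ (TSp n x))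
  simp only [hs _ _ hb]
  rw [scalarCurv, Finset.sum_comm, Finset.sum_comm (s := Finset.univ (α := Fin n))]
  refine Finset.sum_congr rfl fun j _ ↦ ?_
  refine (sum_dual_eq_sum_orthonormal e e (sum_inner_smul_of_orthonormal he) _ hb
    (fun v w ↦ (inner ℝ (curv cov x v (stdOrthonormalBasis ℝ (TSp n x) j)
      (stdOrthonormalBasis ℝ (TSp n x) j)) w : ℝ)) (fun w ↦ ⟨fun v v' ↦ ?_, fun a v ↦ ?_⟩)
    (fun v ↦ ⟨fun w w' ↦ inner_add_right _ _ _, fun a w ↦ real_inner_smul_right _ _ _⟩)).symm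
  · rw [hcov.curv_add_left, inner_add_left]
  · rw [hcov.curv_smul_left, real_inner_smul_left]; rfl

/-- The Clifford relations split a double sum into its trace and its antisymmetric part. -/
theorem sum_sum_clifford {ι A N : Type*} [Fintype ι] [DecidableEq ι] [Ring A] [Algebra ℝ A]
    [AddCommGroup N] [Module ℝ N] [Module A N] [IsScalarTower ℝ A N] (c : ι → A)
    (hc : ∀ i j, c i * c j + c j * c i = (if i = j then (-2 : ℝ) else 0) • (1 : A)) (h : ι → ι → N) :
    ∑ i, ∑ j, (c i * c j) • h i j
      = -∑ i, h i i + (1 / 2 : ℝ) • ∑ i, ∑ j, (c i * c j) • (h i j - h j i) := by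
  have h1 : ∑ i, ∑ j, (c i * c j) • h j i = ∑ i, ∑ j, (c j * c i) • h i j := Finset.sum_comm
  have h2 : ∑ i, ∑ j, (c i * c j) • h i j + ∑ i, ∑ j, (c j * c i) • h i j
      = -(2 : ℝ) • ∑ i, h i i := by
    rw [← Finset.sum_add_distrib, Finset.smul_sum]
    refine Finset.sum_congr rfl fun i _ ↦ ?_
    rw [← Finset.sum_add_distrib]
    simp only [← add_smul, hc]
    simp [ite_smul]
  simp only [smul_sub, Finset.sum_sub_distrib, h1]
  have h3 : ∑ i, ∑ j, (c j * c i) • h i j = -(2 : ℝ) • ∑ i, h i i - ∑ i, ∑ j, (c i * c j) • h i j := by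
    rw [← h2]; abel
  rw [h3]
  module

end Dirac

/-! ### Weitzenböck formulas -/

section EndomorphismFields

variable {n : ℕ} {M : Type*} [TopologicalSpace M] [ChartedSpace (Model n) M]
  [RiemannianBundle (fun x : M ↦ TangentSpace 𝓘(ℝ, Model n) x)]
  [IsManifold 𝓘(ℝ, Model n) ∞ M]

/-- `A'` is the covariant derivative of the smooth field `A` of endomorphisms of `∧* T*M`. -/
structure HasCovDeriv (cov : TConn n M) (A : (x : M) → Module.End ℝ (Ext (TSp n x)))
    (A' : (x : M) → TSp n x → Module.End ℝ (Ext (TSp n x))) : Prop where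
  smoothOn : ∀ {U : Set M}, IsOpen U → ∀ {θ : DForm n M}, θ.SmoothOn U →
    DForm.SmoothOn (fun y ↦ A y (θ y)) U
  formCov_apply : ∀ {U : Set M}, IsOpen U → ∀ {θ : DForm n M}, θ.SmoothOn U → ∀ {x : M}, x ∈ U →
    ∀ u : TSp n x, formCov cov (fun y ↦ A y (θ y)) x u = A' x u (θ x) + A x (formCov cov θ x u)
  linear : ∀ (x : M) (η : Ext (TSp n x)), IsLinearMap ℝ fun u ↦ A' x u η

theorem hasCovDeriv_contract (cov : TConn n M) {v : VField n M} (hv : v.SmoothOn univ) :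
    HasCovDeriv cov (fun x ↦ contract (v x)) (fun x u ↦ contract (cov v x u)) where
  smoothOn hU _ hθ := DForm.SmoothOn.contract hU (hv.mono (subset_univ _)) hθ
  formCov_apply hU _ hθ _ hx u := formCov_contract hU (hv.mono (subset_univ _)) hθ hx u
  linear x η := ⟨fun u w ↦ by rw [map_add, (isLinearMap_contract_left η).map_add],
    fun a u ↦ by rw [map_smul, (isLinearMap_contract_left η).map_smul]⟩

theorem HasCovDeriv.endCov_eq {cov : TConn n M} {A : (x : M) → Module.End ℝ (Ext (TSp n x))}
    {A' : (x : M) → TSp n x → Module.End ℝ (Ext (TSp n x))} {U : Set M} {θ : DForm n M} {x : M}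
    (hA : HasCovDeriv cov A A') (hU : IsOpen U) (hθ : θ.SmoothOn U)
    (hx : x ∈ U) (u : TSp n x) : endCov cov A x u θ = A' x u (θ x) := by
  rw [endCov, hA.formCov_apply hU hθ hx, add_sub_cancel_right]

end EndomorphismFields

section Weitzenboeck

variable {n : ℕ} {M : Type*} [TopologicalSpace M] [ChartedSpace (Model n) M]
  [RiemannianBundle (fun x : M ↦ TangentSpace 𝓘(ℝ, Model n) x)]
  [IsManifold 𝓘(ℝ, Model n) ∞ M]
  [IsContMDiffRiemannianBundle 𝓘(ℝ, Model n) ∞ (Model n)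
    (fun x : M ↦ TangentSpace 𝓘(ℝ, Model n) x)]
  {cov : TConn n M} {U : Set M} {θ : DForm n M} {x : M}

/-- The curvature term in the square of the Dirac operator. -/
theorem IsLeviCivita.sum_cliff_derivAction_curvOp (hcov : IsLeviCivita cov) {e : Fin n → TSp n x}
    (he : Orthonormal ℝ e) (η : Ext (TSp n x)) :
    ∑ i, ∑ j, cliff (e i) (cliff (e j) (derivAction (hcov.curvOp x (e i) (e j)) η))
      = (1 / 4 : ℝ) • curvClifford cov x e η - (1 / 2 * scalarCurv cov x) • η := by
  have hsum := sum_inner_smul_of_orthonormal he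
  have h1 (i j : Fin n) : derivAction (hcov.curvOp x (e i) (e j)) η
      = ∑ k, ∑ l, (inner ℝ (curv cov x (e i) (e j) (e k)) (e l) : ℝ)
        • wedgeDual (e k) (contract (e l) η) := by
    rw [derivAction_eq_sum (fun a ↦ innerSL ℝ (e a)) e hsum]
    refine Finset.sum_congr rfl fun k _ ↦ ?_
    have h2 : contract (hcov.curvOp x (e i) (e j) (e k)) η
        = ∑ l, (inner ℝ (curv cov x (e i) (e j) (e k)) (e l) : ℝ) • contract (e l) η := by
      rw [hcov.curvOp_apply]
      conv_lhs => rw [← hsum (curv cov x (e i) (e j) (e k))]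
      refine (map_sum ((isLinearMap_contract_left η).mk' _) _ _).trans ?_
      refine Finset.sum_congr rfl fun l _ ↦ ?_
      rw [real_inner_comm]
      exact (isLinearMap_contract_left η).map_smul _ _
    rw [h2, map_sum]
    exact Finset.sum_congr rfl fun l _ ↦ map_smul (wedgeDual (e k)) _ _
  have hL := (hcov.isCurvatureLike x e).lichnerowicz (A := Module.End ℝ (Ext (TSp n x)))
    (c := fun i ↦ cliff (e i)) (c' := fun i ↦ cliffBar (e i))
    (fun i j ↦ by
      rw [cliff_anticomm]
      congr 1
      rw [orthonormal_iff_ite.1 he]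
      split_ifs <;> simp)
    (fun i j ↦ cliff_cliffBar_anticomm _ _) (p := fun i ↦ wedgeDual (e i))
    (q := fun i ↦ contract (e i))
    (fun i ↦ by ext1 ζ; simp [cliff, cliffBar]; module)
    (fun i ↦ by ext1 ζ; simp [cliff, cliffBar]; module)
  have hL' := congrArg (fun T : Module.End ℝ (Ext (TSp n x)) ↦ T η) hL
  rw [← hcov.scalarCurv_eq he] at hL'
  simp only [h1, map_sum, map_smul]
  simpa only [LinearMap.sum_apply, LinearMap.smul_apply, LinearMap.sub_apply, Module.End.mul_apply,
    Module.End.one_apply, curvClifford] using hL'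

/-- The Weitzenböck formula for the Dirac operator `d + δ`. -/
theorem IsLeviCivita.dirac_dirac_eq (hcov : IsLeviCivita cov) (hU : IsOpen U) (hθ : θ.SmoothOn U)
    (hx : x ∈ U) {e : Fin n → TSp n x} (he : Orthonormal ℝ e) :
    dirac cov (dirac cov θ) x = -∑ a, formHess cov θ x (e a) (e a)
      - (1 / 8 : ℝ) • curvClifford cov x e (θ x) + ((1 / 4 : ℝ) * scalarCurv cov x) • θ x := by
  have h := sum_sum_clifford (A := Module.End ℝ (Ext (TSp n x))) (fun i ↦ cliff (e i))
    (fun i j ↦ by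
      rw [cliff_anticomm]
      congr 1
      rw [orthonormal_iff_ite.1 he]
      split_ifs <;> simp) (fun i j ↦ formHess cov θ x (e i) (e j))
  simp only [hcov.formHess_sub_swap hU hθ hx, Module.End.smul_def, Module.End.mul_apply, map_neg,
    Finset.sum_neg_distrib, hcov.sum_cliff_derivAction_curvOp he] at h
  rw [hcov.dirac_dirac hU hθ hx he, h]
  module

variable {A B : (x : M) → Module.End ℝ (Ext (TSp n x))}
  {A' B' : (x : M) → TSp n x → Module.End ℝ (Ext (TSp n x))}

theorem IsLeviCivita.hasCovDeriv_wedgeDual (hcov : IsLeviCivita cov) {v : VField n M}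
    (hv : v.SmoothOn univ) :
    HasCovDeriv cov (fun x ↦ wedgeDual (v x)) (fun x u ↦ wedgeDual (cov v x u)) where
  smoothOn hU _ hθ := DForm.SmoothOn.wedgeDual hU (hv.mono (subset_univ _)) hθ
  formCov_apply hU _ hθ _ hx u := hcov.formCov_wedgeDual hU (hv.mono (subset_univ _)) hθ hx u
  linear x η := ⟨fun u w ↦ by rw [map_add, (isLinearMap_wedgeDual_left η).map_add],
    fun a u ↦ by rw [map_smul, (isLinearMap_wedgeDual_left η).map_smul]⟩

theorem cliff_add_apply {V : Type*} [NormedAddCommGroup V] [InnerProductSpace ℝ V] (u w : V)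
    (η : Ext V) : cliff (u + w) η = cliff u η + cliff w η :=
  (isLinearMap_cliff_left η).map_add u w

theorem cliff_smul_apply {V : Type*} [NormedAddCommGroup V] [InnerProductSpace ℝ V] (a : ℝ) (u : V)
    (η : Ext V) : cliff (a • u) η = a • cliff u η :=
  (isLinearMap_cliff_left η).map_smul a u

/-- The twisted connections are connections. -/
theorem IsLeviCivita.isFormConnection_twistedCov (hcov : IsLeviCivita cov)
    (hA : HasCovDeriv cov A A') (hB : HasCovDeriv cov B B') :
    IsFormConnection (twistedCov cov A B) where
  linear U hU θ hθ x hx a u w := by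
    simp only [twistedCov, LinearMap.add_apply, Module.End.mul_apply, cliff_add_apply,
      cliff_smul_apply, map_add, map_smul]
    rw [formCov_add_right hU hθ hx, formCov_smul_right hU hθ hx]
    module
  add U hU θ η hθ hη x hx u := by
    have h : formCov cov (θ + η) x u = _ := formCov_add hU hθ hη hx u
    simp only [twistedCov, h, Pi.add_apply, map_add]
    module
  leibniz U hU θ hθ f hf x hx u := by
    simp only [twistedCov, formCov_smul hU hf hθ hx, map_smul]
    module
  smooth U hU θ hθ X hX := by
    have h1 := hcov.smoothOn_formCov hU hθ hX
    have h2 := ((DForm.SmoothOn.cliff hU hX (hA.smoothOn hU hθ)).add hU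
      (hB.smoothOn hU (DForm.SmoothOn.cliff hU hX hθ))).const_smul (1 / 2) hU
    exact (h1.sub hU h2).congr fun y _ ↦ by simp [twistedCov]

/-- The second covariant derivative of the twisted connection `∇ - ½ (c A + B c)`, in terms of the
untwisted one. -/
def twistedHess (cov : TConn n M) (A B : (x : M) → Module.End ℝ (Ext (TSp n x)))
    (A' B' : (x : M) → TSp n x → Module.End ℝ (Ext (TSp n x))) (θ : DForm n M) (x : M)
    (u w : TSp n x) : Ext (TSp n x) :=
  formHess cov θ x u w
    - (1 / 2 : ℝ) • (cliff w (A' x u (θ x)) + B' x u (cliff w (θ x)))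
    - (1 / 2 : ℝ) • (cliff w (A x (formCov cov θ x u)) + B x (cliff w (formCov cov θ x u)))
    - (1 / 2 : ℝ) • (cliff u (A x (formCov cov θ x w)) + B x (cliff u (formCov cov θ x w)))
    + (1 / 4 : ℝ) • (cliff u (A x (cliff w (A x (θ x)) + B x (cliff w (θ x))))
      + B x (cliff u (cliff w (A x (θ x)) + B x (cliff w (θ x)))))

theorem IsLeviCivita.twistedCov_twistedCov (hcov : IsLeviCivita cov)
    (hA : HasCovDeriv cov A A') (hB : HasCovDeriv cov B B') (hU : IsOpen U) (hθ : θ.SmoothOn U)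
    (hx : x ∈ U) {Y : VField n M} (hY : Y.SmoothOn U) (u : TSp n x) :
    twistedCov cov A B (fun y ↦ twistedCov cov A B θ y (Y y)) x u
      - twistedCov cov A B θ x (cov Y x u) = twistedHess cov A B A' B' θ x u (Y x) := by
  have h1 := hcov.smoothOn_formCov hU hθ hY
  have hcA := DForm.SmoothOn.cliff hU hY (hA.smoothOn hU hθ)
  have hBc := hB.smoothOn hU (DForm.SmoothOn.cliff hU hY hθ)
  have h2 : formCov cov (fun y ↦ twistedCov cov A B θ y (Y y)) x u
      = formCov cov (fun y ↦ formCov cov θ y (Y y)) x u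
        - (1 / 2 : ℝ) • (cliff (cov Y x u) (A x (θ x))
          + cliff (Y x) (A' x u (θ x) + A x (formCov cov θ x u))
          + (B' x u (cliff (Y x) (θ x)) + B x (cliff (cov Y x u) (θ x)
            + cliff (Y x) (formCov cov θ x u)))) := by
    rw [← hcov.formCov_cliff hU hY hθ hx, ← hA.formCov_apply hU hθ hx,
      ← hcov.formCov_cliff hU hY (hA.smoothOn hU hθ) hx,
      ← hB.formCov_apply hU (DForm.SmoothOn.cliff hU hY hθ) hx,
      ← formCov_add hU hcA hBc hx, ← formCov_const_smul _ hU (hcA.add hU hBc) hx,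
      ← formCov_sub hU h1 ((hcA.add hU hBc).const_smul _ hU) hx]
    rfl
  have h3 := hcov.formHess_eq hU hθ hx hY u
  rw [sub_eq_iff_eq_add] at h3
  conv_lhs => enter [1]; rw [twistedCov]
  rw [h2, h3]
  simp only [twistedCov, twistedHess, LinearMap.add_apply, Module.End.mul_apply, map_add, map_sub,
    map_smul]
  module

/-- The Laplacian of the twisted connection is a trace of `twistedHess`; in particular it does not
depend on the chart. -/
theorem IsLeviCivita.connLaplacian_twistedCov (hcov : IsLeviCivita cov)
    (hA : HasCovDeriv cov A A') (hB : HasCovDeriv cov B B') {φ : OpenPartialHomeomorph M (Model n)}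
    (hφ : φ ∈ Charts n M) (hθ : θ.SmoothOn φ.source) (hx : x ∈ φ.source) {e : Fin n → TSp n x}
    (he : Orthonormal ℝ e) :
    connLaplacian cov (twistedCov cov A B) φ θ x
      = ∑ a, twistedHess cov A B A' B' θ x (e a) (e a) := by
  have hU := φ.open_source
  have hlin := isLinearMap_formCov (cov := cov) hU hθ hx
  have hl := hcov.isLinearMap_formHess_left hU hθ hx
  have hr := hcov.isLinearMap_formHess_right hU hθ hx
  have hTl (w : TSp n x) : IsLinearMap ℝ fun u ↦ twistedHess cov A B A' B' θ x u w := by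
    refine ⟨fun u u' ↦ ?_, fun a u ↦ ?_⟩
    · simp only [twistedHess, (hl w).map_add, (hA.linear x _).map_add, (hB.linear x _).map_add,
        hlin.map_add, cliff_add_apply, map_add]
      module
    · simp only [twistedHess, (hl w).map_smul, (hA.linear x _).map_smul, (hB.linear x _).map_smul,
        hlin.map_smul, cliff_smul_apply, map_add, map_smul]
      module
  have hTr (u : TSp n x) : IsLinearMap ℝ (twistedHess cov A B A' B' θ x u) := by
    refine ⟨fun w w' ↦ ?_, fun a w ↦ ?_⟩
    · simp only [twistedHess, (hr u).map_add, hlin.map_add, cliff_add_apply, map_add]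
      module
    · simp only [twistedHess, (hr u).map_smul, hlin.map_smul, cliff_smul_apply, map_add, map_smul]
      module
  rw [← sum_dual_eq_sum_orthonormal _ _ (sum_inner_coordField hφ hx) e
    (sum_inner_smul_of_orthonormal he) _ hTl hTr, connLaplacian]
  refine Finset.sum_congr rfl fun i _ ↦ ?_
  rw [dualField]
  refine Eq.trans ?_ (map_sum ((hTr (coordField φ i x)).mk' _) _ _).symm
  refine Finset.sum_congr rfl fun j _ ↦ ?_
  rw [hcov.twistedCov_twistedCov hA hB hU hθ hx (smoothOn_coordField hφ j)]
  exact ((hTr _).map_smul _ _).symm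

/-- The Weitzenböck formula for `(D + B) (D + A)`, where `D = d + δ`. -/
theorem IsLeviCivita.twisted_weitzenboeck (hcov : IsLeviCivita cov)
    (hA : HasCovDeriv cov A A') (hB : HasCovDeriv cov B B') {φ : OpenPartialHomeomorph M (Model n)}
    (hφ : φ ∈ Charts n M) (hθ : θ.SmoothOn φ.source) (hx : x ∈ φ.source) {e : Fin n → TSp n x}
    (he : Orthonormal ℝ e) :
    dirac cov (fun y ↦ dirac cov θ y + A y (θ y)) x + B x (dirac cov θ x + A x (θ x))
      = -connLaplacian cov (twistedCov cov A B) φ θ x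
        - (1 / 8 : ℝ) • curvClifford cov x e (θ x) + ((1 / 4 : ℝ) * scalarCurv cov x) • θ x
        + B x (A x (θ x))
        + (1 / 4 : ℝ) • (∑ i, (cliff (e i) * A x + B x * cliff (e i)) ^ 2) (θ x)
        - (1 / 2 : ℝ) • ∑ j, (B' x (e j) (cliff (e j) (θ x)) - cliff (e j) (A' x (e j) (θ x))) := by
  have hU := φ.open_source
  have hsum := sum_inner_smul_of_orthonormal he
  have hD := hcov.smoothOn_dirac hU hθ
  have hAθ := hA.smoothOn hU hθ
  have h1 : dirac cov (fun y ↦ dirac cov θ y + A y (θ y)) x = dirac cov (dirac cov θ) x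
      + ∑ a, cliff (e a) (A' x (e a) (θ x) + A x (formCov cov θ x (e a))) := by
    rw [dirac_eq_sum_dual hU (hD.add hU hAθ) hx e e hsum, dirac_eq_sum_dual hU hD hx e e hsum,
      ← Finset.sum_add_distrib]
    refine Finset.sum_congr rfl fun a _ ↦ ?_
    rw [formCov_add hU hD hAθ hx, hA.formCov_apply hU hθ hx, map_add]
  rw [h1, hcov.dirac_dirac_eq hU hθ hx he, dirac_eq_sum_dual hU hθ hx e e hsum,
    hcov.connLaplacian_twistedCov hA hB hφ hθ hx he]
  -- Completing the square, term by term.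
  have key : ∑ a, (-formHess cov θ x (e a) (e a)
        + cliff (e a) (A' x (e a) (θ x) + A x (formCov cov θ x (e a)))
        + B x (cliff (e a) (formCov cov θ x (e a))))
      = ∑ a, (-twistedHess cov A B A' B' θ x (e a) (e a)
        + (1 / 4 : ℝ) • ((cliff (e a) * A x + B x * cliff (e a)) ^ 2) (θ x)
        - (1 / 2 : ℝ) • (B' x (e a) (cliff (e a) (θ x)) - cliff (e a) (A' x (e a) (θ x)))) := by
    refine Finset.sum_congr rfl fun a _ ↦ ?_
    simp only [twistedHess, pow_two, LinearMap.add_apply, Module.End.mul_apply, map_add]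
    module
  simp only [Finset.sum_add_distrib, Finset.sum_sub_distrib, Finset.sum_neg_distrib,
    ← Finset.smul_sum] at key
  simp only [map_add, map_sum, LinearMap.sum_apply, Finset.sum_add_distrib,
    Finset.sum_sub_distrib] at key ⊢
  rw [← sub_eq_zero] at key ⊢
  rw [← key]
  module

end Weitzenboeck

/-! ### The de Rham derivative in terms of the connection -/

section DeRham

variable {n : ℕ} {M : Type*} [TopologicalSpace M] [ChartedSpace (Model n) M]
  [RiemannianBundle (fun x : M ↦ TangentSpace 𝓘(ℝ, Model n) x)]

/-- The derivative of the components of a form in the preferred chart. -/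
def compDeriv (θ : DForm n M) (x : M) (u : TSp n x) : Ext (TSp n x) := fun k ↦
  (fderiv ℝ (coordForm (chartAt (Model n) x) θ k) (chartAt (Model n) x x)
    (chartD (chartAt (Model n) x) x u)).compContinuousLinearMap (chartD (chartAt (Model n) x) x)

variable [IsManifold 𝓘(ℝ, Model n) ∞ M]

theorem extD_eq_sum_compDeriv (θ : DForm n M) (x : M) :
    extD θ x = ∑ a, wedgeDual (dualField (chartAt (Model n) x) a x)
      (compDeriv θ x (coordField (chartAt (Model n) x) a x)) := by
  have hφ := chartAt_mem_charts (n := n) x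
  have hxφ : x ∈ (chartAt (Model n) x).source := mem_chart_source _ x
  refine ext_ext fun k w ↦ ?_
  have hs : (∑ a, wedgeDual (dualField (chartAt (Model n) x) a x)
      (compDeriv θ x (coordField (chartAt (Model n) x) a x))) k w
      = ∑ a, wedgeDual (dualField (chartAt (Model n) x) a x)
      (compDeriv θ x (coordField (chartAt (Model n) x) a x)) k w := by
    simp
  rw [hs]
  cases k with
  | zero => simp [wedgeDual, extD]
  | succ k =>
    simp only [wedgeDual, wedge_apply_succ, innerSL_apply_apply, inner_dualField hφ hxφ]
    rw [Finset.sum_comm]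
    have h1 : extD θ x (k + 1) w = ∑ i : Fin (k + 1), (-1 : ℝ) ^ (i : ℕ) *
        fderiv ℝ (coordForm (chartAt (Model n) x) θ k) (chartAt (Model n) x x)
          (chartD (chartAt (Model n) x) x (w i))
          (i.removeNth fun j ↦ chartD (chartAt (Model n) x) x (w j)) := by
      refine (ContinuousAlternatingMap.alternatizeUncurryFin_apply _ _).trans ?_
      refine Finset.sum_congr rfl fun i _ ↦ ?_
      rw [zsmul_eq_mul]
      push_cast
      rfl
    rw [h1]
    refine Finset.sum_congr rfl fun i _ ↦ ?_
    rw [← Finset.mul_sum]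
    congr 1
    have h2 := congrArg (chartD (chartAt (Model n) x) x) (sum_chartD_smul_coordField hφ hxφ (w i))
    conv_lhs => rw [← h2]
    simp only [map_sum, map_smul, ContinuousAlternatingMap.sum_apply, ContinuousAlternatingMap.smul_apply,
      smul_eq_mul]
    rfl

variable {cov : TConn n M} {U : Set M} {θ : DForm n M} {x : M}

theorem sum_wedgeDual_formCov_eq (hU : IsOpen U) (hθ : θ.SmoothOn U) (hx : x ∈ U)
    {ι : Type*} [Fintype ι] (E D : ι → TSp n x)
    (hED : ∀ u, ∑ j, (inner ℝ (E j) u : ℝ) • D j = u) :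
    ∑ j, wedgeDual (E j) (formCov cov θ x (D j))
      = ∑ a, wedgeDual (stdOrthonormalBasis ℝ (TSp n x) a)
        (formCov cov θ x (stdOrthonormalBasis ℝ (TSp n x) a)) := by
  have hl := isLinearMap_formCov (cov := cov) hU hθ hx
  exact sum_dual_eq_sum_orthonormal E D hED _ (sum_inner_smul_orthonormalBasis _)
    (fun u w ↦ wedgeDual u (formCov cov θ x w)) (fun w ↦ isLinearMap_wedgeDual_left _)
    (fun u ↦ ⟨fun w w' ↦ by rw [hl.map_add, map_add], fun a w ↦ by rw [hl.map_smul, map_smul]⟩)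

/-- The codifferential `-∑ l(e_a) ∇_{e_a}` of the connection on forms. -/
def codiffCov (cov : TConn n M) (θ : DForm n M) : DForm n M := fun x ↦
  -∑ a, contract (stdOrthonormalBasis ℝ (TSp n x) a)
    (formCov cov θ x (stdOrthonormalBasis ℝ (TSp n x) a))

theorem codiffCov_eq_sum_dual (hU : IsOpen U) (hθ : θ.SmoothOn U)
    (hx : x ∈ U) {ι : Type*} [Fintype ι] (E D : ι → TSp n x)
    (hED : ∀ u, ∑ j, (inner ℝ (E j) u : ℝ) • D j = u) :
    codiffCov cov θ x = -∑ j, contract (E j) (formCov cov θ x (D j)) := by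
  have hl := isLinearMap_formCov (cov := cov) hU hθ hx
  exact congrArg Neg.neg (sum_dual_eq_sum_orthonormal E D hED _ (sum_inner_smul_orthonormalBasis _)
    (fun u w ↦ contract u (formCov cov θ x w)) (fun w ↦ isLinearMap_contract_left _)
    (fun u ↦ ⟨fun w w' ↦ by rw [hl.map_add, map_add],
      fun a w ↦ by rw [hl.map_smul, map_smul]⟩)).symm

variable [IsContMDiffRiemannianBundle 𝓘(ℝ, Model n) ∞ (Model n)
    (fun x : M ↦ TangentSpace 𝓘(ℝ, Model n) x)]

/-- The de Rham derivative is the antisymmetrization of the covariant derivative, because the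
Levi-Civita connection is torsion free. -/
theorem IsLeviCivita.extD_eq_sum_dual (hcov : IsLeviCivita cov) (hU : IsOpen U) (hθ : θ.SmoothOn U)
    (hx : x ∈ U) {ι : Type*} [Fintype ι] (E D : ι → TSp n x)
    (hED : ∀ u, ∑ j, (inner ℝ (E j) u : ℝ) • D j = u) :
    extD θ x = ∑ j, wedgeDual (E j) (formCov cov θ x (D j)) := by
  have hφ := chartAt_mem_charts (n := n) x
  set φ := chartAt (Model n) x
  have hxφ : x ∈ φ.source := mem_chart_source _ x
  rw [sum_wedgeDual_formCov_eq hU hθ hx E D hED,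
    ← sum_wedgeDual_formCov_eq hU hθ hx _ _ (sum_inner_dualField hφ hxφ), extD_eq_sum_compDeriv, ← sub_eq_zero,
    ← Finset.sum_sub_distrib]
  set Γ : TSp n x → TSp n x →L[ℝ] TSp n x := fun u ↦
    ∑ j : Fin n, ((EuclideanSpace.proj j : Model n →L[ℝ] ℝ) ∘L chartD φ x).smulRight
      (cov (coordField φ j) x u)
  have hΓ (a b : Fin n) : Γ (coordField φ a x) (coordField φ b x)
      = cov (coordField φ b) x (coordField φ a x) := by
    simp only [Γ, sum_apply, ContinuousLinearMap.smulRight_apply, ContinuousLinearMap.comp_apply]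
    have h (j : Fin n) : (EuclideanSpace.proj j : Model n →L[ℝ] ℝ) (chartD φ x (coordField φ b x))
        = if b = j then 1 else 0 := chartD_coordField hφ hxφ b j
    simp [h]
  have h1 (u : TSp n x) : formCov cov θ x u = compDeriv θ x u - derivAction (Γ u) (θ x) := rfl
  have h2 (a : Fin n) : derivAction (Γ (coordField φ a x)) (θ x)
      = ∑ b, wedgeDual (dualField φ b x) (contract (cov (coordField φ b) x (coordField φ a x)) (θ x)) := by
    rw [derivAction_eq_sum (fun b ↦ innerSL ℝ (dualField φ b x)) (fun b ↦ coordField φ b x)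
      (sum_inner_dualField hφ hxφ)]
    exact Finset.sum_congr rfl fun b _ ↦ by rw [hΓ]; rfl
  -- The Christoffel symbols `∇_{∂_a} ∂_b` are symmetric, so antisymmetrization kills them.
  have h3 : ∑ a, ∑ b, wedgeDual (dualField φ a x) (wedgeDual (dualField φ b x)
      (contract (cov (coordField φ b) x (coordField φ a x)) (θ x))) = 0 := by
    have h4 : ∑ a, ∑ b, wedgeDual (dualField φ a x) (wedgeDual (dualField φ b x)
        (contract (cov (coordField φ b) x (coordField φ a x)) (θ x)))
        = -∑ a, ∑ b, wedgeDual (dualField φ a x) (wedgeDual (dualField φ b x)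
        (contract (cov (coordField φ b) x (coordField φ a x)) (θ x))) := by
      conv_lhs => rw [Finset.sum_comm]
      rw [← Finset.sum_neg_distrib]
      refine Finset.sum_congr rfl fun a _ ↦ ?_
      rw [← Finset.sum_neg_distrib]
      refine Finset.sum_congr rfl fun b _ ↦ ?_
      have h5 : cov (coordField φ a) x (coordField φ b x) = cov (coordField φ b) x (coordField φ a x) :=
        hcov.cov_constField_comm hφ hxφ _ _
      rw [h5, eq_neg_iff_add_eq_zero]
      exact congrArg (fun T : Module.End ℝ (Ext (TSp n x)) ↦
        T (contract (cov (coordField φ b) x (coordField φ a x)) (θ x)))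
        (wedgeDual_anticomm (dualField φ b x) (dualField φ a x))
    have h6 : (2 : ℝ) • ∑ a, ∑ b, wedgeDual (dualField φ a x) (wedgeDual (dualField φ b x)
        (contract (cov (coordField φ b) x (coordField φ a x)) (θ x))) = 0 := by
      rw [two_smul]
      nth_rewrite 1 [h4]
      exact neg_add_cancel _
    exact (smul_eq_zero.1 h6).resolve_left two_ne_zero
  refine Eq.trans (Finset.sum_congr rfl fun a _ ↦ ?_) h3
  rw [h1, map_sub, sub_sub_cancel, h2, map_sum]

theorem IsLeviCivita.smoothOn_extD (hcov : IsLeviCivita cov) (hU : IsOpen U)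
    (hθ : θ.SmoothOn U) : (extD θ).SmoothOn U := by
  refine DForm.smoothOn_of_locally hU fun x hx ↦ ?_
  have hφ := chartAt_mem_charts (n := n) x
  set φ := chartAt (Model n) x
  have hW : IsOpen (U ∩ φ.source) := hU.inter φ.open_source
  refine ⟨U ∩ φ.source, hW, ⟨hx, mem_chart_source _ x⟩, ?_⟩
  refine DForm.SmoothOn.congr (DForm.SmoothOn.sum (s := Finset.univ) hW fun a _ ↦
    DForm.SmoothOn.wedgeDual hW ((smoothOn_dualField hφ a).mono inter_subset_right)
      (hcov.smoothOn_formCov hW (hθ.mono inter_subset_left)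
        ((smoothOn_coordField hφ a).mono inter_subset_right))) fun y hy ↦ ?_
  exact hcov.extD_eq_sum_dual hU hθ hy.1 _ _ (sum_inner_dualField hφ hy.2)

theorem IsLeviCivita.smoothOn_codiffCov (hcov : IsLeviCivita cov) (hU : IsOpen U)
    (hθ : θ.SmoothOn U) : (codiffCov cov θ).SmoothOn U := by
  refine DForm.smoothOn_of_locally hU fun x hx ↦ ?_
  have hφ := chartAt_mem_charts (n := n) x
  set φ := chartAt (Model n) x
  have hW : IsOpen (U ∩ φ.source) := hU.inter φ.open_source
  refine ⟨U ∩ φ.source, hW, ⟨hx, mem_chart_source _ x⟩, ?_⟩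
  refine DForm.SmoothOn.congr (DForm.SmoothOn.const_smul (-1) hW
    (DForm.SmoothOn.sum (s := Finset.univ) hW fun a _ ↦
    DForm.SmoothOn.contract hW ((smoothOn_dualField hφ a).mono inter_subset_right)
      (hcov.smoothOn_formCov hW (hθ.mono inter_subset_left)
        ((smoothOn_coordField hφ a).mono inter_subset_right)))) fun y hy ↦ ?_
  rw [codiffCov_eq_sum_dual hU hθ hy.1 _ _ (sum_inner_dualField hφ hy.2)]
  module

theorem IsLeviCivita.extD_add_codiffCov (hcov : IsLeviCivita cov) (hU : IsOpen U)
    (hθ : θ.SmoothOn U) (hx : x ∈ U) : extD θ x + codiffCov cov θ x = dirac cov θ x := by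
  rw [hcov.extD_eq_sum_dual hU hθ hx _ _ (sum_inner_smul_orthonormalBasis
    (stdOrthonormalBasis ℝ (TSp n x))), codiffCov, dirac, ← sub_eq_add_neg, ← Finset.sum_sub_distrib]
  rfl

end DeRham

/-! ### The divergence formula for `d` and its adjoint -/

section PairDeg

variable {V : Type*} [NormedAddCommGroup V] [InnerProductSpace ℝ V] {ι : Type*} [Fintype ι]

/-- The pairing of the degree `k` parts of two forms, computed with two dual bases `E` and `D`. -/
def pairDeg (E D : ι → V) (k : ℕ) (η ζ : Ext V) : ℝ :=
  ∑ f : Fin k → ι, η k (fun i ↦ E (f i)) * ζ k (fun i ↦ D (f i))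

theorem pairDeg_zero (E D : ι → V) (η ζ : Ext V) :
    pairDeg E D 0 η ζ = η 0 ![] * ζ 0 ![] := by
  simp only [pairDeg, Finset.univ_unique, Finset.sum_singleton]
  congr 2 <;> exact Subsingleton.elim _ _

theorem pairDeg_succ (E D : ι → V) (k : ℕ) (η ζ : Ext V) :
    pairDeg E D (k + 1) η ζ = ∑ a, pairDeg E D k (contract (E a) η) (contract (D a) ζ) := by
  simp only [pairDeg]
  rw [sum_fin_succ_arrow k 0]
  refine Finset.sum_congr rfl fun a _ ↦ Finset.sum_congr rfl fun g _ ↦ ?_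
  rw [comp_insertNth, comp_insertNth, contract_apply, contract_apply, Fin.insertNth_zero',
    Fin.insertNth_zero']

theorem pairDeg_add_left (E D : ι → V) (k : ℕ) (η η' ζ : Ext V) :
    pairDeg E D k (η + η') ζ = pairDeg E D k η ζ + pairDeg E D k η' ζ := by
  simp [pairDeg, add_mul, Finset.sum_add_distrib]

theorem pairDeg_add_right (E D : ι → V) (k : ℕ) (η ζ ζ' : Ext V) :
    pairDeg E D k η (ζ + ζ') = pairDeg E D k η ζ + pairDeg E D k η ζ' := by
  simp [pairDeg, mul_add, Finset.sum_add_distrib]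

theorem pairDeg_smul_left (E D : ι → V) (k : ℕ) (a : ℝ) (η ζ : Ext V) :
    pairDeg E D k (a • η) ζ = a * pairDeg E D k η ζ := by
  simp [pairDeg, Finset.mul_sum, mul_assoc]

theorem pairDeg_smul_right (E D : ι → V) (k : ℕ) (a : ℝ) (η ζ : Ext V) :
    pairDeg E D k η (a • ζ) = a * pairDeg E D k η ζ := by
  simp [pairDeg, Finset.mul_sum, mul_left_comm]

end PairDeg

section DetDerivative

variable {n : ℕ} {M : Type*} [TopologicalSpace M] [ChartedSpace (Model n) M]
  [IsManifold 𝓘(ℝ, Model n) ∞ M]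

/-- Jacobi's formula for the derivative of a determinant. -/
theorem mvfderiv_det {A : M → Matrix (Fin n) (Fin n) ℝ} {x : M}
    (hA : ∀ i j, ContMDiffAt 𝓘(ℝ, Model n) 𝓘(ℝ, ℝ) ∞ (fun y ↦ A y i j) x)
    (hdet : (A x).det ≠ 0) (u : TSp n x) :
    mvfderiv 𝓘(ℝ, Model n) (fun y ↦ (A y).det) x u
      = (A x).det * ∑ i, ∑ j, (A x)⁻¹ j i * mvfderiv 𝓘(ℝ, Model n) (fun y ↦ A y i j) x u := by
  -- The determinant is an alternating form in the rows `r i` of `A`.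
  let f : (Model n) [⋀^Fin n]→L[ℝ] ℝ :=
    { (EuclideanSpace.basisFun (Fin n) ℝ).toBasis.det with
      cont := by
        change Continuous fun v : Fin n → Model n ↦
          (EuclideanSpace.basisFun (Fin n) ℝ).toBasis.det v
        simp only [Module.Basis.det_apply]
        refine Continuous.matrix_det ?_
        refine continuous_matrix fun i j ↦ ?_
        simp only [Module.Basis.toMatrix_apply, OrthonormalBasis.coe_toBasis_repr_apply,
          EuclideanSpace.basisFun_repr]
        fun_prop }
  have hf (v : Fin n → Model n) : f v = (Matrix.of fun i j ↦ v i j).det := by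
    change (EuclideanSpace.basisFun (Fin n) ℝ).toBasis.det v = _
    rw [Module.Basis.det_apply, ← Matrix.det_transpose]
    rfl
  let r : Fin n → M → Model n := fun i y ↦ WithLp.toLp 2 (A y i)
  have hr (i : Fin n) : MDifferentiableAt 𝓘(ℝ, Model n) 𝓘(ℝ, Model n) (r i) x := by
    have h : ContMDiffAt 𝓘(ℝ, Model n) 𝓘(ℝ, Fin n → ℝ) ∞ (fun y j ↦ A y i j) x :=
      contMDiffAt_pi_space.2 fun j ↦ hA i j
    exact (EuclideanSpace.equiv (Fin n) ℝ).symm.differentiableAt.mdifferentiableAt.comp x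
      (h.mdifferentiableAt (by simp))
  have hrd (i j : Fin n) : mvfderiv 𝓘(ℝ, Model n) (r i) x u j
      = mvfderiv 𝓘(ℝ, Model n) (fun y ↦ A y i j) x u := by
    exact ((mfderiv_comp_apply (I' := 𝓘(ℝ, Model n)) (I'' := 𝓘(ℝ, ℝ)) x
      (EuclideanSpace.proj (𝕜 := ℝ) j).differentiableAt.mdifferentiableAt (hr i) u).trans
      (congrArg (fun T : Model n →L[ℝ] ℝ ↦ T (mvfderiv 𝓘(ℝ, Model n) (r i) x u))
        (mfderiv_eq_fderiv.trans (EuclideanSpace.proj (𝕜 := ℝ) j).fderiv))).symm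
  have h := mvfderiv_alternating_apply (f := fun _ : M ↦ f) (x := x) mdifferentiableAt_const hr u
  have h1 : (fun y ↦ f (fun i ↦ r i y)) = fun y ↦ (A y).det := by
    funext y
    rw [hf]
    rfl
  rw [h1] at h
  rw [h, mvfderiv_const]
  have h2 (i : Fin n) : f (Function.update (fun i ↦ r i x) i (mvfderiv 𝓘(ℝ, Model n) (r i) x u))
      = (A x).det * ∑ j, (A x)⁻¹ j i * mvfderiv 𝓘(ℝ, Model n) (fun y ↦ A y i j) x u := by
    have h3 : (Matrix.of fun k l ↦ (Function.update (fun i ↦ r i x) i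
        (mvfderiv 𝓘(ℝ, Model n) (r i) x u) : Fin n → Model n) k l)
        = (A x).updateRow i fun j ↦ mvfderiv 𝓘(ℝ, Model n) (fun y ↦ A y i j) x u := by
      ext k l
      by_cases hk : k = i
      · subst hk
        simp [hrd]
      · simp [hk, r]
    rw [hf, h3, ← Matrix.cramer_transpose_apply, Matrix.cramer_eq_adjugate_mulVec,
      ← Matrix.adjugate_transpose, Matrix.mulVec, dotProduct, Finset.mul_sum]
    refine Finset.sum_congr rfl fun j _ ↦ ?_
    rw [Matrix.transpose_apply, Matrix.inv_def, Matrix.smul_apply, Ring.inverse_eq_inv', smul_eq_mul]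
    field_simp
  simp only [h2, ← Finset.mul_sum]
  simp

end DetDerivative

section Divergence

variable {n : ℕ} {M : Type*} [TopologicalSpace M] [ChartedSpace (Model n) M]
  [RiemannianBundle (fun x : M ↦ TangentSpace 𝓘(ℝ, Model n) x)]
  {φ : OpenPartialHomeomorph M (Model n)} {U : Set M} {x : M}

theorem extInner_eq_sum_pairDeg (hφ : φ ∈ Charts n M) (hx : x ∈ φ.source) (η ζ : Ext (TSp n x)) :
    extInner η ζ = ∑ k ∈ Finset.range (n + 1), ((k.factorial : ℝ))⁻¹ *
      pairDeg (fun a ↦ dualField φ a x) (fun a ↦ coordField φ a x) k η ζ := by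
  have h : Module.finrank ℝ (TSp n x) = n := finrank_euclideanSpace_fin (𝕜 := ℝ)
  rw [extInner_eq_of_dual _ _ (sum_inner_dualField hφ hx), h]
  rfl

/-- The density `√det(g_{ij})` of the Riemannian volume in a chart. -/
def volDensity (φ : OpenPartialHomeomorph M (Model n)) (x : M) : ℝ :=
  √(metricMatrix φ x).det

theorem volDensity_pos (hφ : φ ∈ Charts n M) (hx : x ∈ φ.source) : 0 < volDensity φ x :=
  Real.sqrt_pos.2 (det_metricMatrix_pos hφ hx)

variable [IsManifold 𝓘(ℝ, Model n) ∞ M]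
  [IsContMDiffRiemannianBundle 𝓘(ℝ, Model n) ∞ (Model n)
    (fun x : M ↦ TangentSpace 𝓘(ℝ, Model n) x)]
  {cov : TConn n M}

theorem contMDiffOn_pairDeg (hφ : φ ∈ Charts n M) (hU : IsOpen U) (hUφ : U ⊆ φ.source) (k : ℕ)
    {α θ : DForm n M} (hα : α.SmoothOn U) (hθ : θ.SmoothOn U) :
    ContMDiffOn 𝓘(ℝ, Model n) 𝓘(ℝ, ℝ) ∞ (fun y ↦ pairDeg (fun a ↦ dualField φ a y)
      (fun a ↦ coordField φ a y) k (α y) (θ y)) U := by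
  refine contMDiffOn_finsetSum fun f _ ↦ ContMDiffOn.mul ?_ ?_
  · exact hα.apply hU (X := fun i ↦ dualField φ (f i)) fun i ↦ (smoothOn_dualField hφ _).mono hUφ
  · exact hθ.apply hU (X := fun i ↦ coordField φ (f i)) fun i ↦ (smoothOn_coordField hφ _).mono hUφ

/-- The product rule for `pairDeg`, by induction on the degree: contraction with the two frames
lowers `k`, and the derivatives of the frames cancel. -/
theorem IsLeviCivita.mvfderiv_pairDeg (hcov : IsLeviCivita cov) (hφ : φ ∈ Charts n M)
    (hU : IsOpen U) (hUφ : U ⊆ φ.source) (hx : x ∈ U) (u : TSp n x) (k : ℕ) {α θ : DForm n M}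
    (hα : α.SmoothOn U) (hθ : θ.SmoothOn U) :
    mvfderiv 𝓘(ℝ, Model n) (fun y ↦ pairDeg (fun a ↦ dualField φ a y)
        (fun a ↦ coordField φ a y) k (α y) (θ y)) x u
      = pairDeg (fun a ↦ dualField φ a x) (fun a ↦ coordField φ a x) k (formCov cov α x u) (θ x)
        + pairDeg (fun a ↦ dualField φ a x) (fun a ↦ coordField φ a x) k (α x)
          (formCov cov θ x u) := by
  induction k generalizing α θ with
  | zero =>
    simp only [pairDeg_zero, formCov_zero_degree hU hα hx, formCov_zero_degree hU hθ hx]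
    have h0 {η : DForm n M} (hη : η.SmoothOn U) :
        ContMDiffOn 𝓘(ℝ, Model n) 𝓘(ℝ, ℝ) ∞ (fun y ↦ η y 0 ![]) U :=
      (hη.apply hU (X := ![]) fun i ↦ i.elim0).congr fun y _ ↦
        congrArg _ (Subsingleton.elim _ _)
    exact mvfderiv_mul_apply hU (h0 hα) (h0 hθ) hx u
  | succ k ih =>
    have hE (a : Fin n) := (smoothOn_dualField hφ a).mono hUφ
    have hD (a : Fin n) := (smoothOn_coordField hφ a).mono hUφ
    have hlα (a : Fin n) := hα.contract hU (hE a)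
    have hlθ (a : Fin n) := hθ.contract hU (hD a)
    simp only [pairDeg_succ]
    rw [mvfderiv_sum_apply Finset.univ hU
      (f := fun a y ↦ pairDeg (fun a ↦ dualField φ a y) (fun a ↦ coordField φ a y) k
        (contract (dualField φ a y) (α y)) (contract (coordField φ a y) (θ y)))
      (fun a ↦ contMDiffOn_pairDeg hφ hU hUφ k (hlα a) (hlθ a)) hx]
    simp only [ih (hlα _) (hlθ _), formCov_contract hU (hE _) hα hx,
      formCov_contract hU (hD _) hθ hx, pairDeg_add_left, pairDeg_add_right]
    have h := hcov.sum_cov_dual_add hφ (hUφ hx) u (LinearMap.mk₂ ℝ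
      (fun u w ↦ pairDeg (fun a ↦ dualField φ a x) (fun a ↦ coordField φ a x) k
        (contract u (α x)) (contract w (θ x)))
      (fun u u' w ↦ by rw [(isLinearMap_contract_left _).map_add, pairDeg_add_left])
      (fun a u w ↦ by rw [(isLinearMap_contract_left _).map_smul, pairDeg_smul_left, smul_eq_mul])
      (fun u w w' ↦ by rw [(isLinearMap_contract_left (θ x)).map_add, pairDeg_add_right])
      (fun a u w ↦ by
        rw [(isLinearMap_contract_left (θ x)).map_smul, pairDeg_smul_right, smul_eq_mul]))
    simp only [LinearMap.mk₂_apply, Finset.sum_add_distrib] at h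
    simp only [Finset.sum_add_distrib]
    linear_combination h

theorem contMDiffOn_extInner (hU : IsOpen U) {α θ : DForm n M} (hα : α.SmoothOn U)
    (hθ : θ.SmoothOn U) :
    ContMDiffOn 𝓘(ℝ, Model n) 𝓘(ℝ, ℝ) ∞ (fun y ↦ extInner (α y) (θ y)) U := by
  intro x hx
  have hφ := chartAt_mem_charts (n := n) x
  set φ := chartAt (Model n) x
  have hW : IsOpen (U ∩ φ.source) := hU.inter φ.open_source
  have h : ContMDiffOn 𝓘(ℝ, Model n) 𝓘(ℝ, ℝ) ∞ (fun y ↦ extInner (α y) (θ y)) (U ∩ φ.source) := by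
    refine ContMDiffOn.congr (contMDiffOn_finsetSum fun k _ ↦ contMDiffOn_const.mul
      (contMDiffOn_pairDeg hφ hW inter_subset_right k (hα.mono inter_subset_left)
        (hθ.mono inter_subset_left))) fun y hy ↦ extInner_eq_sum_pairDeg hφ hy.2 _ _
  exact (h.contMDiffAt (hW.mem_nhds ⟨hx, mem_chart_source _ x⟩)).contMDiffWithinAt

/-- The connection on forms is metric. -/
theorem IsLeviCivita.mvfderiv_extInner (hcov : IsLeviCivita cov) (hU : IsOpen U) (hx : x ∈ U)
    (u : TSp n x) {α θ : DForm n M} (hα : α.SmoothOn U) (hθ : θ.SmoothOn U) :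
    mvfderiv 𝓘(ℝ, Model n) (fun y ↦ extInner (α y) (θ y)) x u
      = extInner (formCov cov α x u) (θ x) + extInner (α x) (formCov cov θ x u) := by
  have hφ := chartAt_mem_charts (n := n) x
  have hxφ : x ∈ (chartAt (Model n) x).source := mem_chart_source _ x
  set φ := chartAt (Model n) x
  have hW : IsOpen (U ∩ φ.source) := hU.inter φ.open_source
  have hαW := hα.mono (inter_subset_left (t := φ.source))
  have hθW := hθ.mono (inter_subset_left (t := φ.source))
  have hsm (k : ℕ) := contMDiffOn_pairDeg hφ hW inter_subset_right k hαW hθW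
  have hxW : x ∈ U ∩ φ.source := ⟨hx, hxφ⟩
  rw [mvfderiv_congr (Filter.eventually_of_mem (hW.mem_nhds hxW) fun y hy ↦
    extInner_eq_sum_pairDeg hφ hy.2 (α y) (θ y))]
  rw [mvfderiv_sum_apply (Finset.range (n + 1)) hW (f := fun k y ↦ ((k.factorial : ℝ))⁻¹ *
      pairDeg (fun a ↦ dualField φ a y) (fun a ↦ coordField φ a y) k (α y) (θ y))
    (fun k ↦ contMDiffOn_const.mul (hsm k)) hxW, extInner_eq_sum_pairDeg hφ hxφ,
    extInner_eq_sum_pairDeg hφ hxφ, ← Finset.sum_add_distrib]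
  refine Finset.sum_congr rfl fun k _ ↦ ?_
  rw [mvfderiv_const_mul_apply hW (hsm k) hxW,
    hcov.mvfderiv_pairDeg hφ hW inter_subset_right hxW u k hαW hθW, mul_add]

theorem contMDiffOn_volDensity (hφ : φ ∈ Charts n M) :
    ContMDiffOn 𝓘(ℝ, Model n) 𝓘(ℝ, ℝ) ∞ (volDensity φ) φ.source := fun x hx ↦
  (Real.contDiffAt_sqrt (det_metricMatrix_pos hφ hx).ne').contMDiffAt.comp_contMDiffWithinAt x
    (contMDiffOn_det (contMDiffOn_metricMatrix hφ) x hx)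

/-- The logarithmic derivative of the volume density is the trace of the connection form. -/
theorem IsLeviCivita.mvfderiv_volDensity (hcov : IsLeviCivita cov) (hφ : φ ∈ Charts n M)
    (hx : x ∈ φ.source) (u : TSp n x) :
    mvfderiv 𝓘(ℝ, Model n) (volDensity φ) x u
      = volDensity φ x * ∑ i, (inner ℝ (dualField φ i x) (cov (coordField φ i) x u) : ℝ) := by
  have hU := φ.open_source
  have hv := contMDiffOn_volDensity hφ
  have h1 := mvfderiv_mul_apply hU hv hv hx u
  have h2 : (fun y ↦ volDensity φ y * volDensity φ y) =ᶠ[𝓝 x] fun y ↦ (metricMatrix φ y).det :=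
    Filter.eventually_of_mem (hU.mem_nhds hx) fun y hy ↦
      Real.mul_self_sqrt (det_metricMatrix_pos hφ hy).le
  have h3 : (metricMatrix φ x).det = volDensity φ x * volDensity φ x :=
    (Real.mul_self_sqrt (det_metricMatrix_pos hφ hx).le).symm
  have h4 (i j : Fin n) : mvfderiv 𝓘(ℝ, Model n) (fun y ↦ metricMatrix φ y i j) x u
      = inner ℝ (cov (coordField φ i) x u) (coordField φ j x)
        + inner ℝ (coordField φ i x) (cov (coordField φ j) x u) :=
    hcov.mvfderiv_inner hU (smoothOn_coordField hφ i) (smoothOn_coordField hφ j) hx u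
  have h5 (i : Fin n) : (inner ℝ (dualField φ i x) (cov (coordField φ i) x u) : ℝ)
      = ∑ j, (metricMatrix φ x)⁻¹ i j * inner ℝ (coordField φ j x) (cov (coordField φ i) x u) := by
    simp only [dualField, sum_inner, real_inner_smul_left]
  have hsymm (i j : Fin n) : (metricMatrix φ x)⁻¹ i j = (metricMatrix φ x)⁻¹ j i := by
    rw [← inner_dualField_dualField hφ hx, ← inner_dualField_dualField hφ hx, real_inner_comm]
  have h6 : ∑ i, ∑ j, (metricMatrix φ x)⁻¹ j i *
      mvfderiv 𝓘(ℝ, Model n) (fun y ↦ metricMatrix φ y i j) x u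
      = 2 * ∑ i, (inner ℝ (dualField φ i x) (cov (coordField φ i) x u) : ℝ) := by
    simp only [h4, h5, mul_add, Finset.sum_add_distrib]
    rw [two_mul]
    congr 1
    · refine Finset.sum_congr rfl fun i _ ↦ Finset.sum_congr rfl fun j _ ↦ ?_
      rw [hsymm, real_inner_comm]
    · exact Finset.sum_comm
  rw [mvfderiv_congr h2, mvfderiv_det (fun i j ↦
    (contMDiffOn_metricMatrix hφ i j).contMDiffAt (hU.mem_nhds hx)) (det_metricMatrix_pos hφ hx).ne', h6, h3] at h1
  have hpos := volDensity_pos hφ hx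
  have h7 : (2 * volDensity φ x) * mvfderiv 𝓘(ℝ, Model n) (volDensity φ) x u
      = (2 * volDensity φ x) * (volDensity φ x *
        ∑ i, (inner ℝ (dualField φ i x) (cov (coordField φ i) x u) : ℝ)) := by
    linear_combination -h1
  exact mul_left_cancel₀ (by positivity) h7

/-- The difference of `⟨dα, θ⟩` and `⟨α, δθ⟩` is a divergence. -/
theorem IsLeviCivita.sum_mvfderiv_volDensity_mul_extInner (hcov : IsLeviCivita cov)
    (hφ : φ ∈ Charts n M) (hx : x ∈ φ.source) {α θ : DForm n M}
    (hα : α.SmoothOn φ.source) (hθ : θ.SmoothOn φ.source) :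
    ∑ j, mvfderiv 𝓘(ℝ, Model n) (fun y ↦ volDensity φ y *
        extInner (α y) (contract (dualField φ j y) (θ y))) x (coordField φ j x)
      = volDensity φ x * (extInner (extD α x) (θ x) - extInner (α x) (codiffCov cov θ x)) := by
  have hU := φ.open_source
  have hE (j : Fin n) := smoothOn_dualField hφ j
  have hl (j : Fin n) := hθ.contract hU (hE j)
  have h1 (j : Fin n) : mvfderiv 𝓘(ℝ, Model n) (fun y ↦ volDensity φ y *
        extInner (α y) (contract (dualField φ j y) (θ y))) x (coordField φ j x)
      = volDensity φ x * ((∑ i, (inner ℝ (dualField φ i x)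
          (cov (coordField φ i) x (coordField φ j x)) : ℝ)) *
          extInner (α x) (contract (dualField φ j x) (θ x))
        + extInner (formCov cov α x (coordField φ j x)) (contract (dualField φ j x) (θ x))
        + extInner (α x) (contract (cov (dualField φ j) x (coordField φ j x)) (θ x))
        + extInner (α x) (contract (dualField φ j x) (formCov cov θ x (coordField φ j x)))) := by
    rw [mvfderiv_mul_apply hU (contMDiffOn_volDensity hφ) (contMDiffOn_extInner hU hα (hl j)) hx,
      hcov.mvfderiv_volDensity hφ hx, hcov.mvfderiv_extInner hU hx _ hα (hl j),
      formCov_contract hU (hE j) hθ hx, extInner_add_right]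
    ring
  -- The derivatives of the dual frame cancel against the derivative of the density.
  have h2 : ∑ j, extInner (α x) (contract (cov (dualField φ j) x (coordField φ j x)) (θ x))
      = -∑ j, (∑ i, (inner ℝ (dualField φ i x)
          (cov (coordField φ i) x (coordField φ j x)) : ℝ)) *
          extInner (α x) (contract (dualField φ j x) (θ x)) := by
    have hlin : IsLinearMap ℝ fun w ↦ extInner (α x) (contract w (θ x)) :=
      ⟨fun w w' ↦ by rw [(isLinearMap_contract_left _).map_add, extInner_add_right],
        fun a w ↦ by rw [(isLinearMap_contract_left _).map_smul, extInner_smul_right, smul_eq_mul]⟩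
    have h3 (j : Fin n) : extInner (α x)
        (contract (cov (dualField φ j) x (coordField φ j x)) (θ x))
        = ∑ k, -((inner ℝ (dualField φ j x) (cov (coordField φ j) x (coordField φ k x)) : ℝ) *
          extInner (α x) (contract (dualField φ k x) (θ x))) := by
      conv_lhs => rw [← sum_inner_coordField hφ hx (cov (dualField φ j) x (coordField φ j x))]
      refine (map_sum (hlin.mk' _) _ _).trans (Finset.sum_congr rfl fun k _ ↦ ?_)
      refine (hlin.map_smul _ _).trans ?_
      have h4 : cov (coordField φ k) x (coordField φ j x)
          = cov (coordField φ j) x (coordField φ k x) := hcov.cov_constField_comm hφ hx _ _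
      have h5 := hcov.inner_cov_dualField_add hφ hx (coordField φ j x) j k
      rw [h4, real_inner_comm] at h5
      rw [eq_neg_of_add_eq_zero_left h5, neg_smul, smul_eq_mul]
    simp only [h3, Finset.sum_neg_distrib, Finset.sum_mul]
    rw [Finset.sum_comm]
  simp only [h1, ← Finset.mul_sum, Finset.sum_add_distrib, h2]
  rw [hcov.extD_eq_sum_dual hU hα hx _ _ (sum_inner_dualField hφ hx),
    codiffCov_eq_sum_dual hU hθ hx _ _ (sum_inner_dualField hφ hx), extInner_neg_right,
    extInner_sum_left, extInner_sum_right]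
  simp only [extInner_wedgeDual]
  ring

end Divergence

/-! ### The coderivative `δ = d*` -/

section CompactSupport

variable {n : ℕ} {M : Type*} [TopologicalSpace M] {φ : OpenPartialHomeomorph M (Model n)}
  {K : Set M}

/-- Off the image of `K`, a function supported in `K ⊆ φ.source` vanishes near every point of the
model space, after extension by zero outside the chart; in particular near the boundary of the
chart. -/
theorem indicator_chart_eventuallyEq_zero (hK : IsCompact K) (hKφ : K ⊆ φ.source) {h : M → ℝ}
    (h0 : ∀ x ∉ K, h x = 0) {y : Model n} (hy : y ∉ φ '' K) :
    φ.target.indicator (fun y ↦ h (φ.symm y)) =ᶠ[𝓝 y] fun _ ↦ 0 := by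
  have hKc : IsClosed (φ '' K) := (hK.image_of_continuousOn (φ.continuousOn.mono hKφ)).isClosed
  refine Filter.eventually_of_mem (hKc.isOpen_compl.mem_nhds hy) fun z hz ↦ ?_
  by_cases hzt : z ∈ φ.target
  · rw [indicator_of_mem hzt]
    exact h0 _ fun hzK ↦ hz ⟨_, hzK, φ.right_inv hzt⟩
  · exact indicator_of_notMem hzt _

theorem indicator_chart_eventuallyEq {h : M → ℝ} {y : Model n} (hy : y ∈ φ.target) :
    φ.target.indicator (fun y ↦ h (φ.symm y)) =ᶠ[𝓝 y] fun y ↦ h (φ.symm y) :=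
  Filter.eventually_of_mem (φ.open_target.mem_nhds hy) fun _ hz ↦ indicator_of_mem hz _

theorem hasCompactSupport_indicator_chart (hK : IsCompact K) (hKφ : K ⊆ φ.source) {h : M → ℝ}
    (h0 : ∀ x ∉ K, h x = 0) : HasCompactSupport (φ.target.indicator fun y ↦ h (φ.symm y)) :=
  HasCompactSupport.intro (hK.image_of_continuousOn (φ.continuousOn.mono hKφ)) fun _ hy ↦
    (indicator_chart_eventuallyEq_zero hK hKφ h0 hy).self_of_nhds

variable [ChartedSpace (Model n) M]

theorem contDiff_indicator_chart (hφ : φ ∈ Charts n M) (hK : IsCompact K) (hKφ : K ⊆ φ.source)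
    {h : M → ℝ} (hh : ContMDiffOn 𝓘(ℝ, Model n) 𝓘(ℝ, ℝ) ∞ h φ.source) (h0 : ∀ x ∉ K, h x = 0) :
    ContDiff ℝ ∞ (φ.target.indicator fun y ↦ h (φ.symm y)) := by
  refine contDiff_iff_contDiffAt.2 fun y ↦ ?_
  by_cases hy : y ∈ φ.target
  · have h1 := contDiffOn_comp_chart_symm hφ (f := h) (U := univ) (by simpa using hh)
    refine ContDiffAt.congr_of_eventuallyEq ?_ (indicator_chart_eventuallyEq hy)
    exact h1.contDiffAt (by simpa using φ.open_target.mem_nhds hy)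
  · refine ContDiffAt.congr_of_eventuallyEq contDiffAt_const
      (indicator_chart_eventuallyEq_zero hK hKφ h0 ?_)
    rintro ⟨x, hx, rfl⟩
    exact hy (φ.map_source (hKφ hx))

theorem integral_fderiv_eq_zero {H : Model n → ℝ} (hH : ContDiff ℝ ∞ H) (hc : HasCompactSupport H)
    (w : Model n) : ∫ y, fderiv ℝ H y w = 0 := by
  have hd : Continuous fun y ↦ fderiv ℝ H y w :=
    (hH.continuous_fderiv (by simp)).clm_apply continuous_const
  have h := integral_mul_fderiv_eq_neg_fderiv_mul_of_integrable (μ := MeasureTheory.volume)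
    (f := fun _ : Model n ↦ (1 : ℝ)) (g := H) (v := w) (by simp)
    (by simpa using hd.integrable_of_hasCompactSupport (hc.fderiv_apply (𝕜 := ℝ) w))
    (by simpa using hH.continuous.integrable_of_hasCompactSupport hc)
    (fun _ _ ↦ differentiableAt_const _) (fun x _ ↦ hH.differentiable (by simp) x)
  simpa using h

theorem integral_mvfderiv_coordField_eq_zero (hφ : φ ∈ Charts n M) (hK : IsCompact K)
    (hKφ : K ⊆ φ.source) {h : M → ℝ} (hh : ContMDiffOn 𝓘(ℝ, Model n) 𝓘(ℝ, ℝ) ∞ h φ.source)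
    (h0 : ∀ x ∉ K, h x = 0) (j : Fin n) :
    MeasureTheory.Integrable (φ.target.indicator fun y ↦
      mvfderiv 𝓘(ℝ, Model n) h (φ.symm y) (coordField φ j (φ.symm y))) ∧
    ∫ y, φ.target.indicator (fun y ↦
      mvfderiv 𝓘(ℝ, Model n) h (φ.symm y) (coordField φ j (φ.symm y))) y = 0 := by
  have hH := contDiff_indicator_chart hφ hK hKφ hh h0
  have hc := hasCompactSupport_indicator_chart hK hKφ h0
  have hd : Continuous fun y ↦ fderiv ℝ (φ.target.indicator fun y ↦ h (φ.symm y)) y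
      (EuclideanSpace.single j 1) := (hH.continuous_fderiv (by simp)).clm_apply continuous_const
  have h1 : (φ.target.indicator fun y ↦
      mvfderiv 𝓘(ℝ, Model n) h (φ.symm y) (coordField φ j (φ.symm y)))
      = fun y ↦ fderiv ℝ (φ.target.indicator fun y ↦ h (φ.symm y)) y
        (EuclideanSpace.single j 1) := by
    funext y
    by_cases hy : y ∈ φ.target
    · have hx := φ.map_target hy
      rw [indicator_of_mem hy, mvfderiv_eq_fderiv hφ hx
        (ContMDiffOn.mdifferentiableAt_of_isOpen φ.open_source hh hx), φ.right_inv hy,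
        (indicator_chart_eventuallyEq hy).fderiv_eq, coordField_eq_constField,
        chartD_constField hφ hx]
    · rw [indicator_of_notMem hy, (indicator_chart_eventuallyEq_zero hK hKφ h0 _).fderiv_eq]
      · simp
      · rintro ⟨x, hx, rfl⟩
        exact hy (φ.map_source (hKφ hx))
  rw [h1]
  exact ⟨hd.integrable_of_hasCompactSupport (hc.fderiv_apply (𝕜 := ℝ) _),
    integral_fderiv_eq_zero hH hc _⟩

end CompactSupport

section Codiff

variable {n : ℕ} {M : Type*} [TopologicalSpace M] [ChartedSpace (Model n) M]
  [RiemannianBundle (fun x : M ↦ TangentSpace 𝓘(ℝ, Model n) x)]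
  {φ : OpenPartialHomeomorph M (Model n)} {K : Set M}

theorem chartIntegral_eq (φ : OpenPartialHomeomorph M (Model n)) (f : M → ℝ) :
    chartIntegral φ f = ∫ y, φ.target.indicator
      (fun y ↦ (fun x ↦ f x * volDensity φ x) (φ.symm y)) y :=
  (MeasureTheory.integral_indicator φ.open_target.measurableSet).symm

variable [IsManifold 𝓘(ℝ, Model n) ∞ M]

theorem formCov_zero (cov : TConn n M) (x : M) (u : TSp n x) :
    formCov cov (fun _ ↦ 0) x u = 0 := by
  simpa using formCov_const_smul (cov := cov) 0 isOpen_univ (DForm.smoothOn_zero univ)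
    (mem_univ x) u

variable [IsContMDiffRiemannianBundle 𝓘(ℝ, Model n) ∞ (Model n)
    (fun x : M ↦ TangentSpace 𝓘(ℝ, Model n) x)]

theorem integrable_chart (hφ : φ ∈ Charts n M) (hK : IsCompact K) (hKφ : K ⊆ φ.source) {f : M → ℝ}
    (hf : ContMDiffOn 𝓘(ℝ, Model n) 𝓘(ℝ, ℝ) ∞ f φ.source) (h0 : ∀ x ∉ K, f x = 0) :
    MeasureTheory.Integrable (φ.target.indicator
      (fun y ↦ (fun x ↦ f x * volDensity φ x) (φ.symm y))) := by
  have h0' : ∀ x ∉ K, f x * volDensity φ x = 0 := fun x hx ↦ by rw [h0 x hx, zero_mul]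
  exact (contDiff_indicator_chart hφ hK hKφ (hf.mul (contMDiffOn_volDensity hφ))
    h0').continuous.integrable_of_hasCompactSupport (hasCompactSupport_indicator_chart hK hKφ h0')

theorem chartIntegral_sub (hφ : φ ∈ Charts n M) (hK : IsCompact K) (hKφ : K ⊆ φ.source)
    {f g : M → ℝ} (hf : ContMDiffOn 𝓘(ℝ, Model n) 𝓘(ℝ, ℝ) ∞ f φ.source) (hf0 : ∀ x ∉ K, f x = 0)
    (hg : ContMDiffOn 𝓘(ℝ, Model n) 𝓘(ℝ, ℝ) ∞ g φ.source) (hg0 : ∀ x ∉ K, g x = 0) :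
    chartIntegral φ f - chartIntegral φ g = chartIntegral φ fun x ↦ f x - g x := by
  rw [chartIntegral_eq, chartIntegral_eq, chartIntegral_eq, ← MeasureTheory.integral_sub
    (integrable_chart hφ hK hKφ hf hf0) (integrable_chart hφ hK hKφ hg hg0)]
  congr 1
  funext y
  by_cases hy : y ∈ φ.target
  · simp only [indicator_of_mem hy, sub_mul]
  · simp only [indicator_of_notMem hy, sub_zero]

variable {cov : TConn n M} {θ : DForm n M}

theorem IsLeviCivita.extD_eq_zero (hcov : IsLeviCivita cov) {U : Set M} (hU : IsOpen U)
    (h0 : ∀ x ∈ U, θ x = 0) {x : M} (hx : x ∈ U) : extD θ x = 0 := by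
  have hs : DForm.SmoothOn θ U := (DForm.smoothOn_zero U).congr h0
  rw [hcov.extD_eq_sum_dual hU hs hx _ _ (sum_inner_smul_orthonormalBasis
    (stdOrthonormalBasis ℝ (TSp n x)))]
  refine Finset.sum_eq_zero fun a _ ↦ ?_
  rw [formCov_congr hU (DForm.smoothOn_zero U) h0 hx, formCov_zero, map_zero]

/-- `-∑ l(e_a) ∇_{e_a}` is a formal adjoint of `d`, by the divergence theorem in a chart. -/
theorem IsLeviCivita.isCodiff_codiffCov [T2Space M] (hcov : IsLeviCivita cov)
    (hθ : θ.SmoothOn univ) : IsCodiff θ (codiffCov cov θ) := by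
  refine ⟨hcov.smoothOn_codiffCov isOpen_univ hθ, fun φ hφ α hα ⟨K, hK, hKφ, h0⟩ ↦ ?_⟩
  have hαφ := hα.mono (subset_univ φ.source)
  have hθφ := hθ.mono (subset_univ φ.source)
  have hU := φ.open_source
  have hd0 (x : M) (hx : x ∉ K) : extD α x = 0 :=
    hcov.extD_eq_zero hK.isClosed.isOpen_compl (fun y hy ↦ h0 y hy) hx
  rw [← sub_eq_zero, chartIntegral_sub hφ hK hKφ
    (contMDiffOn_extInner hU (hcov.smoothOn_extD hU hαφ) hθφ)
    (fun x hx ↦ by rw [hd0 x hx, extInner_zero_left])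
    (contMDiffOn_extInner hU hαφ (hcov.smoothOn_codiffCov hU hθφ))
    (fun x hx ↦ by rw [h0 x hx, extInner_zero_left]), chartIntegral_eq]
  have hj (j : Fin n) := integral_mvfderiv_coordField_eq_zero hφ hK hKφ
    (h := fun x ↦ volDensity φ x * extInner (α x) (contract (dualField φ j x) (θ x)))
    ((contMDiffOn_volDensity hφ).mul
      (contMDiffOn_extInner hU hαφ (hθφ.contract hU (smoothOn_dualField hφ j))))
    (fun x hx ↦ by rw [h0 x hx, extInner_zero_left, mul_zero]) j
  have hsum : φ.target.indicator (fun y ↦ (fun x ↦ (extInner (extD α x) (θ x)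
      - extInner (α x) (codiffCov cov θ x)) * volDensity φ x) (φ.symm y))
      = fun y ↦ ∑ j, φ.target.indicator (fun y ↦ mvfderiv 𝓘(ℝ, Model n)
        (fun x ↦ volDensity φ x * extInner (α x) (contract (dualField φ j x) (θ x)))
        (φ.symm y) (coordField φ j (φ.symm y))) y := by
    funext y
    by_cases hy : y ∈ φ.target
    · simp only [indicator_of_mem hy]
      rw [hcov.sum_mvfderiv_volDensity_mul_extInner hφ (φ.map_target hy) hαφ hθφ, mul_comm]
    · simp only [indicator_of_notMem hy, Finset.sum_const_zero]
  rw [hsum, MeasureTheory.integral_finsetSum _ fun j _ ↦ (hj j).1]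
  exact Finset.sum_eq_zero fun j _ ↦ (hj j).2

/-- The formal adjoint of `d` is unique, by the fundamental lemma of the calculus of variations. -/
theorem IsCodiff.unique [T2Space M] {η₁ η₂ : DForm n M} (h₁ : IsCodiff θ η₁)
    (h₂ : IsCodiff θ η₂) : η₁ = η₂ := by
  funext x
  by_contra hne
  have hφ := chartAt_mem_charts (n := n) x
  have hxφ : x ∈ (chartAt (Model n) x).source := mem_chart_source _ x
  set φ := chartAt (Model n) x
  let χ : SmoothBumpFunction 𝓘(ℝ, Model n) x := Classical.arbitrary _
  have hχ : ContMDiffOn 𝓘(ℝ, Model n) 𝓘(ℝ, ℝ) ∞ χ univ := χ.contMDiff.contMDiffOn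
  have hd : DForm.SmoothOn (fun y ↦ η₁ y - η₂ y) univ := h₁.1.sub isOpen_univ h₂.1
  let α : DForm n M := fun y ↦ χ y • (η₁ y - η₂ y)
  have hα : α.SmoothOn univ := DForm.SmoothOn.smul isOpen_univ hχ hd
  have hK : IsCompact (tsupport χ) := χ.hasCompactSupport
  have hKφ : tsupport χ ⊆ φ.source := χ.tsupport_subset_chartAt_source
  have h0 : ∀ y ∉ tsupport χ, α y = 0 := fun y hy ↦ by
    simp only [α]
    rw [image_eq_zero_of_notMem_tsupport hy, zero_smul]
  have hαφ := hα.mono (subset_univ φ.source)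
  have hs {η : DForm n M} (hη : η.SmoothOn univ) := contMDiffOn_extInner φ.open_source hαφ
    (hη.mono (subset_univ φ.source))
  have h0' (η : DForm n M) : ∀ y ∉ tsupport χ, extInner (α y) (η y) = 0 := fun y hy ↦ by
    rw [h0 y hy, extInner_zero_left]
  -- Test with `α = χ (η₁ - η₂)` for a bump function `χ` at `x`.
  have h := (h₁.2 φ hφ α hα ⟨_, hK, hKφ, h0⟩).symm.trans (h₂.2 φ hφ α hα ⟨_, hK, hKφ, h0⟩)
  rw [← sub_eq_zero, chartIntegral_sub hφ hK hKφ (hs h₁.1) (h0' _) (hs h₂.1) (h0' _)] at h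
  have e (y : M) : extInner (α y) (η₁ y) - extInner (α y) (η₂ y)
      = χ y * extInner (η₁ y - η₂ y) (η₁ y - η₂ y) := by
    rw [← extInner_sub_right, extInner_smul_left]
  simp only [e] at h
  rw [chartIntegral_eq] at h
  have hzero : ∀ y ∉ tsupport χ,
      χ y * extInner (η₁ y - η₂ y) (η₁ y - η₂ y) * volDensity φ y = 0 := fun y hy ↦ by
    rw [image_eq_zero_of_notMem_tsupport hy, zero_mul, zero_mul]
  have hd' := hd.mono (subset_univ φ.source)
  have hpos := Continuous.integral_pos_of_hasCompactSupport_nonneg_nonzero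
    (μ := MeasureTheory.volume) (x := φ x) (contDiff_indicator_chart hφ hK hKφ
      (((hχ.mono (subset_univ φ.source)).mul (contMDiffOn_extInner φ.open_source hd' hd')).mul
        (contMDiffOn_volDensity hφ)) hzero).continuous
    (hasCompactSupport_indicator_chart hK hKφ hzero)
    (fun y ↦ indicator_nonneg (fun z hz ↦ mul_nonneg (mul_nonneg χ.nonneg
      (extInner_self_nonneg _)) (volDensity_pos hφ (φ.map_target hz)).le) y)
    (by
      rw [indicator_of_mem (φ.map_source hxφ)]
      simp only [φ.left_inv hxφ]
      refine mul_ne_zero (mul_ne_zero ?_ ?_) (volDensity_pos hφ hxφ).ne'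
      · rw [χ.eq_one]
        exact one_ne_zero
      · exact fun h ↦ hne (sub_eq_zero.1 (eq_zero_of_extInner_self _ h)))
  exact hpos.ne' h

theorem IsLeviCivita.codiff_eq [T2Space M] (hcov : IsLeviCivita cov) (hθ : θ.SmoothOn univ) :
    codiff θ = codiffCov cov θ := by
  have h : ∃ η : DForm n M, IsCodiff θ η := ⟨_, hcov.isCodiff_codiffCov hθ⟩
  rw [codiff, dif_pos h]
  exact h.choose_spec.unique (hcov.isCodiff_codiffCov hθ)

theorem IsLeviCivita.opD_eq [T2Space M] (hcov : IsLeviCivita cov) (v : VField n M)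
    (hθ : θ.SmoothOn univ) :
    opD v θ = fun x ↦ dirac cov θ x + contract (v x) (θ x) := by
  funext x
  rw [opD, hcov.codiff_eq hθ, hcov.extD_add_codiffCov isOpen_univ hθ (mem_univ x)]

theorem IsLeviCivita.opDStar_eq [T2Space M] (hcov : IsLeviCivita cov) (v : VField n M)
    (hθ : θ.SmoothOn univ) :
    opDStar v θ = fun x ↦ dirac cov θ x + wedgeDual (v x) (θ x) := by
  funext x
  rw [opDStar, hcov.codiff_eq hθ, hcov.extD_add_codiffCov isOpen_univ hθ (mem_univ x)]

end Codiff

/-! ### The connection of a Laplace type operator -/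

section LaplaceConnection

variable {n : ℕ} {M : Type*} [TopologicalSpace M] [ChartedSpace (Model n) M]
  [RiemannianBundle (fun x : M ↦ TangentSpace 𝓘(ℝ, Model n) x)]

theorem end_apply_combination {ι W : Type*} [Fintype ι] [AddCommGroup W] [Module ℝ W]
    (a b c d : ℝ) (R S A B : Module.End ℝ W) (C A' B' : ι → Module.End ℝ W) (w : W) :
    (a • R - b • (1 : Module.End ℝ W) - B * A - c • S + d • ∑ j, (B' j * C j - C j * A' j)) w
      = a • R w - b • w - B (A w) - c • S w + d • ∑ j, (B' j (C j w) - C j (A' j w)) := by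
  simp

theorem exists_orthonormal (x : M) : ∃ e : Fin n → TSp n x, Orthonormal ℝ e := by
  have h : Module.finrank ℝ (TSp n x) = n := finrank_euclideanSpace_fin (𝕜 := ℝ)
  exact ⟨_, ((stdOrthonormalBasis ℝ (TSp n x)).reindex (finCongr h)).orthonormal⟩

variable [IsManifold 𝓘(ℝ, Model n) ∞ M] {nab : FormOp n M} {θ : DForm n M} {x : M} {cov : TConn n M}

theorem IsFormConnection.isLinearMap (h : IsFormConnection nab) (hθ : θ.SmoothOn univ) :
    IsLinearMap ℝ (nab θ x) := by
  have hl := h.linear univ isOpen_univ θ hθ x (mem_univ x)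
  have h0 : nab θ x 0 = 0 := by simpa using hl 1 0 0
  exact ⟨fun u w ↦ by simpa using hl 1 u w, fun a u ↦ by simpa [h0] using hl a u 0⟩

/-- The Laplacian of a connection is a second order operator, whose first order part along
`grad f` is twice the connection. -/
theorem IsFormConnection.connLaplacian_smul (h : IsFormConnection nab)
    {φ : OpenPartialHomeomorph M (Model n)} (hφ : φ ∈ Charts n M) (hx : x ∈ φ.source)
    (hθ : θ.SmoothOn univ) {f : M → ℝ} (hf : ContMDiffOn 𝓘(ℝ, Model n) 𝓘(ℝ, ℝ) ∞ f univ) :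
    connLaplacian cov nab φ (fun y ↦ f y • θ y) x = f x • connLaplacian cov nab φ θ x
      + (2 : ℝ) • ∑ i, mvfderiv 𝓘(ℝ, Model n) f x (coordField φ i x) • nab θ x (dualField φ i x)
      + (∑ i, ∑ j, (metricMatrix φ x)⁻¹ i j * (mvfderiv 𝓘(ℝ, Model n)
          (fun y ↦ mvfderiv 𝓘(ℝ, Model n) f y (coordField φ j y)) x (coordField φ i x)
        - mvfderiv 𝓘(ℝ, Model n) f x (cov (coordField φ j) x (coordField φ i x)))) • θ x := by
  have hU := φ.open_source
  have hθφ := hθ.mono (subset_univ φ.source)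
  have hfφ := hf.mono (subset_univ φ.source)
  have hlin := h.isLinearMap (x := x) hθ
  have h1 (j : Fin n) : nab (fun y ↦ nab (fun y ↦ f y • θ y) y (coordField φ j y)) x
      = nab ((fun y ↦ f y • nab θ y (coordField φ j y))
        + fun y ↦ mvfderiv 𝓘(ℝ, Model n) f y (coordField φ j y) • θ y) x := by
    congr 1
    funext y
    exact h.leibniz univ isOpen_univ θ hθ f hf y (mem_univ y) _
  have hη (j : Fin n) := h.smooth _ hU θ hθφ _ (smoothOn_coordField hφ j)
  have hdf (j : Fin n) := contMDiffOn_mvfderiv_apply hU hfφ (smoothOn_coordField hφ j)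
  have h2 (i j : Fin n) : nab (fun y ↦ nab (fun y ↦ f y • θ y) y (coordField φ j y)) x
        (coordField φ i x) - nab (fun y ↦ f y • θ y) x (cov (coordField φ j) x (coordField φ i x))
      = f x • (nab (fun y ↦ nab θ y (coordField φ j y)) x (coordField φ i x)
          - nab θ x (cov (coordField φ j) x (coordField φ i x)))
        + (mvfderiv 𝓘(ℝ, Model n) f x (coordField φ i x) • nab θ x (coordField φ j x)
          + mvfderiv 𝓘(ℝ, Model n) f x (coordField φ j x) • nab θ x (coordField φ i x))
        + (mvfderiv 𝓘(ℝ, Model n)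
            (fun y ↦ mvfderiv 𝓘(ℝ, Model n) f y (coordField φ j y)) x (coordField φ i x)
          - mvfderiv 𝓘(ℝ, Model n) f x (cov (coordField φ j) x (coordField φ i x))) • θ x := by
    rw [h1, h.add _ hU _ _ (DForm.SmoothOn.smul hU hfφ (hη j))
      (DForm.SmoothOn.smul hU (hdf j) hθφ) x hx, h.leibniz _ hU _ (hη j) f hfφ x hx,
      h.leibniz _ hU _ hθφ _ (hdf j) x hx, h.leibniz _ hU _ hθφ f hfφ x hx]
    module
  have hdual (i : Fin n) : nab θ x (dualField φ i x)
      = ∑ j, (metricMatrix φ x)⁻¹ i j • nab θ x (coordField φ j x) := by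
    refine (map_sum (hlin.mk' _) _ _).trans (Finset.sum_congr rfl fun j _ ↦ ?_)
    exact hlin.map_smul _ _
  have hsymm (i j : Fin n) : (metricMatrix φ x)⁻¹ i j = (metricMatrix φ x)⁻¹ j i := by
    rw [← inner_dualField_dualField hφ hx, ← inner_dualField_dualField hφ hx, real_inner_comm]
  have h3 : ∑ i, ∑ j, (metricMatrix φ x)⁻¹ i j •
      (mvfderiv 𝓘(ℝ, Model n) f x (coordField φ i x) • nab θ x (coordField φ j x)
        + mvfderiv 𝓘(ℝ, Model n) f x (coordField φ j x) • nab θ x (coordField φ i x))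
      = (2 : ℝ) • ∑ i, mvfderiv 𝓘(ℝ, Model n) f x (coordField φ i x)
        • nab θ x (dualField φ i x) := by
    simp only [smul_add, Finset.sum_add_distrib]
    rw [two_smul]
    simp only [hdual, Finset.smul_sum]
    congr 1
    · refine Finset.sum_congr rfl fun i _ ↦ Finset.sum_congr rfl fun j _ ↦ smul_comm _ _ _
    · rw [Finset.sum_comm]
      refine Finset.sum_congr rfl fun i _ ↦ Finset.sum_congr rfl fun j _ ↦ ?_
      rw [hsymm, smul_comm]
  rw [← h3]
  simp only [connLaplacian, h2, smul_add, Finset.sum_add_distrib, Finset.smul_sum, Finset.sum_smul,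
    mul_smul]
  congr 2
  exact Finset.sum_congr rfl fun i _ ↦ Finset.sum_congr rfl fun j _ ↦ smul_comm _ _ _

theorem IsLaplaceConnection.apply_smul {P : DForm n M → DForm n M}
    (h : IsLaplaceConnection cov P nab) {φ : OpenPartialHomeomorph M (Model n)}
    (hφ : φ ∈ Charts n M) (hx : x ∈ φ.source) (hθ : θ.SmoothOn univ) {f : M → ℝ}
    (hf : ContMDiffOn 𝓘(ℝ, Model n) 𝓘(ℝ, ℝ) ∞ f univ) :
    (2 : ℝ) • ∑ i, mvfderiv 𝓘(ℝ, Model n) f x (coordField φ i x) • nab θ x (dualField φ i x)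
      = f x • P θ x - P (fun y ↦ f y • θ y) x
      - (∑ i, ∑ j, (metricMatrix φ x)⁻¹ i j * (mvfderiv 𝓘(ℝ, Model n)
          (fun y ↦ mvfderiv 𝓘(ℝ, Model n) f y (coordField φ j y)) x (coordField φ i x)
        - mvfderiv 𝓘(ℝ, Model n) f x (cov (coordField φ j) x (coordField φ i x)))) • θ x := by
  obtain ⟨hn, F, hF⟩ := h
  rw [hF θ hθ φ hφ x hx, hF _ (DForm.SmoothOn.smul isOpen_univ hf hθ) φ hφ x hx,
    hn.connLaplacian_smul hφ hx hθ hf, map_smul]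
  module

/-- The connection of a Laplace type operator `P` is determined by `P`: the commutators of `P` with
functions `f` are its values along `grad f`, and every tangent vector is a gradient. -/
theorem IsLaplaceConnection.unique [T2Space M] {P : DForm n M → DForm n M} {nab' : FormOp n M}
    (h : IsLaplaceConnection cov P nab) (h' : IsLaplaceConnection cov P nab')
    (hθ : θ.SmoothOn univ) : nab' θ = nab θ := by
  funext x u
  have hφ := chartAt_mem_charts (n := n) x
  have hxφ : x ∈ (chartAt (Model n) x).source := mem_chart_source _ x
  have hdual (k : Fin n) : nab' θ x (dualField (chartAt (Model n) x) k x)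
      = nab θ x (dualField (chartAt (Model n) x) k x) := by
    let χ : SmoothBumpFunction 𝓘(ℝ, Model n) x := Classical.arbitrary _
    have hcoord : ContMDiffOn 𝓘(ℝ, Model n) 𝓘(ℝ, ℝ) ∞ (fun y ↦ chartAt (Model n) x y k)
        (chartAt (Model n) x).source := by
      have h := contMDiffOn_comp_chart hφ (f := fun z : Model n ↦ z k) (U := univ)
        (EuclideanSpace.proj (𝕜 := ℝ) k).contDiff.contDiffOn
      simpa using h
    -- The cut-off coordinate function `χ φ_k` has gradient `E^k` at `x`.
    have hf : ContMDiffOn 𝓘(ℝ, Model n) 𝓘(ℝ, ℝ) ∞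
        (fun y ↦ χ y • chartAt (Model n) x y k) univ :=
      (χ.contMDiff_smul hcoord).contMDiffOn
    have hd (i : Fin n) : mvfderiv 𝓘(ℝ, Model n) (fun y ↦ χ y • chartAt (Model n) x y k) x
        (coordField (chartAt (Model n) x) i x) = if i = k then 1 else 0 := by
      have h1 : (fun y ↦ χ y • chartAt (Model n) x y k)
          =ᶠ[𝓝 x] fun y ↦ chartAt (Model n) x y k := by
        filter_upwards [χ.eventuallyEq_one] with y hy
        rw [hy]
        simp
      rw [mvfderiv_congr h1, mvfderiv_comp_chart (f := fun z : Model n ↦ z k) hφ hxφ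
        (EuclideanSpace.proj (𝕜 := ℝ) k).differentiableAt]
      refine Eq.trans ?_ (chartD_coordField hφ hxφ i k)
      exact congrArg (fun T : Model n →L[ℝ] ℝ ↦ T (chartD (chartAt (Model n) x) x
        (coordField (chartAt (Model n) x) i x))) (EuclideanSpace.proj (𝕜 := ℝ) k).fderiv
    have e := (h'.apply_smul hφ hxφ hθ hf).trans (h.apply_smul hφ hxφ hθ hf).symm
    simp only [hd, ite_smul, one_smul, zero_smul, Finset.sum_ite_eq', Finset.mem_univ,
      if_true] at e
    exact smul_right_injective _ (two_ne_zero' ℝ) e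
  have hl := h.1.isLinearMap (x := x) hθ
  have hl' := h'.1.isLinearMap (x := x) hθ
  rw [← sum_inner_coordField hφ hxφ u]
  refine (map_sum (hl'.mk' _) _ _).trans (Eq.trans ?_ (map_sum (hl.mk' _) _ _).symm)
  refine Finset.sum_congr rfl fun k _ ↦ ?_
  exact (hl'.map_smul _ _).trans (Eq.trans (by rw [hdual k]) (hl.map_smul _ _).symm)

variable [IsContMDiffRiemannianBundle 𝓘(ℝ, Model n) ∞ (Model n)
    (fun x : M ↦ TangentSpace 𝓘(ℝ, Model n) x)]
  {A B : (x : M) → Module.End ℝ (Ext (TSp n x))}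
  {A' B' : (x : M) → TSp n x → Module.End ℝ (Ext (TSp n x))}

/-- The connection of `(D + B) (D + A)`, where `D = d + δ`. -/
theorem IsLeviCivita.isUniqueLaplaceConnection_twistedCov [T2Space M] (hcov : IsLeviCivita cov)
    (hA : HasCovDeriv cov A A') (hB : HasCovDeriv cov B B') {P : DForm n M → DForm n M}
    (hP : ∀ θ : DForm n M, θ.SmoothOn univ → ∀ x, P θ x
      = dirac cov (fun y ↦ dirac cov θ y + A y (θ y)) x + B x (dirac cov θ x + A x (θ x))) :
    IsUniqueLaplaceConnection cov P (twistedCov cov A B) := by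
  have h : IsLaplaceConnection cov P (twistedCov cov A B) := by
    choose e he using fun x : M ↦ exists_orthonormal (n := n) x
    refine ⟨hcov.isFormConnection_twistedCov hA hB, fun x ↦
      (1 / 8 : ℝ) • curvClifford cov x (e x)
      - ((1 / 4 : ℝ) * scalarCurv cov x) • (1 : Module.End ℝ (Ext (TSp n x))) - B x * A x
      - (1 / 4 : ℝ) • (∑ i, (cliff (e x i) * A x + B x * cliff (e x i)) ^ 2)
      + (1 / 2 : ℝ) • ∑ j, (B' x (e x j) * cliff (e x j) - cliff (e x j) * A' x (e x j)),
      fun θ hθ φ hφ x hx ↦ ?_⟩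
    rw [hP θ hθ, hcov.twisted_weitzenboeck hA hB hφ (hθ.mono (subset_univ _)) hx (he x)]
    rw [end_apply_combination]
    module
  exact ⟨h, fun nab' h' θ hθ ↦ h.unique h' hθ⟩

/-- The Weitzenböck formula for `(D + B) (D + A)` in a local orthonormal frame. -/
theorem IsLeviCivita.twisted_weitzenboeck_frame (hcov : IsLeviCivita cov)
    (hA : HasCovDeriv cov A A') (hB : HasCovDeriv cov B B') {φ : OpenPartialHomeomorph M (Model n)}
    (hφ : φ ∈ Charts n M) {e : Fin n → VField n M} {U : Set M} (he : IsOrthonormalFrame e U)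
    (hθ : θ.SmoothOn univ) (hx : x ∈ φ.source ∩ U) :
    dirac cov (fun y ↦ dirac cov θ y + A y (θ y)) x + B x (dirac cov θ x + A x (θ x))
      = -connLaplacian cov (twistedCov cov A B) φ θ x
        - (1 / 8 : ℝ) • curvClifford cov x (fun i ↦ e i x) (θ x)
        + ((1 / 4 : ℝ) * scalarCurv cov x) • θ x
        + B x (A x (θ x))
        + (1 / 4 : ℝ) • (∑ i, (cliff (e i x) * A x + B x * cliff (e i x)) ^ 2) (θ x)
        - (1 / 2 : ℝ) • ∑ j, (endCov cov B x (e j x) (fun y ↦ cliff (e j y) (θ y))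
          - cliff (e j x) (endCov cov A x (e j x) θ)) := by
  rw [hcov.twisted_weitzenboeck hA hB hφ (hθ.mono (subset_univ _)) hx.1 (he.orthonormal x hx.2)]
  congr 2
  refine Finset.sum_congr rfl fun j _ ↦ ?_
  have hθU := hθ.mono (subset_univ U)
  rw [hA.endCov_eq he.isOpen hθU hx.2,
    hB.endCov_eq he.isOpen (DForm.SmoothOn.cliff he.isOpen (he.smooth j) hθU) hx.2]

end LaplaceConnection

section SquareZero

variable {V : Type*} [NormedAddCommGroup V] [InnerProductSpace ℝ V]

theorem contract_contract_self (v : V) (η : Ext V) : contract v (contract v η) = 0 := by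
  have h : (2 : ℝ) • contract v (contract v η) = 0 := by
    rw [two_smul]
    exact congrArg (fun T : Module.End ℝ (Ext V) ↦ T η) (contract_anticomm v v)
  exact (smul_eq_zero.1 h).resolve_left two_ne_zero

theorem wedgeDual_wedgeDual_self (v : V) (η : Ext V) : wedgeDual v (wedgeDual v η) = 0 := by
  have h : (2 : ℝ) • wedgeDual v (wedgeDual v η) = 0 := by
    rw [two_smul]
    exact congrArg (fun T : Module.End ℝ (Ext V) ↦ T η) (wedgeDual_anticomm v v)
  exact (smul_eq_zero.1 h).resolve_left two_ne_zero

end SquareZero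

end StatHodge

end

theorem theorem2p1 {n : ℕ} {M : Type*} [TopologicalSpace M] [T2Space M]
    [ChartedSpace (Model n) M] [IsManifold 𝓘(ℝ, Model n) ∞ M]
    [RiemannianBundle (fun x : M ↦ TangentSpace 𝓘(ℝ, Model n) x)]
    [IsContMDiffRiemannianBundle 𝓘(ℝ, Model n) ∞ (Model n)
      (fun x : M ↦ TangentSpace 𝓘(ℝ, Model n) x)]
    (cov : TConn n M) (hcov : IsLeviCivita cov) (v : VField n M) (hv : v.SmoothOn univ) :
    -- the operator `D_v ^ 2`
    (IsUniqueLaplaceConnection cov (fun θ ↦ opD v (opD v θ))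
        (twistedCov cov (fun x ↦ contract (v x)) (fun x ↦ contract (v x))) ∧
      ∀ φ ∈ Charts n M, ∀ (e : Fin n → VField n M) (U : Set M), IsOrthonormalFrame e U →
      ∀ θ : DForm n M, θ.SmoothOn univ → ∀ x ∈ φ.source ∩ U,
        opD v (opD v θ) x =
          - connLaplacian cov (twistedCov cov (fun x ↦ contract (v x)) (fun x ↦ contract (v x))) φ θ x
          - (1 / 8 : ℝ) • curvClifford cov x (fun i ↦ e i x) (θ x)
          + ((1 / 4 : ℝ) * scalarCurv cov x) • θ x
          + (1 / 4 : ℝ) • (∑ i, (cliff (e i x) * contract (v x) + contract (v x) * cliff (e i x)) ^ 2) (θ x)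
          - (1 / 2 : ℝ) • ∑ j,
            (endCov cov (fun y ↦ contract (v y)) x (e j x) (fun y ↦ cliff (e j y) (θ y))
              - cliff (e j x) (endCov cov (fun y ↦ contract (v y)) x (e j x) θ))) ∧
    -- the operator `(D_v^*) ^ 2`
    (IsUniqueLaplaceConnection cov (fun θ ↦ opDStar v (opDStar v θ))
        (twistedCov cov (fun x ↦ wedgeDual (v x)) (fun x ↦ wedgeDual (v x))) ∧
      ∀ φ ∈ Charts n M, ∀ (e : Fin n → VField n M) (U : Set M), IsOrthonormalFrame e U →
      ∀ θ : DForm n M, θ.SmoothOn univ → ∀ x ∈ φ.source ∩ U,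
        opDStar v (opDStar v θ) x =
          - connLaplacian cov (twistedCov cov (fun x ↦ wedgeDual (v x)) (fun x ↦ wedgeDual (v x))) φ θ x
          - (1 / 8 : ℝ) • curvClifford cov x (fun i ↦ e i x) (θ x)
          + ((1 / 4 : ℝ) * scalarCurv cov x) • θ x
          + (1 / 4 : ℝ) • (∑ i, (cliff (e i x) * wedgeDual (v x) + wedgeDual (v x) * cliff (e i x)) ^ 2) (θ x)
          - (1 / 2 : ℝ) • ∑ j,
            (endCov cov (fun y ↦ wedgeDual (v y)) x (e j x) (fun y ↦ cliff (e j y) (θ y))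
              - cliff (e j x) (endCov cov (fun y ↦ wedgeDual (v y)) x (e j x) θ))) ∧
    -- the operator `D_v^* D_v`
    (IsUniqueLaplaceConnection cov (fun θ ↦ opDStar v (opD v θ))
        (twistedCov cov (fun x ↦ contract (v x)) (fun x ↦ wedgeDual (v x))) ∧
      ∀ φ ∈ Charts n M, ∀ (e : Fin n → VField n M) (U : Set M), IsOrthonormalFrame e U →
      ∀ θ : DForm n M, θ.SmoothOn univ → ∀ x ∈ φ.source ∩ U,
        opDStar v (opD v θ) x =
          - connLaplacian cov (twistedCov cov (fun x ↦ contract (v x)) (fun x ↦ wedgeDual (v x))) φ θ x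
          - (1 / 8 : ℝ) • curvClifford cov x (fun i ↦ e i x) (θ x)
          + ((1 / 4 : ℝ) * scalarCurv cov x) • θ x
          + wedgeDual (v x) (contract (v x) (θ x))
          + (1 / 4 : ℝ) • (∑ i, (cliff (e i x) * contract (v x) + wedgeDual (v x) * cliff (e i x)) ^ 2) (θ x)
          - (1 / 2 : ℝ) • ∑ j,
            (endCov cov (fun y ↦ wedgeDual (v y)) x (e j x) (fun y ↦ cliff (e j y) (θ y))
              - cliff (e j x) (endCov cov (fun y ↦ contract (v y)) x (e j x) θ))) := by
  have hA := hasCovDeriv_contract cov hv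
  have hB := hcov.hasCovDeriv_wedgeDual hv
  have hD {θ : DForm n M} (hθ : θ.SmoothOn univ) := hcov.smoothOn_dirac isOpen_univ hθ
  have h₁ {θ : DForm n M} (hθ : θ.SmoothOn univ) :
      DForm.SmoothOn (fun y ↦ dirac cov θ y + contract (v y) (θ y)) univ :=
    (hD hθ).add isOpen_univ (hA.smoothOn isOpen_univ hθ)
  have h₂ {θ : DForm n M} (hθ : θ.SmoothOn univ) :
      DForm.SmoothOn (fun y ↦ dirac cov θ y + wedgeDual (v y) (θ y)) univ :=
    (hD hθ).add isOpen_univ (hB.smoothOn isOpen_univ hθ)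
  have hP₁ (θ : DForm n M) (hθ : θ.SmoothOn univ) (x : M) : opD v (opD v θ) x =
      dirac cov (fun y ↦ dirac cov θ y + contract (v y) (θ y)) x
        + contract (v x) (dirac cov θ x + contract (v x) (θ x)) := by
    rw [hcov.opD_eq v hθ, hcov.opD_eq v (h₁ hθ)]
  have hP₂ (θ : DForm n M) (hθ : θ.SmoothOn univ) (x : M) : opDStar v (opDStar v θ) x =
      dirac cov (fun y ↦ dirac cov θ y + wedgeDual (v y) (θ y)) x
        + wedgeDual (v x) (dirac cov θ x + wedgeDual (v x) (θ x)) := by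
    rw [hcov.opDStar_eq v hθ, hcov.opDStar_eq v (h₂ hθ)]
  have hP₃ (θ : DForm n M) (hθ : θ.SmoothOn univ) (x : M) : opDStar v (opD v θ) x =
      dirac cov (fun y ↦ dirac cov θ y + contract (v y) (θ y)) x
        + wedgeDual (v x) (dirac cov θ x + contract (v x) (θ x)) := by
    rw [hcov.opD_eq v hθ, hcov.opDStar_eq v (h₁ hθ)]
  refine ⟨⟨hcov.isUniqueLaplaceConnection_twistedCov hA hA hP₁, fun φ hφ e U he θ hθ x hx ↦ ?_⟩,
    ⟨hcov.isUniqueLaplaceConnection_twistedCov hB hB hP₂, fun φ hφ e U he θ hθ x hx ↦ ?_⟩,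
    ⟨hcov.isUniqueLaplaceConnection_twistedCov hA hB hP₃, fun φ hφ e U he θ hθ x hx ↦ ?_⟩⟩
  · refine (hP₁ θ hθ x).trans ((hcov.twisted_weitzenboeck_frame hA hA hφ he hθ hx).trans ?_)
    rw [contract_contract_self, add_zero]
  · refine (hP₂ θ hθ x).trans ((hcov.twisted_weitzenboeck_frame hB hB hφ he hθ hx).trans ?_)
    rw [wedgeDual_wedgeDual_self, add_zero]
  · exact (hP₃ θ hθ x).trans (hcov.twisted_weitzenboeck_frame hA hB hφ he hθ hx)
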